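/- **Trees.** A rooted ordered tree is a finite tree with a root and a linear order on the children of each vertex; a leaf is a non-root vertex without children. If $t$ has $n$ leaves, $\ell_1(t),\dots,\ell_n(t)$ denote its leaves in planar order and $\ell_0(t)=\ell_{n+1}(t)$ its root. For $n\ge 2$ let $\mathcal T_n$ be the set of rooted ordered trees with $n$ leaves, root degree one, and no non-root vertex with exactly one child. For $n,k,l\ge 2$ let $T_{n,k,l}$ be the number of pairs $(t,\ell_i)$ with $t\in\mathcal T_n$ and $1\le i\le n$ such that the path from $\ell_0$ to $\ell_1$ has $k$ edges and the path from $\ell_i$ to $\ell_{i+1}$ has $l$ edges; put $T_{n,k,l}=0$ for all other $n,k,l$, and let $T(x,y,z)=\sum_{n,k,l}T_{n,k,l}x^ny^kz^l$. Let $r=3+2\sqrt2$, $s=(\sqrt2-1)/2$ and $q=(r^2-1)^{1/2}$. **Singular expansions.** For $\varepsilon>0$ and $0<\phi<\pi/2$ let $\delta(\varepsilon,\phi)=\{x\in\mathbb C: |x|\le 1+\varepsilon,\ x\ne 1,\ |\mathrm{Arg}(x-1)|\ge\phi\}$ and $\mathcal R(\varepsilon,\phi)=\{(x,y_1,\dots,y_m)\in\mathbb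 C^{m+1}: x\in\delta(\varepsilon,\phi),\ |y_j|<1 \text{ for all } j\}$. Powers are principal values. "Analytic on" a set means analytic in a neighbourhood of each of its points. Write $f=\widetilde O\big((1-x)^{-\alpha}\prod_j(1-y_j)^{-\beta_j}\big)$ if there are some $\mathcal R=\mathcal R(\varepsilon,\phi)$, $\alpha'\in\mathbb R$, $\beta'\ge0$ and $\gamma\ge0$ such that $f$ is analytic on $\mathcal R$; $|f|=O\big(|1-x|^{-\alpha'}\prod_j(1-|y_j|)^{-\beta'}\big)$ on $\mathcal R$; and $|f|=O\big(|1-x|^{-\alpha}\prod_j(1-|y_j|)^{-\beta_j}\big)$ as $(1-x)(1-y_i)^{-\gamma}\to0$ for all $i$ with $(x,y_1,\dots,y_m)\in\mathcal R$. Write $f\approx c(1-x)^{-\alpha}\prod_j(1-y_j)^{-\beta_j}$ if $c\ne0$ and there are $\alpha'<\alpha$, $\beta'_1,\dots,\beta'_m\ge0$ and functions $C(\mathbf y)$, $C_0(x,\mathbf y),\dots,C_m(x,\mathbf y)$, $E(x,\mathbf y)$ such that, on some $\mathcal R(\varepsilon,\phi)$, $$f(x,\mathbf y)=C(\mathbf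 y)(1-x)^{-\alpha}\prod_j(1-y_j)^{-\beta_j}+\sum_{j=0}^mC_j(x,\mathbf y)+E(x,\mathbf y),$$ where $C$ is analytic and $C(\mathbf y)=c+O\big(\sum_j|1-y_j|\big)$ on $\delta(\varepsilon,\phi)^m$; $C_0$ is a polynomial in $x$ and, for $1\le j\le m$, $C_j$ is a polynomial in $y_j$, in each case with coefficients that are analytic functions of the remaining variables; and $E=\widetilde O\big((1-x)^{-\alpha'}\prod_j(1-y_j)^{-\beta'_j}\big)$. **Proposition.** (i) There is a function $f(x,y,z)$ such that, for $|x|,|y|,|z|<1$, the series $T(x/r,y/2s,z/2s)$ converges absolutely to $f(x,y,z)$, and $$f(x,y,z)\approx 2qs^2(1-x)^{-1/2}(1-y)^{-2}(1-z)^{-2}.$$ (ii) For every $L>0$ there are $M>0$ and $K$ such that, for all $n$ and all $k\ge K$ with $k\le L\log n$, $$\left|T_{n,k,k}-\frac{2qs^2}{\sqrt\pi}\,r^{n-k}n^{-1/2}k^2\right|\le M\,r^{n-k}n^{-1/2}k.$$ -/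

import Mathlib

/-! ### Rooted ordered trees -/

/-- A (finite) rooted ordered tree: a root together with the ordered list of the subtrees that
hang from the children of the root. -/
inductive PlaneTree : Type where
  | node (children : List PlaneTree) : PlaneTree

namespace PlaneTree

/-- The ordered list of the subtrees at the children of the root. -/
def children : PlaneTree → List PlaneTree
  | node ts => ts

/-- The vertices of a tree are addressed by lists of natural numbers: the root is `[]`, and the
`i`-th child (counted from `0`, in the given order) of the vertex `u` is `u ++ [i]`.
`t.subtreeAt u` is the subtree formed by the vertex `u` and its descendants, or `none` if `t` has
no vertex with this address. -/
def subtreeAt : PlaneTree → List ℕ → Option PlaneTree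
  | t, [] => some t
  | node ts, i :: u => (ts[i]?).bind fun s => s.subtreeAt u

/-- `u` is (the address of) a vertex of `t`. -/
def IsVertex (t : PlaneTree) (u : List ℕ) : Prop :=
  (t.subtreeAt u).isSome

/-- The underlying graph-theoretic tree: its edges join the vertices to their children. (Addresses
that are not vertices of `t` are isolated points.) -/
def graph (t : PlaneTree) : SimpleGraph (List ℕ) where
  Adj u v := t.IsVertex u ∧ t.IsVertex v ∧ ((∃ i, v = u ++ [i]) ∨ ∃ i, u = v ++ [i])
  symm := ⟨fun _ _ h => ⟨h.2.1, h.1, h.2.2.symm⟩⟩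
  loopless := ⟨fun u h => by
    rcases h.2.2 with ⟨i, hi⟩ | ⟨i, hi⟩ <;> simpa using congrArg List.length hi⟩

mutual

/-- The vertices without children of a tree (the root included if it has none), in planar
order. -/
def tips : PlaneTree → List (List ℕ)
  | node [] => [[]]
  | node (t :: ts) => tipsFrom 0 (t :: ts)

/-- The childless vertices of consecutive subtrees, numbered from `i` on, in planar order. -/
def tipsFrom : ℕ → List PlaneTree → List (List ℕ)
  | _, [] => []
  | i, t :: ts => (tips t).map (fun u => i :: u) ++ tipsFrom (i + 1) ts

end

/-- The leaves of a tree, that is its non-root vertices without children, in planar order. -/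
def leaves (t : PlaneTree) : List (List ℕ) :=
  t.tips.filter fun u => u ≠ []

/-- With `n` the number of leaves of `t`: `t.leaf 0` and `t.leaf (n + 1)` are the root of `t`, and
`t.leaf 1, …, t.leaf n` are its leaves in planar order. -/
def leaf (t : PlaneTree) (i : ℕ) : List ℕ :=
  ([] :: t.leaves).getD i []

/-- The dual trees with `n` leaves: the root has degree one, and no non-root vertex has exactly
one child. -/
def dualTrees (n : ℕ) : Set PlaneTree :=
  {t | 2 ≤ n ∧ t.leaves.length = n ∧ t.children.length = 1 ∧
    ∀ u s, u ≠ [] → t.subtreeAt u = some s → s.children.length ≠ 1}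

/-- The dual trees with `n` leaves in which the path from the root to the first leaf has
length `k`, with a distinguished leaf (the `i`-th one) whose path to the next leaf (to the root,
if it is the last leaf) has length `l`. -/
def markedDualTrees (n k l : ℕ) : Set (PlaneTree × ℕ) :=
  {p | 2 ≤ k ∧ 2 ≤ l ∧ p.1 ∈ dualTrees n ∧ p.1.graph.dist (p.1.leaf 0) (p.1.leaf 1) = k ∧
    1 ≤ p.2 ∧ p.2 ≤ n ∧ p.1.graph.dist (p.1.leaf p.2) (p.1.leaf (p.2 + 1)) = l}

/-- The number `T_{n,k,l}` of dual trees with a distinguished leaf. -/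
noncomputable def markedCount (n k l : ℕ) : ℕ :=
  (markedDualTrees n k l).ncard

end PlaneTree

/-! ### Singular expansions in several variables -/

namespace SingularExpansion

/-- The `δ`-domain with parameters `ε` and `φ`. -/
def deltaDomain (ε φ : ℝ) : Set ℂ :=
  {x | ‖x‖ ≤ 1 + ε ∧ x ≠ 1 ∧ φ ≤ |Complex.arg (x - 1)|}

/-- The `R`-domain in the variables `x, y₁, …, yₘ` with parameters `ε` and `φ`. -/
def rDomain (m : ℕ) (ε φ : ℝ) : Set (ℂ × (Fin m → ℂ)) :=
  {p | p.1 ∈ deltaDomain ε φ ∧ ∀ j, ‖p.2 j‖ < 1}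

/-- Admissible parameters of `δ`- and `R`-domains. -/
def Admissible (ε φ : ℝ) : Prop :=
  0 < ε ∧ 0 < φ ∧ φ < Real.pi / 2

/-- `f(x, y₁, …, yₘ) = Õ((1 - x)^{-α} ∏ⱼ (1 - yⱼ)^{-βⱼ})`. -/
def TildeO {m : ℕ} (f : ℂ × (Fin m → ℂ) → ℂ) (α : ℝ) (β : Fin m → ℝ) : Prop :=
  ∃ ε φ α' β' γ : ℝ, Admissible ε φ ∧ 0 ≤ β' ∧ 0 ≤ γ ∧
    AnalyticOnNhd ℂ f (rDomain m ε φ) ∧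
    (∃ M : ℝ, ∀ p ∈ rDomain m ε φ,
      ‖f p‖ ≤ M * (‖1 - p.1‖ ^ (-α') * ∏ j, (1 - ‖p.2 j‖) ^ (-β'))) ∧
    (∃ M η : ℝ, 0 < η ∧ ∀ p ∈ rDomain m ε φ,
      (∀ i, ‖1 - p.1‖ * ‖1 - p.2 i‖ ^ (-γ) < η) →
        ‖f p‖ ≤ M * (‖1 - p.1‖ ^ (-α) * ∏ j, (1 - ‖p.2 j‖) ^ (-β j)))

/-- On the given `R`-domain, `F` is a polynomial in `x` whose coefficients are analytic functions
of `y₁, …, yₘ`. -/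
def IsPolyInX {m : ℕ} (ε φ : ℝ) (F : ℂ × (Fin m → ℂ) → ℂ) : Prop :=
  ∃ (N : ℕ) (a : ℕ → (Fin m → ℂ) → ℂ),
    (∀ i, AnalyticOnNhd ℂ (a i) {y | ∀ j, ‖y j‖ < 1}) ∧
    ∀ p ∈ rDomain m ε φ, F p = ∑ i ∈ Finset.range N, a i p.2 * p.1 ^ i

/-- On the given `R`-domain, `F` is a polynomial in `yⱼ` whose coefficients are analytic functions
of the remaining variables. -/
def IsPolyInY {m : ℕ} (ε φ : ℝ) (j : Fin m) (F : ℂ × (Fin m → ℂ) → ℂ) : Prop :=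
  ∃ (N : ℕ) (a : ℕ → ℂ × (Fin m → ℂ) → ℂ),
    (∀ i, AnalyticOnNhd ℂ (a i) (rDomain m ε φ)) ∧
    (∀ i x y w, a i (x, Function.update y j w) = a i (x, y)) ∧
    ∀ p ∈ rDomain m ε φ, F p = ∑ i ∈ Finset.range N, a i p * p.2 j ^ i

/-- `f(x, y₁, …, yₘ) ≈ c (1 - x)^{-α} ∏ⱼ (1 - yⱼ)^{-βⱼ}`. The powers are principal values. -/
def Approx {m : ℕ} (f : ℂ × (Fin m → ℂ) → ℂ) (c : ℂ) (α : ℝ) (β : Fin m → ℝ) : Prop :=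
  c ≠ 0 ∧
  ∃ (ε φ α' : ℝ) (β' : Fin m → ℝ) (C : (Fin m → ℂ) → ℂ) (C₀ : ℂ × (Fin m → ℂ) → ℂ)
    (C' : Fin m → ℂ × (Fin m → ℂ) → ℂ) (E : ℂ × (Fin m → ℂ) → ℂ),
    Admissible ε φ ∧ α' < α ∧ (∀ j, 0 ≤ β' j) ∧
    (∀ p ∈ rDomain m ε φ,
      f p = C p.2 * (1 - p.1) ^ (-(α : ℂ)) * ∏ j, (1 - p.2 j) ^ (-(β j : ℂ))
        + (C₀ p + ∑ j, C' j p) + E p) ∧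
    AnalyticOnNhd ℂ C (Set.univ.pi fun _ => deltaDomain ε φ) ∧
    (∃ M : ℝ, ∀ y ∈ Set.univ.pi fun _ : Fin m => deltaDomain ε φ,
      ‖C y - c‖ ≤ M * ∑ j, ‖1 - y j‖) ∧
    IsPolyInX ε φ C₀ ∧ (∀ j, IsPolyInY ε φ j (C' j)) ∧
    TildeO E α' β'

/-- The constant `r = 3 + 2√2`. -/
noncomputable def r : ℝ := 3 + 2 * √2

/-- The constant `s = (√2 - 1) / 2`. -/
noncomputable def s : ℝ := (√2 - 1) / 2

/-- The constant `q = √(r² - 1)`. -/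
noncomputable def q : ℝ := √(r ^ 2 - 1)

end SingularExpansion

/-!
A tree with root degree one is an edge on top of a reduced tree, that is, a tree in which no vertex
has exactly one child. A reduced tree is either a single vertex, or it consists of a root above an
ordered forest of at least two reduced trees, which is split here into its first tree and the
nonempty forest of the others (`reducedTrees_eq`, `reducedForests_eq`). The distance of two
consecutive leaves is read off from the depths of the last leaf of one tree and the first leaf of
the next one. So all series, by number of leaves, are rational in `X` and in the series `u` of the
nonempty forests (`uSeries`), which satisfies `u * (1 - u) = X * (1 + u)`. With the series
(`wSeries`) `w = 1 / (1 - X - 2 * u) = 1 / √(1 - 6 * X + X ^ 2)`, the result (`markedCount_eq`,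
`forestGapSeries_eq_wSeries`) is that the series of the `T_{n, k + 2, l + 2}` for fixed `k` and `l`
is
`2 * (k + 1) * (l + 1) * X ^ 3 * u ^ (k + l) * (1 + u) * w + 2 * X ^ 2 * (1 + u) * u ^ (k + l)`
`+ k * l * X ^ 3 * (1 + u) ^ 2 * u ^ (k + l - 2)`.

The discriminant is `(1 - r * X) * (1 - X / r)`, and `u` takes the value `2 * s` at `X = 1 / r`.

*The generating function.* Summation over `k` and `l` gives geometric series in `y * u / (2 * s)`
and `z * u / (2 * s)` and hence a closed form (`markedFun`, `hasSum_markedFun`). It continues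
analytically to a `δ`-domain because there `‖u‖ < 2 * s` (`norm_uFun_lt`). To see this, solve the
quadratic equation for `x`: `(1 - x) * (1 + u) = r * (u - 2 * s) ^ 2`. On the circle
`‖u‖ = 2 * s`, the points `x` of absolute value at most `1.1` lie in the excluded cone at `1`
(`norm_uFun_ne`). As the domain is star-shaped about `0`, where `u` vanishes, the intermediate value
theorem applies. In the term with `w`, which contains the factor `(1 - x) ^ (-1 / 2)`, replacing
`x` and `u` in all other factors by their values `1` and `2 * s` leaves a
remainder with an additional factor `O(‖1 - x‖ ^ (1 / 2))`; the other two terms are bounded in `x`.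
Hence the difference from the main term is bounded in `x` and of polynomial
growth in `1 / (1 - ‖y‖)` and `1 / (1 - ‖z‖)` (`norm_markedFun_sub_mainTerm_le`). No polynomial
terms are needed in the expansion.

*The coefficients.* The coefficients of `u ^ m * w` are Delannoy numbers, and those of `u ^ m` are
smaller by a factor `m / N` (`mul_coeff_uSeries_pow`). Together with the quadratic equation for `u`,
this gives a three-term recurrence in `m` (`delannoy_recurrence`), so that the ratios of consecutive
numbers are iterates of maps close to the contraction `x ↦ 2 + 1 / x`, with fixed point `1 + √2`
(`abs_ratio_sub_le`). This reduces the asymptotics to the central numbers `m = 0`. For these, `w` is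
the product of the series of `1 / √(1 - r * X)` and of `1 / √(1 - X / r)`, and Wallis' product
gives their size (`abs_delannoy_zero_sub_le`, `sqrt_pi_mul_centralRatio_bounds`). With `k = l` of
order at most `log n`, the errors `O(k ^ 2 / n)` are negligible; what remains is the difference
between `(k - 1) ^ 2` and `k ^ 2`.
-/

open PowerSeries

/-! ### Weighted generating series -/

section WeightSeries

variable {α β : Type*}

/-- The size function `sz` takes each value only finitely often on `S`. -/
def FiniteFibers (S : Set α) (sz : α → ℕ) : Prop :=
  ∀ n, {a | a ∈ S ∧ sz a = n}.Finite

/-- The ordinary generating series `∑ ω(a) X ^ sz(a)` over the elements `a` of a set `S` on which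
the size function `sz` has finite fibres. -/
noncomputable def weightSeries (S : Set α) (sz : α → ℕ) (ω : α → ℝ) : ℝ⟦X⟧ :=
  PowerSeries.mk fun n => ∑ᶠ a ∈ {a | a ∈ S ∧ sz a = n}, ω a

theorem coeff_weightSeries (S : Set α) (sz : α → ℕ) (ω : α → ℝ) (n : ℕ) :
    coeff n (weightSeries S sz ω) = ∑ᶠ a ∈ {a | a ∈ S ∧ sz a = n}, ω a :=
  coeff_mk _ _

theorem coeff_weightSeries_eq_sum {S : Set α} {sz : α → ℕ} (h : FiniteFibers S sz) (ω : α → ℝ)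
    (n : ℕ) : coeff n (weightSeries S sz ω) = ∑ a ∈ (h n).toFinset, ω a := by
  rw [coeff_weightSeries, finsum_mem_eq_finite_toFinset_sum _ (h n)]

theorem weightSeries_congr {S : Set α} {sz sz' : α → ℕ} {ω ω' : α → ℝ}
    (hs : ∀ a ∈ S, sz a = sz' a) (h : ∀ a ∈ S, ω a = ω' a) :
    weightSeries S sz ω = weightSeries S sz' ω' := by
  ext n
  rw [coeff_weightSeries, coeff_weightSeries]
  refine finsum_mem_congr ?_ fun a ha => h a ha.1
  ext a
  constructor <;> rintro ⟨h1, h2⟩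
  · exact ⟨h1, by rw [← hs a h1]; exact h2⟩
  · exact ⟨h1, by rw [hs a h1]; exact h2⟩

theorem weightSeries_add {S : Set α} {sz : α → ℕ} (h : FiniteFibers S sz) (ω ω' : α → ℝ) :
    weightSeries S sz (fun a => ω a + ω' a) = weightSeries S sz ω + weightSeries S sz ω' := by
  ext n
  simp only [map_add, coeff_weightSeries_eq_sum h, Finset.sum_add_distrib]

theorem weightSeries_sum {ι : Type*} {S : Set α} {sz : α → ℕ} (h : FiniteFibers S sz)
    (s : Finset ι) (ω : ι → α → ℝ) :
    weightSeries S sz (fun a => ∑ i ∈ s, ω i a) = ∑ i ∈ s, weightSeries S sz (ω i) := by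
  ext n
  simp only [map_sum, coeff_weightSeries_eq_sum h]
  exact Finset.sum_comm

theorem weightSeries_zero (S : Set α) (sz : α → ℕ) : weightSeries S sz (fun _ => 0) = 0 := by
  ext n
  simp [coeff_weightSeries]

theorem weightSeries_singleton (a : α) (sz : α → ℕ) (ω : α → ℝ) :
    weightSeries {a} sz ω = C (ω a) * X ^ sz a := by
  ext n
  rw [coeff_weightSeries, coeff_C_mul, coeff_X_pow]
  by_cases hn : n = sz a
  · have : {b | b ∈ ({a} : Set α) ∧ sz b = n} = {a} := by
      ext b; simp only [Set.mem_singleton_iff, Set.mem_ofPred_eq]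
      constructor
      · exact fun h => h.1
      · rintro rfl; exact ⟨rfl, hn.symm⟩
    rw [this, finsum_mem_singleton, if_pos hn, mul_one]
  · have : {b | b ∈ ({a} : Set α) ∧ sz b = n} = ∅ := by
      ext b; simp only [Set.mem_singleton_iff, Set.mem_ofPred_eq, Set.mem_empty_iff_false,
          iff_false]
      rintro ⟨rfl, h⟩; exact hn h.symm
    rw [this, finsum_mem_empty, if_neg hn, mul_zero]

theorem weightSeries_union {S T : Set α} {sz : α → ℕ} (hS : FiniteFibers S sz)
    (hT : FiniteFibers T sz) (hd : Disjoint S T) (ω : α → ℝ) :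
    weightSeries (S ∪ T) sz ω = weightSeries S sz ω + weightSeries T sz ω := by
  ext n
  rw [map_add, coeff_weightSeries, coeff_weightSeries, coeff_weightSeries,
    ← finsum_mem_union (hd.mono (fun _ h => h.1) (fun _ h => h.1)) (hS n) (hT n)]
  refine finsum_mem_congr ?_ fun _ _ => rfl
  ext a
  simp [or_and_right]

theorem weightSeries_image {S : Set α} {g : α → β} (hg : Set.InjOn g S) (sz : β → ℕ)
    (ω : β → ℝ) :
    weightSeries (g '' S) sz ω = weightSeries S (fun a => sz (g a)) (fun a => ω (g a)) := by
  ext n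
  rw [coeff_weightSeries, coeff_weightSeries,
    ← finsum_mem_image (f := ω) (hg.mono (fun _ h => h.1))]
  refine finsum_mem_congr ?_ fun _ _ => rfl
  ext b
  constructor
  · rintro ⟨⟨a, ha, rfl⟩, h⟩; exact ⟨a, ⟨ha, h⟩, rfl⟩
  · rintro ⟨a, ⟨ha, h⟩, rfl⟩; exact ⟨⟨a, ha, rfl⟩, h⟩

theorem FiniteFibers.mono {S T : Set α} {sz : α → ℕ} (hT : FiniteFibers T sz) (h : S ⊆ T) :
    FiniteFibers S sz :=
  fun n => (hT n).subset fun _ ha => ⟨h ha.1, ha.2⟩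

theorem FiniteFibers.prod {S : Set α} {T : Set β} {s : α → ℕ} {t : β → ℕ}
    (hS : FiniteFibers S s) (hT : FiniteFibers T t) :
    FiniteFibers (S ×ˢ T) (fun p => s p.1 + t p.2) := by
  intro n
  refine ((Set.finite_Iic n).biUnion fun i _ => (hS i).prod
    ((Set.finite_Iic n).biUnion fun j _ => hT j)).subset ?_
  rintro ⟨a, b⟩ ⟨⟨ha, hb⟩, h⟩
  simp only at h
  simp only [Set.mem_iUnion, Set.mem_prod, Set.mem_Iic]
  exact ⟨s a, by omega, ⟨ha, rfl⟩, t b, by omega, ⟨hb, rfl⟩⟩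

/-- Sizes add and weights multiply on a product of sets. -/
theorem weightSeries_prod {S : Set α} {T : Set β} {s : α → ℕ} {t : β → ℕ}
    (hS : FiniteFibers S s) (hT : FiniteFibers T t) (ω : α → ℝ) (ω' : β → ℝ) :
    weightSeries (S ×ˢ T) (fun p => s p.1 + t p.2) (fun p => ω p.1 * ω' p.2)
      = weightSeries S s ω * weightSeries T t ω' := by
  classical
  ext n
  rw [coeff_mul, coeff_weightSeries_eq_sum (hS.prod hT)]
  simp only [coeff_weightSeries_eq_sum hS, coeff_weightSeries_eq_sum hT]
  simp_rw [Finset.sum_mul_sum, ← Finset.sum_product']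
  rw [← Finset.sum_biUnion]
  · refine Finset.sum_congr ?_ fun _ _ => rfl
    ext ⟨a, b⟩
    simp only [Set.Finite.mem_toFinset, Finset.mem_biUnion, Finset.mem_product, Set.mem_ofPred_eq,
      Set.mem_prod, Prod.exists]
    constructor
    · rintro ⟨⟨ha, hb⟩, h⟩
      exact ⟨s a, t b, Finset.HasAntidiagonal.mem_antidiagonal.2 h, ⟨ha, rfl⟩, hb, rfl⟩
    · rintro ⟨i, j, h, ⟨ha, rfl⟩, hb, rfl⟩
      exact ⟨⟨ha, hb⟩, Finset.HasAntidiagonal.mem_antidiagonal.1 h⟩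
  · rintro ⟨i, j⟩ _ ⟨i', j'⟩ _ hne
    refine Finset.disjoint_left.2 ?_
    rintro ⟨a, b⟩ h1 h2
    simp only [Finset.mem_product, Set.Finite.mem_toFinset, Set.mem_ofPred_eq] at h1 h2
    exact hne (by rw [← h1.1.2, ← h1.2.2, ← h2.1.2, ← h2.2.2])

end WeightSeries

namespace PlaneTree

/-! ### Distances between the vertices of a tree -/

/-- The distance of the vertices with addresses `u` and `v`: the lengths of what remains of the
two addresses after the removal of their longest common prefix. -/
def addrDist : List ℕ → List ℕ → ℕ
  | [], v => v.length
  | a :: u, [] => (a :: u).length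
  | a :: u, b :: v => if a = b then addrDist u v else u.length + v.length + 2

@[simp] theorem addrDist_nil_left (v : List ℕ) : addrDist [] v = v.length := by
  simp [addrDist]

@[simp] theorem addrDist_nil_right (u : List ℕ) : addrDist u [] = u.length := by
  cases u <;> simp [addrDist]

@[simp] theorem addrDist_cons_same (a : ℕ) (u v : List ℕ) :
    addrDist (a :: u) (a :: v) = addrDist u v := by
  simp [addrDist]

theorem addrDist_cons_ne {a b : ℕ} (h : a ≠ b) (u v : List ℕ) :
    addrDist (a :: u) (b :: v) = u.length + v.length + 2 := by
  simp [addrDist, h]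

theorem addrDist_self (u : List ℕ) : addrDist u u = 0 := by
  induction u with
  | nil => rfl
  | cons a u ih => simpa using ih

theorem addrDist_concat_le (u v : List ℕ) (i : ℕ) :
    addrDist u (v ++ [i]) ≤ addrDist u v + 1 ∧ addrDist u v ≤ addrDist u (v ++ [i]) + 1 := by
  induction u generalizing v with
  | nil => constructor <;> simp; omega
  | cons a u ih =>
    cases v with
    | nil =>
      by_cases h : a = i
      · subst h; simp; omega
      · simp [addrDist_cons_ne h]
    | cons b v =>
      by_cases h : a = b
      · subst h; simpa using ih v
      · simp [addrDist_cons_ne h]; omega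

theorem exists_common_prefix (u v : List ℕ) :
    ∃ p u' v', u = p ++ u' ∧ v = p ++ v' ∧ addrDist u v = u'.length + v'.length := by
  induction u generalizing v with
  | nil => exact ⟨[], [], v, by simp⟩
  | cons a u ih =>
    cases v with
    | nil => exact ⟨[], a :: u, [], by simp⟩
    | cons b v =>
      by_cases h : a = b
      · subst h
        obtain ⟨p, u', v', rfl, rfl, h⟩ := ih v
        exact ⟨a :: p, u', v', by simp, by simp, by simpa using h⟩
      · exact ⟨[], a :: u, b :: v, by simp, by simp, by
          simp [addrDist_cons_ne h]; omega⟩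

theorem subtreeAt_nil (t : PlaneTree) : t.subtreeAt [] = some t := by
  cases t; simp [subtreeAt]

theorem subtreeAt_cons (ts : List PlaneTree) (i : ℕ) (u : List ℕ) :
    (node ts).subtreeAt (i :: u) = (ts[i]?).bind fun s => s.subtreeAt u := by
  simp [subtreeAt]

theorem IsVertex.of_append {t : PlaneTree} {u v : List ℕ} (h : t.IsVertex (u ++ v)) :
    t.IsVertex u := by
  induction u generalizing t with
  | nil => simp [IsVertex, subtreeAt_nil]
  | cons i u ih =>
    obtain ⟨ts⟩ := t
    unfold IsVertex at h ⊢
    rw [List.cons_append, subtreeAt_cons] at h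
    rw [subtreeAt_cons]
    cases hi : ts[i]? with
    | none => simp [hi] at h
    | some s =>
      simp only [hi, Option.bind_some] at h ⊢
      exact ih h

theorem exists_walk_append {t : PlaneTree} (p u : List ℕ) (h : t.IsVertex (p ++ u)) :
    ∃ w : t.graph.Walk p (p ++ u), w.length = u.length := by
  induction u using List.reverseRecOn with
  | nil => exact ⟨SimpleGraph.Walk.nil.copy rfl (by simp), by simp⟩
  | append_singleton u i ih =>
    have h' : t.IsVertex (p ++ u ++ [i]) := by simpa using h
    obtain ⟨w, hw⟩ := ih h'.of_append
    have hadj : t.graph.Adj (p ++ u) (p ++ u ++ [i]) := ⟨h'.of_append, h', Or.inl ⟨i, rfl⟩⟩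
    exact ⟨(w.concat hadj).copy rfl (by simp), by simp [hw]⟩

theorem addrDist_le_length {t : PlaneTree} (o : List ℕ) {u v : List ℕ} (w : t.graph.Walk u v) :
    addrDist o v ≤ addrDist o u + w.length := by
  induction w with
  | nil => simp
  | @cons a b c hadj w ih =>
    have hab : addrDist o b ≤ addrDist o a + 1 := by
      rcases hadj.2.2 with ⟨i, rfl⟩ | ⟨i, rfl⟩
      · exact (addrDist_concat_le o a i).1
      · exact (addrDist_concat_le o b i).2
    rw [SimpleGraph.Walk.length_cons]
    omega

/-- The distance in the graph is the one computed from the addresses: it is attained by the path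
through the longest common prefix, and along an edge `addrDist` changes by at most one. -/
theorem dist_eq_addrDist {t : PlaneTree} {u v : List ℕ} (hu : t.IsVertex u) (hv : t.IsVertex v) :
    t.graph.dist u v = addrDist u v := by
  obtain ⟨p, u', v', rfl, rfl, h⟩ := exists_common_prefix u v
  obtain ⟨w₁, h₁⟩ := exists_walk_append p u' hu
  obtain ⟨w₂, h₂⟩ := exists_walk_append p v' hv
  refine le_antisymm ?_ ?_
  · refine (SimpleGraph.dist_le (w₁.reverse.append w₂)).trans ?_
    simp [h₁, h₂, h]
  · obtain ⟨w, hw⟩ := (w₁.reverse.append w₂).reachable.exists_walk_length_eq_dist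
    rw [← hw]
    simpa [addrDist_self] using addrDist_le_length (p ++ u') w

/-! ### Depths of the leaves and gaps between them -/

/-- The distances between consecutive entries of a list of addresses. -/
def gaps : List (List ℕ) → List ℕ
  | u :: v :: L => addrDist u v :: gaps (v :: L)
  | _ => []

@[simp] theorem gaps_nil : gaps [] = [] := by simp [gaps]

@[simp] theorem gaps_singleton (u : List ℕ) : gaps [u] = [] := by simp [gaps]

@[simp] theorem gaps_cons_cons (u v : List ℕ) (L : List (List ℕ)) :
    gaps (u :: v :: L) = addrDist u v :: gaps (v :: L) := by simp [gaps]

theorem gaps_map_cons (i : ℕ) (L : List (List ℕ)) : gaps (L.map (i :: ·)) = gaps L := by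
  induction L with
  | nil => rfl
  | cons u L ih =>
    cases L with
    | nil => rfl
    | cons v L => simpa using ih

theorem gaps_append (L : List (List ℕ)) (u v : List ℕ) (M : List (List ℕ)) :
    gaps (L ++ u :: v :: M) = gaps (L ++ [u]) ++ addrDist u v :: gaps (v :: M) := by
  induction L with
  | nil => simp
  | cons a L ih =>
    cases L with
    | nil => simp
    | cons b L => simpa using ih

/-- The depth of the first tip. -/
def leftDepth (t : PlaneTree) : ℕ := (t.tips.headD []).length

/-- The depth of the last tip. -/
def rightDepth (t : PlaneTree) : ℕ := (t.tips.getLastD []).length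

/-- The number of tips. -/
def numTips (t : PlaneTree) : ℕ := t.tips.length

/-- The number of tips of a forest. -/
def forestNumTips (f : List PlaneTree) : ℕ := (f.map numTips).sum

/-- The depth of the first tip of a forest, the roots of its trees having depth `0`. -/
def forestLeftDepth : List PlaneTree → ℕ
  | [] => 0
  | t :: _ => leftDepth t

/-- The depth of the last tip of a forest, the roots of its trees having depth `0`. -/
def forestRightDepth : List PlaneTree → ℕ
  | [] => 0
  | [t] => rightDepth t
  | _ :: t :: f => forestRightDepth (t :: f)

/-- The distances between consecutive tips of a forest, the roots of its trees being joined to a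
common parent. -/
def forestGaps : List PlaneTree → List ℕ
  | [] => []
  | [t] => gaps t.tips
  | t :: t' :: f => gaps t.tips ++ (rightDepth t + leftDepth t' + 2) :: forestGaps (t' :: f)

theorem tips_leaf : tips (node []) = [[]] := by simp [tips]

theorem tips_node_cons (t : PlaneTree) (f : List PlaneTree) :
    tips (node (t :: f)) = tipsFrom 0 (t :: f) := by simp [tips]

theorem tipsFrom_nil (i : ℕ) : tipsFrom i [] = [] := by simp [tipsFrom]

theorem tipsFrom_cons (i : ℕ) (t : PlaneTree) (f : List PlaneTree) :
    tipsFrom i (t :: f) = (tips t).map (fun u => i :: u) ++ tipsFrom (i + 1) f := by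
  rw [tipsFrom]

theorem tree_induction {P : PlaneTree → Prop}
    (h : ∀ ts : List PlaneTree, (∀ t ∈ ts, P t) → P (node ts)) : ∀ t, P t
  | node ts => h ts fun t _ => tree_induction h t

theorem tips_ne_nil (t : PlaneTree) : t.tips ≠ [] := by
  induction t using tree_induction with
  | h ts ih =>
    cases ts with
    | nil => simp [tips_leaf]
    | cons t f => simp [tips_node_cons, tipsFrom_cons, ih t (by simp)]

theorem exists_tips_eq_cons (t : PlaneTree) :
    ∃ u L, t.tips = u :: L ∧ leftDepth t = u.length := by
  obtain ⟨u, L, h⟩ := List.exists_cons_of_ne_nil (tips_ne_nil t)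
  exact ⟨u, L, h, by simp [leftDepth, h]⟩

theorem exists_tips_eq_concat (t : PlaneTree) :
    ∃ L u, t.tips = L ++ [u] ∧ rightDepth t = u.length := by
  obtain ⟨L, u, h⟩ := List.eq_nil_or_concat t.tips |>.resolve_left (tips_ne_nil t)
  exact ⟨L, u, by simpa using h, by simp [rightDepth, h]⟩

theorem numTips_pos (t : PlaneTree) : 0 < numTips t :=
  List.length_pos_of_ne_nil (tips_ne_nil t)

theorem numTips_leaf : numTips (node []) = 1 := by simp [numTips, tips_leaf]

@[simp] theorem forestNumTips_nil : forestNumTips [] = 0 := rfl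

@[simp] theorem forestNumTips_cons (t : PlaneTree) (f : List PlaneTree) :
    forestNumTips (t :: f) = numTips t + forestNumTips f := by
  simp [forestNumTips]

theorem length_tipsFrom (i : ℕ) (f : List PlaneTree) :
    (tipsFrom i f).length = forestNumTips f := by
  induction f generalizing i with
  | nil => simp [tipsFrom_nil]
  | cons t f ih => simp [tipsFrom_cons, ih, numTips]

theorem numTips_node_cons (t : PlaneTree) (f : List PlaneTree) :
    numTips (node (t :: f)) = numTips t + forestNumTips f := by
  rw [numTips, tips_node_cons, length_tipsFrom, forestNumTips_cons]

theorem leftDepth_leaf : leftDepth (node []) = 0 := by simp [leftDepth, tips_leaf]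

theorem rightDepth_leaf : rightDepth (node []) = 0 := by simp [rightDepth, tips_leaf]

theorem leftDepth_node_cons (t : PlaneTree) (f : List PlaneTree) :
    leftDepth (node (t :: f)) = leftDepth t + 1 := by
  obtain ⟨u, L, h, hu⟩ := exists_tips_eq_cons t
  rw [hu, leftDepth, tips_node_cons, tipsFrom_cons, h]
  simp

theorem exists_tipsFrom_eq_concat (i : ℕ) (t : PlaneTree) (f : List PlaneTree) :
    ∃ L j u, tipsFrom i (t :: f) = L ++ [j :: u] ∧ forestRightDepth (t :: f) = u.length := by
  induction f generalizing i t with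
  | nil =>
    obtain ⟨L, u, h, hu⟩ := exists_tips_eq_concat t
    exact ⟨L.map (i :: ·), i, u, by simp [tipsFrom_cons, tipsFrom_nil, h], by
      simpa [forestRightDepth] using hu⟩
  | cons t' f ih =>
    obtain ⟨L, j, u, h, hu⟩ := ih (i + 1) t'
    exact ⟨(tips t).map (i :: ·) ++ L, j, u, by rw [tipsFrom_cons, h]; simp, by
      simpa [forestRightDepth] using hu⟩

theorem rightDepth_node_cons (t : PlaneTree) (f : List PlaneTree) :
    rightDepth (node (t :: f)) = forestRightDepth (t :: f) + 1 := by
  obtain ⟨L, j, u, h, hu⟩ := exists_tipsFrom_eq_concat 0 t f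
  rw [hu, rightDepth, tips_node_cons, h]
  simp

/-- The tips of a forest below a common parent: the gap between two neighbouring trees has length
`rightDepth + leftDepth + 2`, the other gaps lie within the trees. -/
theorem gaps_tipsFrom (i : ℕ) (f : List PlaneTree) : gaps (tipsFrom i f) = forestGaps f := by
  induction f generalizing i with
  | nil => simp [tipsFrom_nil, forestGaps]
  | cons t f ih =>
    cases f with
    | nil => simp [tipsFrom_cons, tipsFrom_nil, forestGaps, gaps_map_cons]
    | cons t' f =>
      obtain ⟨L, u, h, hu⟩ := exists_tips_eq_concat t
      obtain ⟨v, M, h', hv⟩ := exists_tips_eq_cons t'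
      have ih' := ih (i + 1)
      have hL := gaps_map_cons i t.tips
      rw [forestGaps, ← ih', ← hL, hu, hv, tipsFrom_cons, tipsFrom_cons, h, h']
      simp only [List.map_append, List.map_cons, List.map_nil, List.append_assoc,
        List.cons_append, List.nil_append]
      rw [gaps_append, addrDist_cons_ne (by omega)]

theorem gaps_tips_node_cons (t : PlaneTree) (f : List PlaneTree) :
    gaps (tips (node (t :: f))) = forestGaps (t :: f) := by
  rw [tips_node_cons, gaps_tipsFrom]

theorem gaps_tips_leaf : gaps (tips (node [])) = [] := by
  simp [tips_leaf]

theorem isVertex_of_mem_tips {t : PlaneTree} {u : List ℕ} (h : u ∈ t.tips) : t.IsVertex u := by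
  induction t using tree_induction generalizing u with
  | h ts ih =>
    have key : ∀ (f : List PlaneTree) (i : ℕ), (∀ j, f[j]? = ts[i + j]?) → (∀ t ∈ f, t ∈ ts) →
        ∀ u ∈ tipsFrom i f, (node ts).IsVertex u := by
      intro f
      induction f with
      | nil => simp [tipsFrom_nil]
      | cons t f ihf =>
        intro i hf hmem u hu
        rw [tipsFrom_cons, List.mem_append, List.mem_map] at hu
        rcases hu with ⟨v, hv, rfl⟩ | hu
        · have h0 := hf 0
          simp only [List.getElem?_cons_zero, add_zero] at h0
          unfold IsVertex
          rw [subtreeAt_cons, ← h0]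
          exact ih t (hmem t (by simp)) hv
        · refine ihf (i + 1) (fun j => ?_) (fun t ht => hmem t (by simp [ht])) u hu
          have := hf (j + 1)
          simpa [add_assoc, add_comm 1 j] using this
    cases ts with
    | nil =>
      rw [tips_leaf, List.mem_singleton] at h
      subst h
      simp [IsVertex, subtreeAt_nil]
    | cons t f =>
      rw [tips_node_cons] at h
      exact key _ 0 (by simp) (by simp) u h

/-! ### Reduced trees -/

/-- No vertex, the root included, has exactly one child. -/
def IsReduced (t : PlaneTree) : Prop :=
  ∀ u s, t.subtreeAt u = some s → s.children.length ≠ 1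

/-- A vertex of `node ts` is its root or a vertex of one of the trees `ts`. -/
theorem isReduced_node {ts : List PlaneTree} :
    IsReduced (node ts) ↔ ts.length ≠ 1 ∧ ∀ t ∈ ts, IsReduced t := by
  constructor
  · intro h
    refine ⟨h [] _ (subtreeAt_nil _), fun t ht u s hs => ?_⟩
    obtain ⟨i, hi⟩ := List.getElem?_of_mem ht
    exact h (i :: u) s (by rw [subtreeAt_cons, hi]; exact hs)
  · rintro ⟨h1, h2⟩ u s hs
    cases u with
    | nil =>
      rw [subtreeAt_nil, Option.some.injEq] at hs
      subst hs
      exact h1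
    | cons i u =>
      rw [subtreeAt_cons, Option.bind_eq_some_iff] at hs
      obtain ⟨t, ht, hs⟩ := hs
      exact h2 t (List.mem_of_getElem? ht) u s hs

/-- The reduced trees. -/
def reducedTrees : Set PlaneTree := {t | IsReduced t}

/-- The nonempty ordered forests of reduced trees. -/
def reducedForests : Set (List PlaneTree) := {f | f ≠ [] ∧ ∀ t ∈ f, IsReduced t}

/-- A reduced tree is a single vertex, or a root above a reduced tree followed by a nonempty forest
of reduced trees. -/
theorem reducedTrees_eq :
    reducedTrees = {node []} ∪
      (fun p : PlaneTree × List PlaneTree => node (p.1 :: p.2)) ''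
        (reducedTrees ×ˢ reducedForests) := by
  ext ⟨ts⟩
  simp only [reducedTrees, reducedForests, Set.mem_ofPred_eq, Set.mem_union,
    Set.mem_singleton_iff, Set.mem_image, Set.mem_prod, Prod.exists, node.injEq, isReduced_node]
  rcases ts with _ | ⟨t, _ | ⟨t', f⟩⟩
  · simp
  · simp
  · constructor
    · rintro ⟨-, h⟩
      exact Or.inr ⟨t, t' :: f, ⟨h t (by simp), by simp, fun s hs => h s (by simp_all)⟩, rfl⟩
    · rintro (h | ⟨s, g, ⟨hs, -, hg⟩, h⟩)
      · simp at h
      · rw [← h]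
        have : g = t' :: f := by simpa using (List.cons.inj h).2
        exact ⟨by simp [this], fun x hx => (List.mem_cons.1 hx).elim (fun e => e ▸ hs) (hg x)⟩

/-- A nonempty forest is a single tree, or a tree followed by a nonempty forest. -/
theorem reducedForests_eq :
    reducedForests = (fun t => [t]) '' reducedTrees ∪
      (fun p : PlaneTree × List PlaneTree => p.1 :: p.2) '' (reducedTrees ×ˢ reducedForests) := by
  ext f
  simp only [reducedTrees, reducedForests, Set.mem_ofPred_eq, Set.mem_union,
    Set.mem_image, Set.mem_prod, Prod.exists]
  rcases f with _ | ⟨t, _ | ⟨t', f⟩⟩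
  · simp
  · simp
  · simp

theorem length_le_forestNumTips (f : List PlaneTree) : f.length ≤ forestNumTips f := by
  induction f with
  | nil => simp
  | cons t f ih => have := numTips_pos t; simp; omega

theorem finite_lists_of_finite {α : Type*} {S : Set α} (hS : S.Finite) (n : ℕ) :
    {l : List α | l.length ≤ n ∧ ∀ a ∈ l, a ∈ S}.Finite := by
  have := hS.to_subtype
  refine ((List.finite_length_le S n).image (List.map Subtype.val)).subset ?_
  rintro l ⟨h, hl⟩
  exact ⟨l.attachWith (· ∈ S) hl, by simpa using h, by simp⟩

theorem numTips_le_forestNumTips {t : PlaneTree} {f : List PlaneTree} (h : t ∈ f) :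
    numTips t ≤ forestNumTips f := by
  induction f with
  | nil => simp at h
  | cons s f ih =>
    rcases List.mem_cons.1 h with rfl | h
    · simp
    · have := ih h; simp; omega

/-- Since every vertex that is not a tip has at least two children, there are only finitely many
reduced trees with a bounded number of tips. -/
theorem finite_reducedTrees_le (n : ℕ) : {t | t ∈ reducedTrees ∧ numTips t ≤ n}.Finite := by
  induction n with
  | zero =>
    convert Set.finite_empty
    ext t
    have := numTips_pos t
    simp; omega
  | succ n ih =>
    refine ((finite_lists_of_finite ih (n + 1)).image node).union (Set.finite_singleton (node []))
      |>.subset ?_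
    rintro ⟨ts⟩ ⟨h, hn⟩
    have h' := isReduced_node.1 h
    rcases ts with _ | ⟨t, f⟩
    · simp
    · refine Or.inl ⟨t :: f, ⟨?_, ?_⟩, rfl⟩
      · have := length_le_forestNumTips (t :: f)
        rw [numTips_node_cons] at hn
        simp at this ⊢; omega
      · intro s hs
        refine ⟨h'.2 s hs, ?_⟩
        rw [numTips_node_cons] at hn
        have hf : f ≠ [] := by rintro rfl; simp at h'
        have hf' : 0 < f.length := List.length_pos_of_ne_nil hf
        have h1 := length_le_forestNumTips f
        have h2 := numTips_pos t
        rcases List.mem_cons.1 hs with rfl | hs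
        · omega
        · have := numTips_le_forestNumTips hs; omega

theorem finiteFibers_reducedTrees : FiniteFibers reducedTrees numTips :=
  fun n => (finite_reducedTrees_le n).subset fun _ h => ⟨h.1, h.2.le⟩

theorem finiteFibers_reducedForests : FiniteFibers reducedForests forestNumTips := by
  intro n
  refine (finite_lists_of_finite (finite_reducedTrees_le n) n).subset ?_
  rintro f ⟨h, rfl⟩
  exact ⟨length_le_forestNumTips f, fun t ht => ⟨h.2 t ht, numTips_le_forestNumTips ht⟩⟩

/-! ### Marked trees as a weighted count of reduced trees -/

/-- The leaves of a planted tree are the tips of the tree on top of which the root was added. -/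
theorem leaves_planted (s : PlaneTree) : (node [s]).leaves = s.tips.map (0 :: ·) := by
  rw [leaves, tips_node_cons, tipsFrom_cons, tipsFrom_nil, List.append_nil, List.filter_eq_self]
  simp

theorem leaf_planted_succ (s : PlaneTree) (i : ℕ) :
    (node [s]).leaf (i + 1) = (s.tips.map (0 :: ·)).getD i [] := by
  simp [leaf, leaves_planted]

theorem leaf_zero (t : PlaneTree) : t.leaf 0 = [] := by simp [leaf]

theorem isVertex_leaf_planted (s : PlaneTree) (i : ℕ) :
    (node [s]).IsVertex ((node [s]).leaf i) := by
  have h0 : (node [s]).IsVertex [] := by simp [IsVertex, subtreeAt_nil]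
  cases i with
  | zero => rwa [leaf_zero]
  | succ i =>
    rw [leaf_planted_succ]
    by_cases hi : i < s.tips.length
    · have h : s.IsVertex s.tips[i] := isVertex_of_mem_tips (List.getElem_mem hi)
      rw [List.getD_eq_getElem _ _ (by simpa using hi), List.getElem_map]
      unfold IsVertex at h ⊢
      rw [subtreeAt_cons]
      simpa using h
    · rwa [List.getD_eq_default _ _ (by simpa using hi)]

/-- The pairs of consecutive entries of `M` at distance `l`, the last entry being followed by the
root address `[]`. -/
theorem sum_addrDist_getD (M : List (List ℕ)) (hM : M ≠ []) (l : ℕ) :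
    ∑ i ∈ Finset.range M.length,
        (if addrDist (M.getD i []) (M.getD (i + 1) []) = l then (1 : ℝ) else 0)
      = (gaps M).count l + if (M.getLastD []).length = l then 1 else 0 := by
  induction M with
  | nil => exact absurd rfl hM
  | cons u M ih =>
    cases M with
    | nil => rw [List.length_singleton, Finset.sum_range_one]; simp
    | cons v M =>
      rw [List.length_cons, Finset.sum_range_succ']
      have := ih (by simp)
      simp only [List.getD_cons_succ, List.getD_cons_zero, gaps_cons_cons, List.count_cons,
        List.getLastD_cons, beq_iff_eq] at this ⊢
      rw [this]
      push_cast
      ring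

/-- The number of leaves of a planted tree that are at distance `l` from the next leaf, or from the
root in the case of the last leaf. -/
theorem sum_dist_leaf_planted (s : PlaneTree) (l : ℕ) :
    ∑ i ∈ Finset.Icc 1 (numTips s),
        (if (node [s]).graph.dist ((node [s]).leaf i) ((node [s]).leaf (i + 1)) = l
          then (1 : ℝ) else 0)
      = (gaps s.tips).count l + if rightDepth s + 1 = l then 1 else 0 := by
  have h := sum_addrDist_getD (s.tips.map (0 :: ·)) (by simp [tips_ne_nil]) l
  have hlast : ((s.tips.map (0 :: ·)).getLastD []).length = rightDepth s + 1 := by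
    obtain ⟨L, u, h, hu⟩ := exists_tips_eq_concat s
    rw [h, hu]; simp
  rw [gaps_map_cons, hlast, List.length_map] at h
  simp_rw [dist_eq_addrDist (isVertex_leaf_planted s _) (isVertex_leaf_planted s _)]
  rw [← h, Finset.range_eq_Ico]
  simp_rw [← leaf_planted_succ]
  exact (Finset.sum_Ico_add' (fun i =>
    if addrDist ((node [s]).leaf i) ((node [s]).leaf (i + 1)) = l then (1 : ℝ) else 0) 0
      s.tips.length 1).symm

theorem dist_first_leaf_planted (s : PlaneTree) :
    (node [s]).graph.dist ((node [s]).leaf 0) ((node [s]).leaf 1) = leftDepth s + 1 := by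
  rw [dist_eq_addrDist (isVertex_leaf_planted s _) (isVertex_leaf_planted s _), leaf_zero,
    leaf_planted_succ]
  obtain ⟨u, L, h, hu⟩ := exists_tips_eq_cons s
  simp [h, hu]

theorem mem_dualTrees_iff {t : PlaneTree} {n : ℕ} :
    t ∈ dualTrees n ↔ 2 ≤ n ∧ ∃ s, t = node [s] ∧ IsReduced s ∧ numTips s = n := by
  constructor
  · rintro ⟨hn, hl, hc, hr⟩
    obtain ⟨ts⟩ := t
    obtain ⟨s, hs⟩ := List.length_eq_one_iff.1 hc
    have hs' : ts = [s] := hs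
    subst hs'
    refine ⟨hn, s, rfl, fun u s' h => hr (0 :: u) s' (by simp) (by
      rw [subtreeAt_cons]; simpa using h), ?_⟩
    rw [← hl, leaves_planted, List.length_map, numTips]
  · rintro ⟨hn, s, rfl, hs, rfl⟩
    refine ⟨hn, by rw [leaves_planted, List.length_map, numTips], rfl, ?_⟩
    intro u s' hu h
    cases u with
    | nil => exact absurd rfl hu
    | cons i u =>
      rw [subtreeAt_cons, Option.bind_eq_some_iff] at h
      obtain ⟨t, ht, h⟩ := h
      have : t = s := by simpa using List.mem_of_getElem? ht
      exact hs u s' (this ▸ h)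

theorem two_le_numTips {s : PlaneTree} (hs : IsReduced s) (h : 1 ≤ leftDepth s) :
    2 ≤ numTips s := by
  obtain ⟨ts⟩ := s
  rcases ts with _ | ⟨t, _ | ⟨t', f⟩⟩
  · simp [leftDepth_leaf] at h
  · simpa using (isReduced_node.1 hs).1
  · have h1 := numTips_pos t
    have h2 := numTips_pos t'
    rw [numTips_node_cons, forestNumTips_cons]
    omega

/-- The marked dual trees are the planted reduced trees with a chosen tip. The choices of the tip
are counted by a weight: the gaps of length `l`, and the path from the last leaf back to the root. -/
theorem markedCount_eq_coeff {k l : ℕ} (hk : 2 ≤ k) (hl : 2 ≤ l) (n : ℕ) :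
    (markedCount n k l : ℝ) = coeff n (weightSeries reducedTrees numTips fun s =>
      (if leftDepth s + 1 = k then 1 else 0) *
        ((gaps s.tips).count l + if rightDepth s + 1 = l then 1 else 0)) := by
  classical
  have hfin := finiteFibers_reducedTrees n
  have hset : markedDualTrees n k l =
      (fun p : PlaneTree × ℕ => (node [p.1], p.2)) ''
        ((hfin.toFinset ×ˢ Finset.Icc 1 n).filter fun p => leftDepth p.1 + 1 = k ∧
          (node [p.1]).graph.dist ((node [p.1]).leaf p.2) ((node [p.1]).leaf (p.2 + 1)) = l) := by
    ext ⟨t, i⟩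
    simp only [markedDualTrees, mem_dualTrees_iff, Set.mem_ofPred_eq, Set.mem_image,
      Finset.coe_filter, Finset.mem_product, Set.Finite.mem_toFinset, Finset.mem_Icc,
      Prod.mk.injEq, Prod.exists]
    constructor
    · rintro ⟨-, -, ⟨hn, s, rfl, hs, hsn⟩, h1, hi, hi', h2⟩
      rw [dist_first_leaf_planted] at h1
      exact ⟨s, i, ⟨⟨⟨hs, hsn⟩, hi, hi'⟩, h1, h2⟩, rfl, rfl⟩
    · rintro ⟨s, i, ⟨⟨⟨hs, hsn⟩, hi, hi'⟩, h1, h2⟩, rfl, rfl⟩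
      have h3 := two_le_numTips hs (by omega)
      exact ⟨hk, hl, ⟨by omega, s, rfl, hs, hsn⟩, by rw [dist_first_leaf_planted, h1],
        hi, hi', h2⟩
  have hinj : Function.Injective (fun p : PlaneTree × ℕ => (node [p.1], p.2)) := by
    rintro ⟨s, i⟩ ⟨s', i'⟩ h
    simpa using h
  rw [markedCount, hset, Set.ncard_image_of_injective _ hinj, Set.ncard_coe_finset,
    Finset.card_filter, Finset.sum_product, coeff_weightSeries_eq_sum finiteFibers_reducedTrees]
  push_cast
  refine Finset.sum_congr rfl fun s hs => ?_
  have hsn : numTips s = n := ((Set.Finite.mem_toFinset _).1 hs).2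
  rw [← sum_dist_leaf_planted, hsn, Finset.mul_sum]
  refine Finset.sum_congr rfl fun i _ => ?_
  by_cases h : leftDepth s + 1 = k <;> simp [h]

theorem markedCount_eq_zero {n k l : ℕ} (h : ¬ (2 ≤ k ∧ 2 ≤ l)) : markedCount n k l = 0 := by
  have : markedDualTrees n k l = ∅ := by
    ext p
    simp only [markedDualTrees, Set.mem_ofPred_eq, Set.mem_empty_iff_false, iff_false]
    exact fun hp => h ⟨hp.1, hp.2.1⟩
  rw [markedCount, this, Set.ncard_empty]

/-! ### Functional equations -/

/-- The weighted series of the reduced trees, by number of tips. -/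
noncomputable def treeSeries (ω : PlaneTree → ℝ) : ℝ⟦X⟧ :=
  weightSeries reducedTrees numTips ω

/-- The weighted series of the nonempty forests of reduced trees, by number of tips. -/
noncomputable def forestSeries (ω : List PlaneTree → ℝ) : ℝ⟦X⟧ :=
  weightSeries reducedForests forestNumTips ω

/-- The weighted series of the pairs of a reduced tree and a nonempty forest of reduced trees. -/
noncomputable def pairSeries (ω : PlaneTree × List PlaneTree → ℝ) : ℝ⟦X⟧ :=
  weightSeries (reducedTrees ×ˢ reducedForests) (fun p => numTips p.1 + forestNumTips p.2) ω

/-- The series `uSeries` of the nonempty forests of reduced trees. -/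
noncomputable def uSeries : ℝ⟦X⟧ := forestSeries fun _ => 1

/-- The decomposition `reducedTrees_eq` in terms of series. -/
theorem treeSeries_eq (ω : PlaneTree → ℝ) :
    treeSeries ω = C (ω (node [])) * X + pairSeries fun p => ω (node (p.1 :: p.2)) := by
  have hinj : Set.InjOn (fun p : PlaneTree × List PlaneTree => node (p.1 :: p.2))
      (reducedTrees ×ˢ reducedForests) := by
    rintro ⟨s, f⟩ - ⟨s', f'⟩ - h
    simpa using h
  have hfin := finiteFibers_reducedTrees
  have hsub := reducedTrees_eq
  rw [treeSeries]
  nth_rewrite 1 [hsub]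
  rw [weightSeries_union (hfin.mono (hsub ▸ Set.subset_union_left))
    (hfin.mono (by nth_rewrite 2 [hsub]; exact Set.subset_union_right)), weightSeries_singleton,
    weightSeries_image hinj, numTips_leaf, pow_one]
  · congr 1
    exact weightSeries_congr (fun p _ => numTips_node_cons _ _) fun _ _ => rfl
  · rw [Set.disjoint_singleton_left]
    rintro ⟨p, -, h⟩
    simp at h

/-- The decomposition `reducedForests_eq` in terms of series. -/
theorem forestSeries_eq (ω : List PlaneTree → ℝ) :
    forestSeries ω = treeSeries (fun t => ω [t]) + pairSeries fun p => ω (p.1 :: p.2) := by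
  have hinj : Set.InjOn (fun p : PlaneTree × List PlaneTree => p.1 :: p.2)
      (reducedTrees ×ˢ reducedForests) := by
    rintro ⟨s, f⟩ - ⟨s', f'⟩ - h
    simpa using h
  have hinj' : Set.InjOn (fun t : PlaneTree => [t]) reducedTrees := by
    rintro s - s' - h
    simpa using h
  have hfin := finiteFibers_reducedForests
  have hsub := reducedForests_eq
  rw [forestSeries]
  nth_rewrite 1 [hsub]
  rw [weightSeries_union (hfin.mono (hsub ▸ Set.subset_union_left))
    (hfin.mono (by nth_rewrite 2 [hsub]; exact Set.subset_union_right)),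
    weightSeries_image hinj, weightSeries_image hinj']
  · rfl
  · rw [Set.disjoint_left]
    rintro _ ⟨t, -, rfl⟩ ⟨p, ⟨-, hp⟩, h⟩
    exact hp.1 (List.cons.inj h).2

theorem pairSeries_mul (ω : PlaneTree → ℝ) (ω' : List PlaneTree → ℝ) :
    pairSeries (fun p => ω p.1 * ω' p.2) = treeSeries ω * forestSeries ω' :=
  weightSeries_prod finiteFibers_reducedTrees finiteFibers_reducedForests ω ω'

theorem pairSeries_left (ω : PlaneTree → ℝ) :
    pairSeries (fun p => ω p.1) = treeSeries ω * uSeries := by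
  have h := pairSeries_mul ω fun _ => 1
  simp only [mul_one] at h
  exact h

theorem pairSeries_right (ω : List PlaneTree → ℝ) :
    pairSeries (fun p => ω p.2) = treeSeries (fun _ => 1) * forestSeries ω := by
  simpa only [one_mul] using pairSeries_mul (fun _ => 1) ω

theorem pairSeries_congr {ω ω' : PlaneTree × List PlaneTree → ℝ}
    (h : ∀ t, ∀ f ≠ [], ω (t, f) = ω' (t, f)) : pairSeries ω = pairSeries ω' :=
  weightSeries_congr (fun _ _ => rfl) fun p hp => h p.1 p.2 hp.2.1

theorem pairSeries_add (ω ω' : PlaneTree × List PlaneTree → ℝ) :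
    pairSeries (fun p => ω p + ω' p) = pairSeries ω + pairSeries ω' :=
  weightSeries_add (finiteFibers_reducedTrees.prod finiteFibers_reducedForests) ω ω'

theorem pairSeries_sum {ι : Type*} (s : Finset ι) (ω : ι → PlaneTree × List PlaneTree → ℝ) :
    pairSeries (fun p => ∑ i ∈ s, ω i p) = ∑ i ∈ s, pairSeries (ω i) :=
  weightSeries_sum (finiteFibers_reducedTrees.prod finiteFibers_reducedForests) s ω

theorem treeSeries_add (ω ω' : PlaneTree → ℝ) :
    treeSeries (fun p => ω p + ω' p) = treeSeries ω + treeSeries ω' :=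
  weightSeries_add finiteFibers_reducedTrees ω ω'

theorem pairSeries_zero : pairSeries (fun _ => 0) = 0 := weightSeries_zero _ _

theorem treeSeries_one_eq : treeSeries (fun _ => 1) = X + treeSeries (fun _ => 1) * uSeries := by
  conv_lhs => rw [treeSeries_eq, pairSeries_left (fun _ => 1)]
  simp

theorem uSeries_eq : uSeries = treeSeries (fun _ => 1) + treeSeries (fun _ => 1) * uSeries := by
  conv_lhs => rw [uSeries, forestSeries_eq, pairSeries_left (fun _ => 1)]

/-- The equation `uSeries (1 - uSeries) = X (1 + uSeries)`. -/
theorem uSeries_mul_one_sub : uSeries * (1 - uSeries) = X * (1 + uSeries) := by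
  linear_combination (1 - uSeries) * uSeries_eq + (1 + uSeries) * treeSeries_one_eq

theorem one_add_uSeries_mul : (1 + uSeries) * (1 - treeSeries (fun _ => 1)) = 1 := by
  linear_combination uSeries_eq

theorem treeSeries_one_mul : treeSeries (fun _ => 1) * (1 + uSeries) = uSeries := by
  linear_combination -uSeries_eq

/-! ### Series for the depths of the first and the last leaf -/

/-- Every level above the first tip contributes the nonempty forest to the right of the path. -/
theorem treeSeries_leftDepth (k : ℕ) :
    treeSeries (fun t => if leftDepth t = k then 1 else 0) = X * uSeries ^ k := by
  induction k with
  | zero => rw [treeSeries_eq]; simp [leftDepth_leaf, leftDepth_node_cons, pairSeries_zero]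
  | succ k ih =>
    rw [treeSeries_eq]
    simp only [leftDepth_leaf, leftDepth_node_cons, Nat.add_right_cancel_iff]
    rw [pairSeries_left (fun t => if leftDepth t = k then 1 else 0), ih]
    simp [pow_succ, mul_assoc]

theorem forestSeries_leftDepth (k : ℕ) :
    forestSeries (fun f => if forestLeftDepth f = k then 1 else 0) =
        X * uSeries ^ k * (1 + uSeries) := by
  rw [forestSeries_eq]
  change treeSeries (fun t => if leftDepth t = k then 1 else 0) +
    pairSeries (fun p => if leftDepth p.1 = k then 1 else 0) = _
  rw [pairSeries_left (fun t => if leftDepth t = k then 1 else 0), treeSeries_leftDepth]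
  ring

theorem forestRightDepth_cons {f : List PlaneTree} (hf : f ≠ []) (t : PlaneTree) :
    forestRightDepth (t :: f) = forestRightDepth f := by
  cases f with
  | nil => exact absurd rfl hf
  | cons t' f => rfl

/-- The last tip of a forest lies in its last tree, which may be preceded by an arbitrary forest. -/
theorem forestSeries_rightDepth_eq (k : ℕ) :
    forestSeries (fun f => if forestRightDepth f = k then 1 else 0)
      = (1 + uSeries) * treeSeries (fun t => if rightDepth t = k then 1 else 0) := by
  have h : forestSeries (fun f => if forestRightDepth f = k then 1 else 0) =
      treeSeries (fun t => if rightDepth t = k then 1 else 0) + treeSeries (fun _ => 1) *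
        forestSeries (fun f => if forestRightDepth f = k then 1 else 0) := by
    conv_lhs => rw [forestSeries_eq]
    rw [← pairSeries_right]
    congr 1
    exact pairSeries_congr fun t f hf => by simp only [forestRightDepth_cons hf]
  linear_combination (1 + uSeries) * h -
    forestSeries (fun f => if forestRightDepth f = k then 1 else 0) * one_add_uSeries_mul

theorem treeSeries_rightDepth (k : ℕ) :
    treeSeries (fun t => if rightDepth t = k then 1 else 0) = X * uSeries ^ k := by
  induction k with
  | zero => rw [treeSeries_eq]; simp [rightDepth_leaf, rightDepth_node_cons, pairSeries_zero]
  | succ k ih =>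
    rw [treeSeries_eq]
    simp only [rightDepth_leaf, rightDepth_node_cons, Nat.add_right_cancel_iff]
    rw [pairSeries_congr (ω' := fun p => if forestRightDepth p.2 = k then 1 else 0)
      fun t f hf => by simp only [forestRightDepth_cons hf]]
    rw [pairSeries_right (fun f => if forestRightDepth f = k then 1 else 0),
      forestSeries_rightDepth_eq, ih]
    simp only [Nat.zero_ne_add_one, if_false, map_zero]
    linear_combination X * uSeries ^ k * treeSeries_one_mul

/-- The series of the reduced trees whose first and last tips have depths `k` and `j`. -/
noncomputable def depthSeries (k j : ℕ) : ℝ⟦X⟧ :=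
  treeSeries fun t => (if leftDepth t = k then 1 else 0) * if rightDepth t = j then 1 else 0

theorem depthSeries_zero_zero : depthSeries 0 0 = X := by
  rw [depthSeries, treeSeries_eq]
  simp [leftDepth_leaf, rightDepth_leaf, leftDepth_node_cons, pairSeries_zero]

theorem depthSeries_zero_succ (j : ℕ) : depthSeries 0 (j + 1) = 0 := by
  rw [depthSeries, treeSeries_eq]
  simp [leftDepth_leaf, rightDepth_leaf, leftDepth_node_cons, pairSeries_zero]

theorem depthSeries_succ_zero (k : ℕ) : depthSeries (k + 1) 0 = 0 := by
  rw [depthSeries, treeSeries_eq]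
  simp [leftDepth_leaf, rightDepth_leaf, rightDepth_node_cons, pairSeries_zero]

theorem depthSeries_succ_succ (k j : ℕ) :
    depthSeries (k + 1) (j + 1) = X ^ 2 * (1 + uSeries) * uSeries ^ (k + j) := by
  rw [depthSeries, treeSeries_eq]
  simp only [leftDepth_leaf, rightDepth_leaf, leftDepth_node_cons, rightDepth_node_cons,
    Nat.add_right_cancel_iff, Nat.zero_ne_add_one, if_false, mul_zero, map_zero, zero_mul, zero_add]
  rw [pairSeries_congr (ω' := fun p => (if leftDepth p.1 = k then 1 else 0) *
    if forestRightDepth p.2 = j then 1 else 0)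
      fun t f hf => by simp only [forestRightDepth_cons hf]]
  rw [pairSeries_mul (fun t => if leftDepth t = k then 1 else 0)
    (fun f => if forestRightDepth f = j then 1 else 0), treeSeries_leftDepth,
    forestSeries_rightDepth_eq, treeSeries_rightDepth]
  ring

/-! ### Series for the gaps between consecutive leaves -/

/-- The indicator of `a + b + 2 = l + 2` as a sum of products of indicators. -/
theorem ite_add_add_two (a b l : ℕ) :
    (if a + b + 2 = l + 2 then (1 : ℝ) else 0) = ∑ ij ∈ Finset.HasAntidiagonal.antidiagonal l,
      (if a = ij.1 then 1 else 0) * if b = ij.2 then 1 else 0 := by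
  by_cases h : a + b = l
  · rw [if_pos (by omega), Finset.sum_eq_single (a, b)]
    · simp
    · rintro ⟨i, j⟩ _ hne
      by_cases ha : a = i <;> by_cases hb : b = j <;> simp_all
    · intro hn
      exact absurd (Finset.HasAntidiagonal.mem_antidiagonal.2 h) hn
  · rw [if_neg (by omega)]
    symm
    refine Finset.sum_eq_zero ?_
    rintro ⟨i, j⟩ hij
    have hij : i + j = l := Finset.HasAntidiagonal.mem_antidiagonal.1 hij
    by_cases ha : a = i <;> by_cases hb : b = j <;> simp_all

/-- The series of the pairs of a tree and a forest, put side by side below a common parent, such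
that the gap between the two has length `l + 2`. -/
theorem pairSeries_junction (ω : PlaneTree → ℝ) (l : ℕ) :
    pairSeries (fun p => ω p.1 *
        if rightDepth p.1 + forestLeftDepth p.2 + 2 = l + 2 then 1 else 0)
      = ∑ ij ∈ Finset.HasAntidiagonal.antidiagonal l,
        treeSeries (fun t => ω t * if rightDepth t = ij.1 then 1 else 0) *
          (X * uSeries ^ ij.2 * (1 + uSeries)) := by
  simp_rw [ite_add_add_two, Finset.mul_sum, ← mul_assoc]
  rw [pairSeries_sum]
  refine Finset.sum_congr rfl fun ij _ => ?_
  rw [pairSeries_mul (fun t => ω t * if rightDepth t = ij.1 then 1 else 0)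
    (fun f => if forestLeftDepth f = ij.2 then 1 else 0), forestSeries_leftDepth]
  ring

theorem count_forestGaps_cons {f : List PlaneTree} (hf : f ≠ []) (t : PlaneTree) (l : ℕ) :
    ((forestGaps (t :: f)).count l : ℝ) = (gaps t.tips).count l +
      (if rightDepth t + forestLeftDepth f + 2 = l then 1 else 0) + (forestGaps f).count l := by
  cases f with
  | nil => exact absurd rfl hf
  | cons t' f =>
    simp only [forestGaps, List.count_append, List.count_cons, forestLeftDepth, beq_iff_eq]
    push_cast
    ring_nf

/-- The series counting the gaps of length `l` in reduced trees. -/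
noncomputable def gapSeries (l : ℕ) : ℝ⟦X⟧ := treeSeries fun t => (gaps t.tips).count l

/-- The series counting the gaps of length `l` in nonempty forests of reduced trees. -/
noncomputable def forestGapSeries (l : ℕ) : ℝ⟦X⟧ := forestSeries fun f => (forestGaps f).count l

theorem sum_antidiagonal_uSeries (l : ℕ) (p : ℝ⟦X⟧) :
    ∑ ij ∈ Finset.HasAntidiagonal.antidiagonal l, uSeries ^ ij.1 * uSeries ^ ij.2 * p =
        ((l : ℝ⟦X⟧) + 1) * uSeries ^ l * p := by
  rw [← Finset.sum_mul, Finset.sum_congr rfl (g := fun _ => uSeries ^ l)]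
  · simp
  · intro ij hij
    rw [← pow_add, Finset.HasAntidiagonal.mem_antidiagonal.1 hij]

theorem pairSeries_forestGaps (l : ℕ) :
    pairSeries (fun p => (forestGaps (p.1 :: p.2)).count (l + 2)) =
      gapSeries (l + 2) * uSeries + ((l : ℝ⟦X⟧) + 1) * uSeries ^ l * (X ^ 2 * (1 + uSeries)) +
        treeSeries (fun _ => 1) * forestGapSeries (l + 2) := by
  rw [pairSeries_congr (ω' := fun p => (gaps p.1.tips).count (l + 2) +
      (if rightDepth p.1 + forestLeftDepth p.2 + 2 = l + 2 then 1 else 0) +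
        (forestGaps p.2).count (l + 2)) fun t f hf => count_forestGaps_cons hf t (l + 2),
    pairSeries_add,
    pairSeries_add, pairSeries_left (fun t => ((gaps t.tips).count (l + 2) : ℝ)),
    pairSeries_right (fun f => ((forestGaps f).count (l + 2) : ℝ)), gapSeries, forestGapSeries]
  congr 2
  have h := pairSeries_junction (fun _ => 1) l
  simp only [one_mul] at h
  rw [h, ← sum_antidiagonal_uSeries]
  refine Finset.sum_congr rfl fun ij _ => ?_
  rw [treeSeries_rightDepth]
  ring

/-- A gap of a reduced tree lies in the first subtree, between the first and the second subtree, or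
in the forest formed by the other subtrees. -/
theorem gapSeries_eq (l : ℕ) :
    gapSeries (l + 2) = gapSeries (l + 2) * uSeries +
        ((l : ℝ⟦X⟧) + 1) * uSeries ^ l * (X ^ 2 * (1 + uSeries)) +
        treeSeries (fun _ => 1) * forestGapSeries (l + 2) := by
  conv_lhs => rw [gapSeries, treeSeries_eq]
  rw [← pairSeries_forestGaps]
  simp [gaps_tips_leaf, gaps_tips_node_cons]

theorem forestGapSeries_eq (l : ℕ) :
    forestGapSeries (l + 2) = gapSeries (l + 2) + gapSeries (l + 2) * uSeries +
      ((l : ℝ⟦X⟧) + 1) * uSeries ^ l * (X ^ 2 * (1 + uSeries)) +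
        treeSeries (fun _ => 1) * forestGapSeries (l + 2) := by
  conv_lhs => rw [forestGapSeries, forestSeries_eq]
  rw [pairSeries_forestGaps, ← add_assoc, ← add_assoc]
  rfl

/-- The linear system formed by `gapSeries_eq` and `forestGapSeries_eq`, solved for the series of
the forests. -/
theorem forestGapSeries_mul (l : ℕ) :
    forestGapSeries (l + 2) * (1 - 2 * uSeries - uSeries ^ 2) =
      2 * ((l : ℝ⟦X⟧) + 1) * X ^ 2 * uSeries ^ l * (1 + uSeries) ^ 2 := by
  have h1 := gapSeries_eq l
  have h2 := forestGapSeries_eq l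
  have h3 := treeSeries_one_mul
  linear_combination 2 * (1 + uSeries) * h1 + (1 - uSeries ^ 2) * (h2 - h1) +
    2 * forestGapSeries (l + 2) * h3

/-- The series counting the gaps of length `l` in reduced trees whose first tip has depth `k`. -/
noncomputable def leftDepthGapSeries (k l : ℕ) : ℝ⟦X⟧ :=
  treeSeries fun t => (if leftDepth t = k then 1 else 0) * (gaps t.tips).count l

theorem leftDepthGapSeries_zero (l : ℕ) : leftDepthGapSeries 0 l = 0 := by
  rw [leftDepthGapSeries, treeSeries_eq]
  simp [leftDepth_leaf, leftDepth_node_cons, gaps_tips_leaf, pairSeries_zero]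

/-- The recursion on the depth of the first tip: a gap lies in the first subtree, between the first
and the second subtree, or in the forest formed by the other subtrees, which does not affect the
first tip. -/
theorem leftDepthGapSeries_succ (k l : ℕ) :
    leftDepthGapSeries (k + 1) (l + 2) = leftDepthGapSeries k (l + 2) * uSeries +
      (∑ ij ∈ Finset.HasAntidiagonal.antidiagonal l,
        depthSeries k ij.1 * (X * uSeries ^ ij.2 * (1 + uSeries))) +
      X * uSeries ^ k * forestGapSeries (l + 2) := by
  conv_lhs => rw [leftDepthGapSeries, treeSeries_eq]
  simp only [leftDepth_leaf, leftDepth_node_cons, Nat.add_right_cancel_iff, Nat.zero_ne_add_one,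
    if_false, zero_mul, map_zero, zero_add, gaps_tips_node_cons]
  rw [pairSeries_congr (ω' := fun p => (if leftDepth p.1 = k then 1 else 0) *
        (gaps p.1.tips).count (l + 2) +
      (if leftDepth p.1 = k then 1 else 0) *
        (if rightDepth p.1 + forestLeftDepth p.2 + 2 = l + 2 then 1 else 0) +
      (if leftDepth p.1 = k then 1 else 0) * (forestGaps p.2).count (l + 2)) fun t f hf => by
        simp only [count_forestGaps_cons hf, mul_add],
    pairSeries_add, pairSeries_add,
    pairSeries_left (fun t => (if leftDepth t = k then 1 else 0) * (gaps t.tips).count (l + 2)),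
    pairSeries_mul (fun t => if leftDepth t = k then 1 else 0)
      (fun f => ((forestGaps f).count (l + 2) : ℝ)),
    pairSeries_junction (fun t => if leftDepth t = k then 1 else 0), treeSeries_leftDepth]
  rfl

theorem sum_depthSeries_zero (l : ℕ) :
    ∑ ij ∈ Finset.HasAntidiagonal.antidiagonal l,
        depthSeries 0 ij.1 * (X * uSeries ^ ij.2 * (1 + uSeries))
      = X ^ 2 * uSeries ^ l * (1 + uSeries) := by
  rw [Finset.Nat.sum_antidiagonal_eq_sum_range_succ_mk, Finset.sum_range_succ',
    Finset.sum_eq_zero]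
  · simp only [depthSeries_zero_zero, tsub_zero]
    ring
  · intro i _
    simp [depthSeries_zero_succ]

theorem sum_depthSeries_succ (k l : ℕ) :
    ∑ ij ∈ Finset.HasAntidiagonal.antidiagonal l,
        depthSeries (k + 1) ij.1 * (X * uSeries ^ ij.2 * (1 + uSeries))
      = (l : ℝ⟦X⟧) * X ^ 3 * (1 + uSeries) ^ 2 * uSeries ^ (k + l - 1) := by
  cases l with
  | zero => simp [depthSeries_succ_zero]
  | succ l =>
    rw [Finset.Nat.sum_antidiagonal_eq_sum_range_succ_mk, Finset.sum_range_succ',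
      Finset.sum_congr rfl (g := fun _ => X ^ 3 * (1 + uSeries) ^ 2 * uSeries ^ (k + l))]
    · simp only [depthSeries_succ_zero, Finset.sum_const, Finset.card_range, nsmul_eq_mul]
      push_cast
      rw [show k + (l + 1) - 1 = k + l by omega]
      ring
    · intro i hi
      have hi : i < l + 1 := by simpa using hi
      rw [depthSeries_succ_succ, show l + 1 - (i + 1) = l - i by omega]
      have : uSeries ^ (k + l) = uSeries ^ (k + i) * uSeries ^ (l - i) := by
        rw [← pow_add]; congr 1; omega
      rw [this]
      ring

/-- The solution of the recursion `leftDepthGapSeries_succ`. The exponent `k + l - 2` is truncated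
only if `k + l < 2`, and then the coefficient `k * l` vanishes. -/
theorem leftDepthGapSeries_eq (k l : ℕ) :
    leftDepthGapSeries (k + 1) (l + 2) =
      ((k : ℝ⟦X⟧) + 1) * X * uSeries ^ k * forestGapSeries (l + 2) +
          X ^ 2 * (1 + uSeries) * uSeries ^ (k + l) +
        (k : ℝ⟦X⟧) * (l : ℝ⟦X⟧) * X ^ 3 * (1 + uSeries) ^ 2 * uSeries ^ (k + l - 2) := by
  induction k with
  | zero =>
    rw [leftDepthGapSeries_succ, leftDepthGapSeries_zero, sum_depthSeries_zero]
    simp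
    ring
  | succ k ih =>
    rw [leftDepthGapSeries_succ, ih, sum_depthSeries_succ]
    rcases Nat.eq_zero_or_pos l with rfl | hl
    · push_cast
      simp only [add_zero]
      ring
    · have h1 : uSeries ^ (k + 1 + l - 2) = uSeries ^ (k + l - 1) := by congr 1; omega
      rw [h1]
      rcases Nat.eq_zero_or_pos k with rfl | hk
      · push_cast
        ring
      · have h2 : uSeries ^ (k + l - 1) = uSeries ^ (k + l - 2) * uSeries := by
          rw [← pow_succ]; congr 1; omega
        rw [h2]
        push_cast
        ring

/-- The number of marked dual trees as a coefficient of the series in `uSeries` that gives the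
generating series of these trees for fixed `k` and `l`. -/
theorem markedCount_eq (n k l : ℕ) :
    (markedCount n (k + 2) (l + 2) : ℝ) = coeff n
      (((k : ℝ⟦X⟧) + 1) * X * uSeries ^ k * forestGapSeries (l + 2) +
          2 * (X ^ 2 * (1 + uSeries) * uSeries ^ (k + l)) +
        (k : ℝ⟦X⟧) * (l : ℝ⟦X⟧) * X ^ 3 * (1 + uSeries) ^ 2 * uSeries ^ (k + l - 2)) := by
  rw [markedCount_eq_coeff (by omega) (by omega)]
  congr 1
  have h := leftDepthGapSeries_eq k l
  have h' := depthSeries_succ_succ k l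
  rw [leftDepthGapSeries] at h
  rw [depthSeries] at h'
  change treeSeries _ = _
  simp only [show ∀ a b : ℕ, a + 1 = b + 2 ↔ a = b + 1 by omega,
    mul_add]
  rw [treeSeries_add, h, h']
  ring

/-! ### The series `uSeries` and `wSeries = 1 / √(1 - 6 X + X ^ 2)` -/

theorem constantCoeff_uSeries : constantCoeff uSeries = 0 := by
  rw [← coeff_zero_eq_constantCoeff_apply, uSeries, forestSeries, coeff_weightSeries]
  have : {f | f ∈ reducedForests ∧ forestNumTips f = 0} = ∅ := by
    ext f
    simp only [Set.mem_ofPred_eq, Set.mem_empty_iff_false, iff_false]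
    rintro ⟨⟨hf, -⟩, h⟩
    have := length_le_forestNumTips f
    have := List.length_pos_of_ne_nil hf
    omega
  rw [this, finsum_mem_empty]

/-- The series `wSeries = (1 + uSeries) / (1 - 2 uSeries - uSeries ^ 2)`, which is the inverse of
`1 - X - 2 uSeries = √(1 - 6 X + X ^ 2)`. -/
noncomputable def wSeries : ℝ⟦X⟧ := (1 + uSeries) * (1 - 2 * uSeries - uSeries ^ 2)⁻¹

theorem wSeries_mul_quadratic : wSeries * (1 - 2 * uSeries - uSeries ^ 2) = 1 + uSeries := by
  rw [wSeries, mul_assoc, PowerSeries.inv_mul_cancel, mul_one]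
  simp [constantCoeff_uSeries]

theorem one_add_uSeries_ne_zero : (1 + uSeries : ℝ⟦X⟧) ≠ 0 := by
  intro h
  have := congrArg constantCoeff h
  simp [constantCoeff_uSeries] at this

/-- The series `wSeries` is the inverse of the square root `1 - X - 2 * uSeries` of the
discriminant. -/
theorem wSeries_mul_linear : wSeries * (1 - X - 2 * uSeries) = 1 := by
  refine mul_right_cancel₀ one_add_uSeries_ne_zero ?_
  linear_combination wSeries_mul_quadratic + wSeries * uSeries_mul_one_sub

/-- The square of `1 - X - 2 * uSeries` is the discriminant of the quadratic equation for
`uSeries`. -/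
theorem linear_sq : (1 - X - 2 * uSeries) ^ 2 = (1 - 6 * X + X ^ 2 : ℝ⟦X⟧) := by
  linear_combination -4 * uSeries_mul_one_sub

theorem wSeries_sq_mul : wSeries ^ 2 * (1 - 6 * X + X ^ 2) = 1 := by
  linear_combination (wSeries * (1 - X - 2 * uSeries) + 1) * wSeries_mul_linear -
      wSeries ^ 2 * linear_sq

theorem constantCoeff_wSeries : constantCoeff wSeries = 1 := by
  have := congrArg constantCoeff wSeries_mul_quadratic
  simpa [constantCoeff_uSeries] using this

theorem forestGapSeries_eq_wSeries (l : ℕ) :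
    forestGapSeries (l + 2) = 2 * ((l : ℝ⟦X⟧) + 1) * X ^ 2 * uSeries ^ l *
        ((1 + uSeries) * wSeries) := by
  refine mul_right_cancel₀ one_add_uSeries_ne_zero ?_
  linear_combination wSeries * forestGapSeries_mul l -
      forestGapSeries (l + 2) * wSeries_mul_quadratic

theorem derivative_uSeries : d⁄dX ℝ uSeries = (1 + uSeries) * wSeries := by
  have h := congrArg (d⁄dX ℝ) uSeries_mul_one_sub
  simp only [Derivation.leibniz, smul_eq_mul, map_sub, map_add, Derivation.map_one_eq_zero,
    derivative_X] at h
  linear_combination wSeries * h - d⁄dX ℝ uSeries * wSeries_mul_linear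

theorem X_mul_derivative_uSeries_pow (m : ℕ) :
    X * d⁄dX ℝ (uSeries ^ m) = (m : ℝ⟦X⟧) * uSeries ^ m * (1 - uSeries) * wSeries := by
  cases m with
  | zero => simp
  | succ m =>
    rw [Derivation.leibniz_pow, derivative_uSeries]
    simp only [nsmul_eq_mul, smul_eq_mul, Nat.add_sub_cancel]
    linear_combination -((m + 1 : ℕ) : ℝ⟦X⟧) * uSeries ^ m * wSeries * uSeries_mul_one_sub

theorem coeff_X_mul_derivative (f : ℝ⟦X⟧) (N : ℕ) :
    coeff N (X * d⁄dX ℝ f) = N * coeff N f := by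
  cases N with
  | zero => simp
  | succ N => rw [coeff_succ_X_mul, coeff_derivative]; push_cast; ring

/-- The Delannoy numbers `D(N - m, N)`, as the coefficients of
`uSeries ^ m / √(1 - 6 X + X ^ 2)`. -/
noncomputable def delannoy (m N : ℕ) : ℝ := coeff N (uSeries ^ m * wSeries)

/-- The differential equation `X_mul_derivative_uSeries_pow` in terms of coefficients. -/
theorem mul_coeff_uSeries_pow (m N : ℕ) : N * coeff N (uSeries ^ m) =
    m * (delannoy m N - delannoy (m + 1) N) := by
  have h := congrArg (coeff N) (X_mul_derivative_uSeries_pow m)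
  rw [coeff_X_mul_derivative] at h
  have h' : (m : ℝ⟦X⟧) * uSeries ^ m * (1 - uSeries) * wSeries =
      C (m : ℝ) * (uSeries ^ m * wSeries - uSeries ^ (m + 1) * wSeries) := by
    rw [map_natCast]; ring
  rw [h, h', coeff_C_mul, map_sub, delannoy, delannoy]

/-- The three-term recurrence for the Delannoy numbers along a line. -/
theorem delannoy_recurrence (m N : ℕ) :
    ((N : ℝ) - m) * delannoy m N = (2 * N + 1) * delannoy (m + 1) N +
        (N - m - 1) * delannoy (m + 2) N := by
  have h1 := mul_coeff_uSeries_pow m N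
  have h2 := mul_coeff_uSeries_pow (m + 1) N
  have h3 : delannoy m N - (delannoy (m + 1) N + delannoy (m + 1) N) - delannoy (m + 2) N
      = coeff N (uSeries ^ m) + coeff N (uSeries ^ (m + 1)) := by
    simp only [delannoy, ← map_sub, ← map_add]
    congr 1
    linear_combination uSeries ^ m * wSeries_mul_quadratic
  push_cast at h2
  linear_combination (N : ℝ) * h3 + h1 + h2

theorem exists_uSeries_eq_X_mul : ∃ v : ℝ⟦X⟧, uSeries = X * v ∧ constantCoeff v = 1 := by
  obtain ⟨v, hv⟩ := X_dvd_iff.2 constantCoeff_uSeries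
  refine ⟨v, hv, ?_⟩
  have h : v = 1 + uSeries + X * v ^ 2 := by
    refine mul_left_cancel₀ (X_ne_zero (R := ℝ)) ?_
    have := uSeries_mul_one_sub
    linear_combination this + (uSeries + X * v - 1) * hv
  rw [h]
  simp [constantCoeff_uSeries]

theorem delannoy_self (N : ℕ) : delannoy N N = 1 := by
  obtain ⟨v, hv, hv1⟩ := exists_uSeries_eq_X_mul
  rw [delannoy, hv, mul_pow, mul_assoc]
  have := coeff_X_pow_mul (v ^ N * wSeries) N 0
  rw [zero_add] at this
  rw [this]
  simp [hv1, constantCoeff_wSeries]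

theorem delannoy_eq_zero {m N : ℕ} (h : N < m) : delannoy m N = 0 := by
  obtain ⟨v, hv, hv1⟩ := exists_uSeries_eq_X_mul
  rw [delannoy, hv, mul_pow, mul_assoc, coeff_X_pow_mul', if_neg (by omega)]

/-- The recurrence, read downwards in `m` from `delannoy N N = 1`, has nonnegative coefficients. -/
theorem delannoy_pos_aux (d m : ℕ) : 0 < delannoy m (m + d) ∧ 0 ≤ delannoy (m + 1) (m + d) := by
  induction d generalizing m with
  | zero => simp [delannoy_self, delannoy_eq_zero]
  | succ d ih =>
    obtain ⟨h1, h2⟩ := ih (m + 1)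
    rw [show m + 1 + d = m + (d + 1) by omega] at h1 h2
    refine ⟨?_, h1.le⟩
    have h := delannoy_recurrence m (m + (d + 1))
    push_cast at h
    have h3 : ((d : ℝ) + 1) * delannoy m (m + (d + 1)) =
      (2 * (m + (d + 1)) + 1) * delannoy (m + 1) (m + (d + 1)) +
          d * delannoy (m + 1 + 1) (m + (d + 1)) := by
      linear_combination h
    have h4 : 0 < ((d : ℝ) + 1) * delannoy m (m + (d + 1)) := by rw [h3]; positivity
    exact pos_of_mul_pos_right h4 (by positivity)

theorem delannoy_pos {m N : ℕ} (h : m ≤ N) : 0 < delannoy m N := by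
  have := (delannoy_pos_aux (N - m) m).1
  rwa [show m + (N - m) = N by omega] at this

theorem delannoy_nonneg (m N : ℕ) : 0 ≤ delannoy m N := by
  rcases le_or_gt m N with h | h
  · exact (delannoy_pos h).le
  · exact (delannoy_eq_zero h).ge

/-! ### Ratios of consecutive Delannoy numbers -/

/-- The recurrence as a relation between consecutive ratios. It remains true at `m + 1 = N`, where
the inverse ratio is multiplied by zero. -/
theorem ratio_eq {m N : ℕ} (h : m < N) :
    delannoy m N / delannoy (m + 1) N = (2 * N + 1) / (N - m) +
      (N - m - 1) / (N - m) * (delannoy (m + 1) N / delannoy (m + 2) N)⁻¹ := by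
  have h1 := delannoy_pos (show m + 1 ≤ N from h)
  have h2 := delannoy_recurrence m N
  have h3 : (0 : ℝ) < N - m := by
    have : (m : ℝ) < N := by exact_mod_cast h
    linarith
  rw [inv_div]
  field_simp
  linear_combination h2

theorem two_le_ratio {m N : ℕ} (h : m < N) :
    2 ≤ delannoy m N / delannoy (m + 1) N ∧
        (2 * N + 1) / ((N : ℝ) - m) ≤ delannoy m N / delannoy (m + 1) N := by
  have h3 : (m : ℝ) + 1 ≤ N := by exact_mod_cast h
  have h4 : (2 : ℝ) ≤ (2 * N + 1) / ((N : ℝ) - m) := by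
    rw [le_div_iff₀ (by linarith)]
    have : (0 : ℝ) ≤ m := by positivity
    linarith
  have h5 : (2 * N + 1) / ((N : ℝ) - m) ≤ delannoy m N / delannoy (m + 1) N := by
    rw [ratio_eq h]
    have : 0 ≤ ((N : ℝ) - m - 1) / (N - m) * (delannoy (m + 1) N / delannoy (m + 2) N)⁻¹ :=
      mul_nonneg (div_nonneg (by linarith) (by linarith))
        (inv_nonneg.2 (div_nonneg (delannoy_nonneg _ _) (delannoy_nonneg _ _)))
    linarith
  exact ⟨h4.trans h5, h5⟩

theorem inv_ratio_le (m N : ℕ) : (delannoy m N / delannoy (m + 1) N)⁻¹ ≤ 1 / 2 := by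
  rcases lt_or_ge m N with h | h
  · rw [one_div]
    exact inv_anti₀ (by norm_num) (two_le_ratio h).1
  · rw [delannoy_eq_zero (show N < m + 1 by omega)]
    simp

/-- Along a line, the ratios of consecutive Delannoy numbers are close to the fixed point `1 + √2`
of the contraction `x ↦ 2 + 1 / x`. The induction descends from `m ≈ N / 2`, where the bound is
trivial. -/
theorem abs_ratio_sub_le {m N : ℕ} (hN : 0 < N) (h : 2 * m ≤ N) :
    |delannoy m N / delannoy (m + 1) N - (1 + √2)| ≤ 9 * (m + 1) / N := by
  have hs0 : √2 * √2 = 2 := Real.mul_self_sqrt (by norm_num)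
  have hs1 : 1.4 ≤ √2 := Real.le_sqrt_of_sq_le (by norm_num)
  have hs2 : √2 ≤ 1.5 := Real.sqrt_le_iff.2 (by norm_num)
  obtain ⟨d, hd⟩ : ∃ d, N = 2 * m + d := ⟨N - 2 * m, by omega⟩
  clear h
  have hN1 : (1 : ℝ) ≤ N := by exact_mod_cast hN
  induction d using Nat.strong_induction_on generalizing m with
  | _ d ih =>
    have hm : (0 : ℝ) ≤ m := by positivity
    have hmN : m < N := by omega
    have hmN2 : 2 * (m : ℝ) ≤ N := by
      have : 2 * m ≤ N := by omega
      exact_mod_cast this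
    have hpos : (0 : ℝ) < N - m := by linarith
    have hρ := ratio_eq hmN
    have hρ2 := (two_le_ratio hmN).1
    have hσ2 := inv_ratio_le (m + 1) N
    have hσ0 : 0 ≤ (delannoy (m + 1) N / delannoy (m + 2) N)⁻¹ :=
      inv_nonneg.2 (div_nonneg (delannoy_nonneg _ _) (delannoy_nonneg _ _))
    set ρ := delannoy m N / delannoy (m + 1) N
    set σ := (delannoy (m + 1) N / delannoy (m + 2) N)⁻¹ with hσ
    have hσ' : (N - m - 1) / (N - m) * σ = σ - σ / (N - m) := by field_simp
    have hσ3 : 0 ≤ σ / (N - m) := by positivity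
    rw [hσ'] at hρ
    by_cases hd2 : 2 ≤ d
    · have hm1 : 2 * (m + 1) + (d - 2) = N := by omega
      have hih := @ih (d - 2) (by omega) (m + 1) hm1.symm
      have hρ' := (two_le_ratio (show m + 1 < N by omega)).1
      rw [show m + 1 + 1 = m + 2 from rfl] at hih hρ'
      set ρ' := delannoy (m + 1) N / delannoy (m + 2) N
      have h1 : σ - (√2 - 1) = (1 + √2 - ρ') * (σ * (√2 - 1)) := by
        rw [hσ]
        field_simp
        linear_combination -hs0
      have h2 : |σ - (√2 - 1)| ≤ 9 * (m + 2) / N * (1 / 4) := by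
        rw [h1, abs_mul, abs_sub_comm, abs_of_nonneg (mul_nonneg hσ0 (by linarith))]
        push_cast at hih
        rw [add_assoc, one_add_one_eq_two] at hih
        exact mul_le_mul hih (by nlinarith) (mul_nonneg hσ0 (by linarith)) (by positivity)
      have h3 : (2 * N + 1) / ((N : ℝ) - m) - 2 ≤ (4 * m + 2) / N := by
        rw [div_sub' hpos.ne', div_le_div_iff₀ hpos (by linarith)]
        nlinarith
      have h3' : 0 ≤ (2 * N + 1) / ((N : ℝ) - m) - 2 := by
        rw [div_sub' hpos.ne']
        exact div_nonneg (by linarith) hpos.le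
      have h4 : σ / (N - m) ≤ 1 / N := by
        rw [div_le_div_iff₀ hpos (by linarith)]
        nlinarith
      have h5 : (4 * (m : ℝ) + 2) / N + 1 / N + 9 * (m + 2) / N * (1 / 4) ≤ 9 * (m + 1) / N := by
        rw [← sub_nonneg]
        have : 9 * ((m : ℝ) + 1) / N - ((4 * m + 2) / N + 1 / N + 9 * (m + 2) / N * (1 / 4)) =
          (11 * m + 6) / (4 * N) := by field_simp; ring
        rw [this]
        positivity
      rw [abs_le] at h2 ⊢
      constructor <;> linarith [h2.1, h2.2]
    · have h1 : (2 * N + 1) / ((N : ℝ) - m) ≤ 6 := by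
        rw [div_le_iff₀ hpos]
        linarith
      have h2 : 4.5 ≤ 9 * ((m : ℝ) + 1) / N := by
        have : (N : ℝ) ≤ 2 * m + 1 := by
          have : N ≤ 2 * m + 1 := by omega
          exact_mod_cast this
        rw [le_div_iff₀ (by linarith)]
        linarith
      rw [abs_le]
      constructor <;> linarith

/-- Along a line, the Delannoy numbers decrease like a geometric progression of ratio
`√2 - 1 = 1 / (1 + √2)`, as long as the square of the distance covered is small against `N`. -/
theorem abs_delannoy_mul_pow_sub_le {m N : ℕ} (hN : 0 < N) (h : 9 * m ^ 2 ≤ N) :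
    |delannoy m N * (1 + √2) ^ m - delannoy 0 N| ≤ 9 * m ^ 2 / N * delannoy 0 N := by
  induction m with
  | zero => simp
  | succ m ih =>
    have hm9 : 9 * m ^ 2 ≤ N := le_trans (by gcongr; omega) h
    have hm2 : 2 * m ≤ N := by nlinarith
    have hmN : m < N := by nlinarith
    have hih := ih hm9
    have hN0 : (0 : ℝ) < N := by exact_mod_cast hN
    have h0 := delannoy_pos (Nat.zero_le N)
    have h1 := abs_ratio_sub_le hN hm2
    have h2 := (two_le_ratio hmN).1
    have h3 := delannoy_pos (show m + 1 ≤ N from hmN)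
    have h4 := delannoy_pos hmN.le
    set ρ := delannoy m N / delannoy (m + 1) N with hρ
    have ha : delannoy (m + 1) N = delannoy m N / ρ := by rw [hρ]; field_simp
    set b := delannoy m N * (1 + √2) ^ m with hb
    have hb' : delannoy (m + 1) N * (1 + √2) ^ (m + 1) - b = b * ((1 + √2 - ρ) / ρ) := by
      rw [ha, pow_succ, hb]
      field_simp
    have hθ : 9 * (m : ℝ) ^ 2 / N ≤ 1 := by
      rw [div_le_one hN0]
      exact_mod_cast hm9
    have hb2 : |b| ≤ 2 * delannoy 0 N := by
      have := abs_sub_abs_le_abs_sub b (delannoy 0 N)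
      rw [abs_of_pos h0] at this
      nlinarith
    have h5 : |(1 + √2 - ρ) / ρ| ≤ 9 * (m + 1) / N / 2 := by
      rw [abs_div, abs_sub_comm, abs_of_pos (show 0 < ρ by linarith)]
      exact div_le_div₀ (by positivity) h1 (by norm_num) h2
    have h6 : |delannoy (m + 1) N * (1 + √2) ^ (m + 1) - b| ≤ 9 * (m + 1) / N * delannoy 0 N := by
      rw [hb', abs_mul]
      calc |b| * |(1 + √2 - ρ) / ρ| ≤ 2 * delannoy 0 N * (9 * (m + 1) / N / 2) :=
            mul_le_mul hb2 h5 (abs_nonneg _) (by positivity)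
        _ = _ := by ring
    calc |delannoy (m + 1) N * (1 + √2) ^ (m + 1) - delannoy 0 N|
        ≤ |delannoy (m + 1) N * (1 + √2) ^ (m + 1) - b| + |b - delannoy 0 N| := abs_sub_le _ _ _
      _ ≤ 9 * (m + 1) / N * delannoy 0 N + 9 * m ^ 2 / N * delannoy 0 N := add_le_add h6 hih
      _ = 9 * (m ^ 2 + m + 1) / N * delannoy 0 N := by ring
      _ ≤ _ := by
        push_cast
        gcongr
        have : (0 : ℝ) ≤ m := by positivity
        nlinarith

/-! ### Power series and the functions they represent -/

/-- The power series `p` converges absolutely to the function `g` on the disc of radius `ρ`. -/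
def Represents (p : ℝ⟦X⟧) (g : ℂ → ℂ) (ρ : ℝ) : Prop :=
  ∀ x : ℂ, ‖x‖ < ρ → Summable (fun n => ‖((coeff n p : ℝ) : ℂ) * x ^ n‖) ∧
    HasSum (fun n => ((coeff n p : ℝ) : ℂ) * x ^ n) (g x)

namespace Represents

variable {p p' : ℝ⟦X⟧} {g g' : ℂ → ℂ} {ρ : ℝ}

theorem add (h : Represents p g ρ) (h' : Represents p' g' ρ) :
    Represents (p + p') (fun x => g x + g' x) ρ := by
  intro x hx
  have e : ∀ n, ((coeff n (p + p') : ℝ) : ℂ) * x ^ n =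
      ((coeff n p : ℝ) : ℂ) * x ^ n + ((coeff n p' : ℝ) : ℂ) * x ^ n := by
    intro n; rw [map_add]; push_cast; ring
  simp_rw [e]
  exact ⟨((h x hx).1.add (h' x hx).1).of_nonneg_of_le (fun _ => norm_nonneg _)
    fun _ => norm_add_le _ _, (h x hx).2.add (h' x hx).2⟩

theorem mul (h : Represents p g ρ) (h' : Represents p' g' ρ) :
    Represents (p * p') (fun x => g x * g' x) ρ := by
  intro x hx
  have e : ∀ n, ((coeff n (p * p') : ℝ) : ℂ) * x ^ n = ∑ ij ∈ Finset.HasAntidiagonal.antidiagonal n,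
      (((coeff ij.1 p : ℝ) : ℂ) * x ^ ij.1) * (((coeff ij.2 p' : ℝ) : ℂ) * x ^ ij.2) := by
    intro n
    rw [coeff_mul, Complex.ofReal_sum, Finset.sum_mul]
    refine Finset.sum_congr rfl fun ij hij => ?_
    rw [← Finset.HasAntidiagonal.mem_antidiagonal.1 hij, pow_add]
    push_cast
    ring
  simp_rw [e]
  have hs := summable_norm_sum_mul_antidiagonal_of_summable_norm (h x hx).1 (h' x hx).1
  refine ⟨hs, ?_⟩
  have ht := tsum_mul_tsum_eq_tsum_sum_antidiagonal_of_summable_norm (h x hx).1 (h' x hx).1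
  rw [(h x hx).2.tsum_eq, (h' x hx).2.tsum_eq] at ht
  rw [ht]
  exact hs.of_norm.hasSum

theorem const (c : ℝ) : Represents (C c) (fun _ => (c : ℂ)) ρ := by
  intro x _
  have h0 : ∀ n ≠ 0, ((coeff n (C c) : ℝ) : ℂ) * x ^ n = 0 := by
    intro n hn
    rw [coeff_C, if_neg hn]; simp
  constructor
  · exact summable_of_ne_finset_zero (s := {0}) fun n hn => by
      rw [h0 n (by simpa using hn), norm_zero]
  · have := hasSum_single (f := fun n => ((coeff n (C c) : ℝ) : ℂ) * x ^ n) 0 h0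
    simpa using this

theorem identity : Represents (X : ℝ⟦X⟧) (fun x => x) ρ := by
  intro x _
  have h0 : ∀ n ≠ 1, ((coeff n (X : ℝ⟦X⟧) : ℝ) : ℂ) * x ^ n = 0 := by
    intro n hn
    rw [coeff_X, if_neg hn]; simp
  constructor
  · exact summable_of_ne_finset_zero (s := {1}) fun n hn => by
      rw [h0 n (by simpa using hn), norm_zero]
  · have := hasSum_single (f := fun n => ((coeff n (X : ℝ⟦X⟧) : ℝ) : ℂ) * x ^ n) 1 h0
    simpa using this

theorem pow (h : Represents p g ρ) (m : ℕ) : Represents (p ^ m) (fun x => g x ^ m) ρ := by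
  induction m with
  | zero => simpa using const (ρ := ρ) 1
  | succ m ih => simpa only [pow_succ] using ih.mul h

theorem congr (h : Represents p g ρ) (e : ∀ x, ‖x‖ < ρ → g x = g' x) : Represents p g' ρ :=
  fun x hx => ⟨(h x hx).1, e x hx ▸ (h x hx).2⟩

theorem unique (h : Represents p g ρ) (h' : Represents p g' ρ) {x : ℂ} (hx : ‖x‖ < ρ) :
    g x = g' x :=
  (h x hx).2.unique (h' x hx).2

theorem rescale {c : ℝ} (hc : 0 < c) (h : Represents p g 1) :
    Represents (PowerSeries.rescale c p) (fun x => g (c * x)) c⁻¹ := by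
  intro x hx
  have hx' : ‖(c : ℂ) * x‖ < 1 := by
    rw [norm_mul, Complex.norm_real, Real.norm_of_nonneg hc.le]
    calc c * ‖x‖ < c * c⁻¹ := by gcongr
      _ = 1 := mul_inv_cancel₀ hc.ne'
  have e : ∀ n, ((coeff n (PowerSeries.rescale c p) : ℝ) : ℂ) * x ^ n =
      ((coeff n p : ℝ) : ℂ) * ((c : ℂ) * x) ^ n := by
    intro n; rw [coeff_rescale]; push_cast; ring
  simp_rw [e]
  exact h _ hx'

theorem mono {ρ' : ℝ} (h : Represents p g ρ) (hρ : ρ' ≤ ρ) : Represents p g ρ' :=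
  fun x hx => h x (hx.trans_le hρ)

end Represents

/-! ### The series of `1 / √(1 - X)` -/

/-- The coefficients `centralBinom n / 4 ^ n` of the series of `1 / √(1 - X)`. -/
noncomputable def centralRatio (n : ℕ) : ℝ := n.centralBinom / 4 ^ n

theorem centralRatio_zero : centralRatio 0 = 1 := by simp [centralRatio]

theorem centralRatio_pos (n : ℕ) : 0 < centralRatio n := by
  have := n.centralBinom_pos
  unfold centralRatio; positivity

theorem centralRatio_succ (n : ℕ) : (2 * n + 2) * centralRatio (n + 1) =
    (2 * n + 1) * centralRatio n := by
  have h := Nat.succ_mul_centralBinom_succ n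
  have h' : ((n : ℝ) + 1) * (n + 1).centralBinom = 2 * (2 * n + 1) * n.centralBinom := by
    exact_mod_cast h
  unfold centralRatio
  rw [pow_succ]
  field_simp
  linear_combination 2 * h'

theorem centralRatio_antitone : Antitone centralRatio := by
  refine antitone_nat_of_succ_le fun n => ?_
  have h := centralRatio_succ n
  have := centralRatio_pos (n + 1)
  have := centralRatio_pos n
  nlinarith

theorem centralRatio_le_one (n : ℕ) : centralRatio n ≤ 1 :=
    centralRatio_zero ▸ centralRatio_antitone (Nat.zero_le n)

/-- The series of `1 / √(1 - X)`. -/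
noncomputable def invSqrtSeries : ℝ⟦X⟧ := PowerSeries.mk centralRatio

theorem invSqrtSeries_sq_mul : invSqrtSeries ^ 2 * (1 - X) = 1 := by
  have h : (1 - X) * (2 * d⁄dX ℝ invSqrtSeries) = invSqrtSeries := by
    have : (1 - X) * (2 * d⁄dX ℝ invSqrtSeries) =
        C 2 * (d⁄dX ℝ invSqrtSeries) - C 2 * (X * d⁄dX ℝ invSqrtSeries) := by
      rw [map_ofNat]; ring
    rw [this]
    ext n
    rw [map_sub, coeff_C_mul, coeff_C_mul, coeff_X_mul_derivative, coeff_derivative,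
      invSqrtSeries, coeff_mk, coeff_mk]
    linear_combination centralRatio_succ n
  refine derivative.ext ?_ ?_
  · rw [Derivation.leibniz, Derivation.leibniz_pow, map_sub, derivative_X,
      Derivation.map_one_eq_zero]
    simp only [smul_eq_mul, nsmul_eq_mul, Nat.cast_ofNat, Nat.reduceSub, pow_one]
    linear_combination invSqrtSeries * h
  · have : constantCoeff invSqrtSeries = 1 := by
      rw [← coeff_zero_eq_constantCoeff_apply, invSqrtSeries, coeff_mk, centralRatio_zero]
    simp [this]

theorem norm_centralRatio_mul_pow_le (n : ℕ) (x : ℂ) : ‖(centralRatio n : ℂ) * x ^ n‖ ≤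
    ‖x‖ ^ n := by
  rw [norm_mul, norm_pow, Complex.norm_real, Real.norm_of_nonneg (centralRatio_pos n).le]
  exact mul_le_of_le_one_left (by positivity) (centralRatio_le_one n)

theorem summable_norm_centralRatio_mul_pow {x : ℂ} (hx : ‖x‖ < 1) :
    Summable fun n => ‖(centralRatio n : ℂ) * x ^ n‖ :=
  (summable_geometric_of_lt_one (norm_nonneg _) hx).of_nonneg_of_le (fun _ => norm_nonneg _)
    fun n => norm_centralRatio_mul_pow_le n x

theorem one_sub_mem_slitPlane {x : ℂ} (hx : ‖x‖ < 1) : 1 - x ∈ Complex.slitPlane := by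
  refine Or.inl ?_
  have := (Complex.abs_re_le_norm x).trans_lt hx
  rw [abs_lt] at this
  simp; linarith

theorem half_cpow_sq (z : ℂ) : (z ^ (1 / 2 : ℂ)) ^ 2 = z := by
  rw [← Complex.cpow_nat_mul]
  simp

/-- The sum of the series and the principal value of `1 / √(1 - x)` have the same square and the
same value at `0`, hence they agree on the disc. -/
theorem represents_invSqrtSeries :
    Represents invSqrtSeries (fun x => ((1 - x) ^ (1 / 2 : ℂ))⁻¹) 1 := by
  have h0 : Represents invSqrtSeries (fun x => ∑' n, (centralRatio n : ℂ) * x ^ n) 1 := by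
    intro x hx
    simp only [invSqrtSeries, coeff_mk]
    exact ⟨summable_norm_centralRatio_mul_pow hx,
        (summable_norm_centralRatio_mul_pow hx).of_norm.hasSum⟩
  have hsq : ∀ x : ℂ, ‖x‖ < 1 → (∑' n, (centralRatio n : ℂ) * x ^ n) ^ 2 * (1 - x) = 1 := by
    intro x hx
    have h1 := (h0.pow 2).mul ((Represents.const 1).add ((Represents.const (-1)).mul
      Represents.identity))
    have h2 : invSqrtSeries ^ 2 * (C 1 + C (-1) * X) = C 1 := by
      rw [map_neg, map_one]; linear_combination invSqrtSeries_sq_mul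
    rw [h2] at h1
    have := h1.unique (Represents.const 1) hx
    simpa [sub_eq_add_neg] using this
  have hcont : ContinuousOn (fun x : ℂ => ∑' n,
      (centralRatio n : ℂ) * x ^ n) (Metric.ball 0 1) := by
    rw [Metric.isOpen_ball.continuousOn_iff]
    intro x hx
    have hx : ‖x‖ < 1 := by simpa using hx
    obtain ⟨ρ, hρ1, hρ2⟩ := exists_between hx
    have hc : ContinuousOn (fun x : ℂ => ∑' n, (centralRatio n : ℂ) * x ^ n) (Metric.ball 0 ρ) := by
      refine continuousOn_tsum (u := fun n => ρ ^ n) (fun n => by fun_prop)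
        (summable_geometric_of_lt_one ((norm_nonneg _).trans hρ1.le) hρ2) ?_
      intro n y hy
      have hy : ‖y‖ < ρ := by simpa using hy
      exact (norm_centralRatio_mul_pow_le n y).trans (pow_le_pow_left₀ (norm_nonneg _) hy.le n)
    exact hc.continuousAt (Metric.isOpen_ball.mem_nhds (by simpa using hρ1))
  have hcont' : ContinuousOn (fun x : ℂ => ((1 - x) ^ (1 / 2 : ℂ))) (Metric.ball 0 1) := by
    intro x hx
    refine ContinuousAt.continuousWithinAt ?_
    exact (continuousAt_const.sub continuousAt_id).cpow continuousAt_const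
      (one_sub_mem_slitPlane (by simpa using hx))
  have hne : ∀ x ∈ Metric.ball (0 : ℂ) 1, ((1 - x) ^ (1 / 2 : ℂ)) ≠ 0 := by
    intro x hx h
    have h1 := half_cpow_sq (1 - x)
    rw [h] at h1
    exact Complex.slitPlane_ne_zero (one_sub_mem_slitPlane (x := x) (by simpa using hx))
      (by simpa using h1.symm)
  refine h0.congr fun x hx => ?_
  have hx' : x ∈ Metric.ball (0 : ℂ) 1 := by simpa using hx
  have key := IsPreconnected.eq_of_sq_eq (S := Metric.ball (0 : ℂ) 1)
    (f := fun x : ℂ => ∑' n, (centralRatio n : ℂ) * x ^ n) (g := fun x => ((1 - x) ^ (1 / 2 : ℂ))⁻¹)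
    (convex_ball 0 1).isPreconnected hcont (hcont'.inv₀ hne) ?_ (fun hx => inv_ne_zero (hne _ hx))
    (y := 0) (by simp) ?_
  · exact key hx'
  · intro y hy
    have h1 := hsq y (by simpa using hy)
    have h2 := half_cpow_sq (1 - y)
    have h3 := hne y hy
    simp only [Pi.pow_apply, inv_pow, h2]
    exact eq_inv_of_mul_eq_one_left h1
  · have : ∑' n, (centralRatio n : ℂ) * 0 ^ n = 1 := by
      rw [tsum_eq_single 0]
      · simp [centralRatio_zero]
      · intro n hn; simp [hn]
    simp [this]

open SingularExpansion

/-! ### The functions represented by `wSeries` and `uSeries` -/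

theorem r_sq : r ^ 2 = 6 * r - 1 := by
  have h : √2 * √2 = 2 := Real.mul_self_sqrt (by norm_num)
  unfold r
  linear_combination 4 * h

theorem one_add_sqrt_two_sq : (1 + √2) ^ 2 = r := by
  have h : √2 * √2 = 2 := Real.mul_self_sqrt (by norm_num)
  unfold r
  linear_combination h

theorem r_gt : 5.8 < r := by
  have : 1.4 < √2 := Real.lt_sqrt_of_sq_lt (by norm_num)
  unfold r; linarith

theorem r_pos : 0 < r := by linarith [r_gt]

/-- The discriminant factors as `1 - 6 X + X ^ 2 = (1 - r X) (1 - X / r)`. The sign of the square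
root is fixed by the constant coefficient. -/
theorem wSeries_eq : wSeries = rescale r invSqrtSeries * rescale r⁻¹ invSqrtSeries := by
  have hr := r_pos.ne'
  have h1 := congrArg (rescale r) invSqrtSeries_sq_mul
  have h2 := congrArg (rescale r⁻¹) invSqrtSeries_sq_mul
  have e1 : ∀ c : ℝ, rescale c (1 - X : ℝ⟦X⟧) = 1 - C c * X := by
    intro c
    rw [map_sub, map_one, rescale_X]
  rw [map_mul, map_pow, map_one, e1] at h1 h2
  set P := rescale r invSqrtSeries
  set Q := rescale r⁻¹ invSqrtSeries
  have h3 : (1 - C r * X) * (1 - C r⁻¹ * X) = (1 - 6 * X + X ^ 2 : ℝ⟦X⟧) := by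
    have e2 : C r * C r⁻¹ = (1 : ℝ⟦X⟧) := by
      rw [← map_mul, mul_inv_cancel₀ hr, map_one]
    have e3 : C r + C r⁻¹ = (6 : ℝ⟦X⟧) := by
      rw [← map_add, show r + r⁻¹ = 6 by field_simp; linarith [r_sq], map_ofNat]
    linear_combination X ^ 2 * e2 - X * e3
  have h4 : (P * Q) ^ 2 * (1 - 6 * X + X ^ 2) = 1 := by
    rw [← h3]
    linear_combination Q ^ 2 * (1 - C r⁻¹ * X) * h1 + h2
  have h5 : wSeries ^ 2 = (P * Q) ^ 2 := by
    linear_combination (P * Q) ^ 2 * wSeries_sq_mul - wSeries ^ 2 * h4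
  rcases sq_eq_sq_iff_eq_or_eq_neg.1 h5 with h | h
  · exact h
  · exfalso
    have hB : constantCoeff invSqrtSeries = 1 := by
      rw [← coeff_zero_eq_constantCoeff_apply, invSqrtSeries, coeff_mk, centralRatio_zero]
    have hc : ∀ c : ℝ, constantCoeff (rescale c invSqrtSeries) = 1 := by
      intro c
      rw [← coeff_zero_eq_constantCoeff_apply, coeff_rescale, pow_zero, one_mul,
        coeff_zero_eq_constantCoeff_apply, hB]
    have := congrArg constantCoeff h
    rw [constantCoeff_wSeries, map_neg, map_mul, hc, hc] at this
    norm_num at this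

/-- The square root of `1 - 6 X + X ^ 2 = (1 - r X) (1 - X / r)` at `X = x / r`. -/
noncomputable def sqrtFun (x : ℂ) : ℂ := (1 - x) ^ (1 / 2 : ℂ) * (1 - x / (r : ℂ) ^ 2) ^ (1 / 2 : ℂ)

/-- The function given by the series `uSeries` at `x / r`. -/
noncomputable def uFun (x : ℂ) : ℂ := (1 - x / (r : ℂ) - sqrtFun x) / 2

theorem r_complex_ne_zero : (r : ℂ) ≠ 0 := by exact_mod_cast r_pos.ne'

theorem r_complex_sq : (r : ℂ) ^ 2 = 6 * r - 1 := by exact_mod_cast r_sq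

theorem sqrtFun_sq (x : ℂ) : sqrtFun x ^ 2 = 1 - 6 * (x / r) + (x / r) ^ 2 := by
  rw [sqrtFun, mul_pow, half_cpow_sq, half_cpow_sq]
  have h := r_complex_ne_zero
  field_simp
  linear_combination (-(x : ℂ)) * r_complex_sq

theorem one_sub_div_mem_slitPlane {x : ℂ} (hx : ‖x‖ < 2) :
    1 - x / (r : ℂ) ^ 2 ∈ Complex.slitPlane := by
  apply one_sub_mem_slitPlane
  rw [norm_div, norm_pow, Complex.norm_real, Real.norm_of_nonneg r_pos.le,
    div_lt_one (by have := r_pos; positivity)]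
  nlinarith [r_gt]

theorem represents_wSeries : Represents wSeries (fun x => (sqrtFun (r * x))⁻¹) r⁻¹ := by
  have hr := r_complex_ne_zero
  rw [wSeries_eq]
  refine ((represents_invSqrtSeries.rescale r_pos).mul
    ((represents_invSqrtSeries.rescale (inv_pos.2 r_pos)).mono ?_)).congr ?_
  · rw [inv_inv]
    exact (inv_le_one_of_one_le₀ (by linarith [r_gt])).trans (by linarith [r_gt])
  · intro x _
    rw [sqrtFun, mul_inv]
    congr 4
    push_cast
    field_simp

theorem represents_uSeries : Represents uSeries (fun x => uFun (r * x)) r⁻¹ := by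
  have hr := r_complex_ne_zero
  have e : uSeries = C (1 / 2) * (C 1 + C (-1) * X +
      C (-1) * ((C 1 + C (-6) * X + X ^ 2) * wSeries)) := by
    have h1 : C (1 / 2 : ℝ) * 2 = (1 : ℝ⟦X⟧) := by
      rw [show (2 : ℝ⟦X⟧) = C 2 from (map_ofNat _ _).symm, ← map_mul]
      norm_num
    have h2 : C (-6 : ℝ) = (-6 : ℝ⟦X⟧) := by rw [map_neg, map_ofNat]
    have h3 : C (-1 : ℝ) = (-1 : ℝ⟦X⟧) := by rw [map_neg, map_one]
    rw [h2, h3, map_one]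
    linear_combination (-uSeries) * h1 +
        C (1 / 2 : ℝ) * ((1 - X - 2 * uSeries) * wSeries_mul_linear - wSeries * linear_sq)
  have X1 : Represents (X : ℝ⟦X⟧) (fun x => x) r⁻¹ := .identity
  rw [e]
  refine ((Represents.const _).mul (((Represents.const _).add ((Represents.const _).mul X1)).add
    ((Represents.const _).mul ((((Represents.const _).add ((Represents.const _).mul X1)).add
      (X1.pow 2)).mul represents_wSeries)))).congr fun x _ => ?_
  have h := sqrtFun_sq (r * x)
  rw [mul_div_cancel_left₀ x hr] at h
  rw [uFun, mul_div_cancel_left₀ x hr]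
  push_cast
  rw [show (1 : ℂ) + -6 * x + x ^ 2 = sqrtFun (r * x) ^ 2 by rw [h]; ring]
  by_cases h0 : sqrtFun (r * x) = 0
  · rw [h0]; ring
  · field_simp
    ring

/-! ### Asymptotics of the central Delannoy numbers -/

/-- The square of `centralRatio n` is, up to the factor `2 n + 1`, the inverse of a partial product
of Wallis' formula. -/
theorem centralRatio_sq_bounds (n : ℕ) :
    1 ≤ Real.pi * (n + 1 / 2) * centralRatio n ^ 2 ∧
      Real.pi * (n + 1 / 2) * centralRatio n ^ 2 ≤ 1 + 1 / (2 * n + 1) := by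
  have hW : centralRatio n ^ 2 * ((2 * n + 1) * Real.Wallis.W n) = 1 := by
    induction n with
    | zero => simp [centralRatio_zero, Real.Wallis.W]
    | succ n ih =>
      have h := centralRatio_succ n
      have h' : centralRatio (n + 1) = (2 * n + 1) / (2 * n + 2) * centralRatio n := by
          field_simp; linarith
      rw [Real.Wallis.W_succ, h']
      push_cast
      have e : ((2 * (n : ℝ) + 1) / (2 * n + 2) * centralRatio n) ^ 2 * ((2 * (n + 1) + 1) *
        (Real.Wallis.W n * ((2 * n + 2) / (2 * n + 1) * ((2 * n + 2) / (2 * n + 3))))) =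
          centralRatio n ^ 2 * ((2 * n + 1) * Real.Wallis.W n) := by
        field_simp
        ring
      rw [e, ih]
  have h1 := Real.Wallis.W_le n
  have h2 := Real.Wallis.le_W n
  have hn : (0 : ℝ) < 2 * n + 1 := by positivity
  have hb : 0 < centralRatio n ^ 2 := by have := centralRatio_pos n; positivity
  constructor
  · calc (1 : ℝ) = centralRatio n ^ 2 * ((2 * n + 1) * Real.Wallis.W n) := hW.symm
      _ ≤ centralRatio n ^ 2 * ((2 * n + 1) * (Real.pi / 2)) := by gcongr
      _ = _ := by ring
  · have h3 : Real.pi / 2 ≤ (2 * n + 2) / (2 * n + 1) * Real.Wallis.W n := by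
      rw [div_mul_eq_mul_div, div_le_iff₀ (by positivity)] at h2
      rw [div_mul_eq_mul_div, le_div_iff₀ hn]
      linarith
    calc Real.pi * (n + 1 / 2) * centralRatio n ^ 2 =
        centralRatio n ^ 2 * (2 * n + 1) * (Real.pi / 2) := by ring
      _ ≤ centralRatio n ^ 2 * (2 * n + 1) * ((2 * n + 2) / (2 * n + 1) * Real.Wallis.W n) := by
          gcongr
      _ = centralRatio n ^ 2 * ((2 * n + 1) * Real.Wallis.W n) * ((2 * n + 2) / (2 * n + 1)) := by
          ring
      _ = 1 + 1 / (2 * n + 1) := by rw [hW]; field_simp; ring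

/-- How much `centralRatio` changes over `j` steps. The factor `2 ^ j` is wasteful, but it is
absorbed by the decay of the terms in which the bound is used. -/
theorem centralRatio_le_two_pow_mul (N j : ℕ) (h : j ≤ N) :
    centralRatio (N - j) ≤ 2 ^ j * centralRatio N ∧
        N * (centralRatio (N - j) - centralRatio N) ≤ j * 2 ^ j * centralRatio N := by
  induction j with
  | zero => simp
  | succ j ih =>
    obtain ⟨ih1, ih2⟩ := ih (by omega)
    obtain ⟨i, hi⟩ : ∃ i, N = i + (j + 1) := ⟨N - (j + 1), by omega⟩
    have e1 : N - (j + 1) = i := by omega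
    have e2 : N - j = i + 1 := by omega
    rw [e2] at ih1 ih2
    rw [e1]
    have hb := centralRatio_succ i
    have hN : (N : ℝ) = i + (j + 1) := by exact_mod_cast hi
    have hb0 := centralRatio_pos i
    have hb1 := centralRatio_pos (i + 1)
    have hbN := centralRatio_pos N
    have hi0 : (0 : ℝ) ≤ i := by positivity
    have hj0 : (0 : ℝ) ≤ j := by positivity
    have h1 : centralRatio i ≤ 2 * centralRatio (i + 1) := by nlinarith
    have h2 : (N : ℝ) * (centralRatio i - centralRatio (i + 1)) ≤
        (j + 1) * centralRatio (i + 1) := by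
      have : (2 * (i : ℝ) + 1) * (centralRatio i - centralRatio (i + 1)) =
          centralRatio (i + 1) := by linarith
      have h3 : centralRatio i - centralRatio (i + 1) = centralRatio (i + 1) / (2 * i + 1) := by
          field_simp; linarith
      rw [h3, ← mul_div_assoc, div_le_iff₀ (by positivity), hN]
      nlinarith [mul_nonneg hi0 hj0, mul_nonneg (mul_nonneg hi0 hj0) hb1.le,
        mul_nonneg hi0 hb1.le, mul_nonneg hj0 hb1.le]
    refine ⟨by rw [pow_succ]; linarith, ?_⟩
    push_cast
    calc (N : ℝ) * (centralRatio i - centralRatio N) =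
        N * (centralRatio i - centralRatio (i + 1)) +
            N * (centralRatio (i + 1) - centralRatio N) := by ring
      _ ≤ (j + 1) * (2 ^ j * centralRatio N) + j * 2 ^ j * centralRatio N := by
        refine add_le_add (h2.trans ?_) ih2
        gcongr
      _ ≤ (j + 1) * 2 ^ (j + 1) * centralRatio N := by
        rw [pow_succ]
        have : 0 < 2 ^ j * centralRatio N := by positivity
        nlinarith

theorem q_pos : 0 < q := by
  unfold q
  exact Real.sqrt_pos.2 (by nlinarith [r_gt])

theorem q_sq : q ^ 2 = r ^ 2 - 1 := by
  unfold q
  exact Real.sq_sqrt (by nlinarith [r_gt])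

/-- The value of `1 / √(1 - x)` at `x = r⁻¹ ^ 2`. -/
theorem hasSum_centralRatio_mul_pow : HasSum (fun n => centralRatio n * (r⁻¹ ^ 2) ^ n) (r / q) := by
  have hr := r_gt
  have ht : ‖((r⁻¹ ^ 2 : ℝ) : ℂ)‖ < 1 := by
    rw [Complex.norm_real, Real.norm_of_nonneg (by positivity)]
    exact pow_lt_one₀ (inv_nonneg.2 r_pos.le) (inv_lt_one_of_one_lt₀ (by linarith)) (by norm_num)
  have h := (represents_invSqrtSeries _ ht).2
  have h1 : (1 - ((r⁻¹ ^ 2 : ℝ) : ℂ)) ^ (1 / 2 : ℂ) = ((q / r : ℝ) : ℂ) := by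
    have h2 : 1 - r⁻¹ ^ 2 = (q / r) ^ 2 := by
      rw [div_pow, q_sq]
      have := r_pos
      field_simp
    rw [← Complex.ofReal_one, ← Complex.ofReal_sub, h2,
      show (((1 : ℝ) : ℂ) / 2) = ((1 / 2 : ℝ) : ℂ) by push_cast; ring,
      ← Complex.ofReal_cpow (by positivity), ← Real.sqrt_eq_rpow,
      Real.sqrt_sq (div_nonneg q_pos.le r_pos.le)]
  beta_reduce at h
  rw [h1, ← Complex.ofReal_inv, inv_div] at h
  have e : ∀ n, ((coeff n invSqrtSeries : ℝ) : ℂ) * ((r⁻¹ ^ 2 : ℝ) : ℂ) ^ n =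
      ((centralRatio n * (r⁻¹ ^ 2) ^ n : ℝ) : ℂ) := by
    intro n; rw [invSqrtSeries, coeff_mk]; push_cast; ring
  simp_rw [e] at h
  exact Complex.hasSum_ofReal.1 h

/-- The convolution given by the factorization of `wSeries`. -/
theorem delannoy_zero_eq (N : ℕ) :
    delannoy 0 N = r ^ N * ∑ j ∈ Finset.range (N + 1),
        centralRatio (N - j) * (centralRatio j * (r⁻¹ ^ 2) ^ j) := by
  rw [delannoy, pow_zero, one_mul, wSeries_eq, mul_comm, coeff_mul,
    Finset.Nat.sum_antidiagonal_eq_sum_range_succ_mk, Finset.mul_sum]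
  refine Finset.sum_congr rfl fun j hj => ?_
  have hj : j < N + 1 := by simpa using hj
  have hr := r_pos
  rw [coeff_rescale, coeff_rescale, invSqrtSeries, coeff_mk, coeff_mk]
  have : r ^ N = r ^ (N - j) * r ^ j := by rw [← pow_add]; congr 1; omega
  rw [this, ← pow_mul, mul_comm 2 j, pow_mul, inv_pow, inv_pow]
  field_simp

/-- The central Delannoy numbers are `r ^ N * centralRatio N * (r / q)` up to a relative error
`O(1 / N)`: in the convolution that expresses them, only the terms with small `j` matter, and there
`centralRatio (N - j)` may be replaced by `centralRatio N`. -/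
theorem abs_delannoy_zero_sub_le {N : ℕ} (hN : 0 < N) :
    |delannoy 0 N / (r ^ N * centralRatio N) - r / q| ≤ 3 / N := by
  have hr := r_gt
  have hrp := r_pos
  have hN0 : (0 : ℝ) < N := by exact_mod_cast hN
  have hbN := centralRatio_pos N
  set t := r⁻¹ ^ 2 with ht
  have ht0 : 0 < t := by positivity
  have ht1 : t ≤ 1 / 25 := by
    rw [ht, inv_pow, one_div]
    exact inv_anti₀ (by norm_num) (by nlinarith)
  have hsum := hasSum_centralRatio_mul_pow
  have hsplit := hsum.summable.sum_add_tsum_nat_add (N + 1)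
  rw [hsum.tsum_eq] at hsplit
  have htail : ∑' i, centralRatio (i + (N + 1)) * t ^ (i + (N + 1)) ≤ 1 / N := by
    have hg : Summable fun i : ℕ => t ^ i := summable_geometric_of_lt_one ht0.le (by linarith)
    calc ∑' i, centralRatio (i + (N + 1)) * t ^ (i + (N + 1)) ≤ ∑' i, t ^ (N + 1) * t ^ i := by
          refine ((summable_nat_add_iff (N + 1)).2 hsum.summable).tsum_le_tsum (fun i => ?_)
            (hg.mul_left _)
          rw [pow_add, mul_comm (t ^ i)]
          exact mul_le_of_le_one_left (by positivity) (centralRatio_le_one _)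
      _ = t ^ (N + 1) * (1 - t)⁻¹ := by rw [tsum_mul_left,
          tsum_geometric_of_lt_one ht0.le (by linarith)]
      _ ≤ (1 / 2) ^ (N + 1) * 2 := by
          refine mul_le_mul (pow_le_pow_left₀ ht0.le (by linarith) _) ?_
            (inv_nonneg.2 (by linarith)) (by positivity)
          rw [inv_le_comm₀ (by linarith) (by norm_num)]
          linarith
      _ = (1 / 2) ^ N := by rw [pow_succ]; ring
      _ ≤ 1 / N := by
          rw [one_div_pow]
          gcongr
          exact_mod_cast Nat.lt_two_pow_self.le
  have htail0 : 0 ≤ ∑' i, centralRatio (i + (N + 1)) * t ^ (i + (N + 1)) :=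
    tsum_nonneg fun i => mul_nonneg (centralRatio_pos _).le (by positivity)
  have hmain : delannoy 0 N / (r ^ N * centralRatio N) =
      ∑ j ∈ Finset.range (N + 1), centralRatio (N - j) / centralRatio N *
          (centralRatio j * t ^ j) := by
    rw [delannoy_zero_eq, mul_div_mul_left _ _ (by positivity), Finset.sum_div]
    exact Finset.sum_congr rfl fun j _ => by ring
  have hdiff : delannoy 0 N / (r ^ N * centralRatio N) - ∑ j ∈ Finset.range (N + 1),
      centralRatio j * t ^ j =
      ∑ j ∈ Finset.range (N + 1), (centralRatio (N - j) - centralRatio N) / centralRatio N *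
          (centralRatio j * t ^ j) := by
    rw [hmain, ← Finset.sum_sub_distrib]
    refine Finset.sum_congr rfl fun j _ => ?_
    field_simp
  have hd0 : 0 ≤ delannoy 0 N / (r ^ N * centralRatio N) - ∑ j ∈ Finset.range (N + 1),
      centralRatio j * t ^ j := by
    rw [hdiff]
    refine Finset.sum_nonneg fun j _ => ?_
    have := centralRatio_antitone (Nat.sub_le N j)
    have := centralRatio_pos j
    have : 0 ≤ centralRatio (N - j) - centralRatio N := by linarith
    positivity
  have hd1 : delannoy 0 N / (r ^ N * centralRatio N) - ∑ j ∈ Finset.range (N + 1),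
      centralRatio j * t ^ j ≤ 2 / N := by
    rw [hdiff]
    calc ∑ j ∈ Finset.range (N + 1),
        (centralRatio (N - j) - centralRatio N) / centralRatio N * (centralRatio j * t ^ j)
        ≤ ∑ j ∈ Finset.range (N + 1), (1 / N : ℝ) * (1 / 2) ^ j := by
          refine Finset.sum_le_sum fun j hj => ?_
          have hj : j ≤ N := Nat.lt_succ_iff.1 (by simpa using hj)
          have h1 := (centralRatio_le_two_pow_mul N j hj).2
          have h2 : (centralRatio (N - j) - centralRatio N) / centralRatio N ≤ j * 2 ^ j / N := by
            rw [div_le_div_iff₀ hbN hN0]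
            linarith
          have h3 : centralRatio j * t ^ j ≤ (1 / 25) ^ j :=
            (mul_le_of_le_one_left (by positivity) (centralRatio_le_one _)).trans
              (pow_le_pow_left₀ ht0.le ht1 j)
          have h4 : (j : ℝ) ≤ 2 ^ j := by exact_mod_cast Nat.lt_two_pow_self.le
          calc (centralRatio (N - j) - centralRatio N) / centralRatio N * (centralRatio j * t ^ j)
              ≤ (2 ^ j * 2 ^ j / N) * (1 / 25) ^ j := by
                refine mul_le_mul (h2.trans ?_) h3
                  (mul_nonneg (centralRatio_pos _).le (by positivity)) (by positivity)
                gcongr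
            _ = 1 / N * (2 * 2 * (1 / 25)) ^ j := by rw [mul_pow, mul_pow]; ring
            _ ≤ 1 / N * (1 / 2) ^ j := by gcongr; norm_num
      _ = 1 / N * ∑ j ∈ Finset.range (N + 1), (1 / 2 : ℝ) ^ j := by rw [Finset.mul_sum]
      _ ≤ 1 / N * 2 := by gcongr; exact sum_geometric_two_le _
      _ = 2 / N := by ring
  have h3 : (3 : ℝ) / N = 2 / N + 1 / N := by ring
  rw [abs_le, h3]
  have : 0 < 1 / (N : ℝ) := by positivity
  have : 0 < 2 / (N : ℝ) := by positivity
  constructor <;> linarith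

/-! ### Asymptotics of the number of marked trees -/

/-- Wallis' asymptotics of `centralRatio`, with `N + 3` in place of `N` under the root to match the
number of leaves. -/
theorem sqrt_pi_mul_centralRatio_bounds {N : ℕ} (hN : 0 < N) :
    1 ≤ √(Real.pi * (N + 3)) * centralRatio N ∧
        √(Real.pi * (N + 3)) * centralRatio N ≤ 1 + 6 / N := by
  have hN0 : (1 : ℝ) ≤ N := by exact_mod_cast hN
  have hπ := Real.pi_pos
  obtain ⟨h1, h2⟩ := centralRatio_sq_bounds N
  have hb := centralRatio_pos N
  set x := √(Real.pi * (N + 3)) * centralRatio N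
  have hx0 : 0 ≤ x := by positivity
  have hx : x ^ 2 = Real.pi * (N + 1 / 2) * centralRatio N ^ 2 * (1 + 5 / (2 * N + 1)) := by
    simp only [x]
    rw [mul_pow, Real.sq_sqrt (by positivity)]
    field_simp
    ring
  have h3 : (0 : ℝ) < 5 / (2 * N + 1) := by positivity
  have h4 : 1 ≤ x ^ 2 := by rw [hx]; nlinarith
  have hx1 : 1 ≤ x := by nlinarith
  refine ⟨hx1, ?_⟩
  calc x ≤ x ^ 2 := by nlinarith
    _ ≤ (1 + 1 / (2 * N + 1)) * (1 + 5 / (2 * N + 1)) := by rw [hx]; gcongr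
    _ ≤ 1 + 6 / N := by
      rw [← sub_nonneg]
      have : 1 + 6 / (N : ℝ) - (1 + 1 / (2 * N + 1)) * (1 + 5 / (2 * N + 1)) =
        (12 * N ^ 2 + 13 * N + 6) / (N * (2 * N + 1) ^ 2) := by field_simp; ring
      rw [this]
      positivity

theorem r_div_q_bounds : 1 ≤ r / q ∧ r / q ≤ 1.1 := by
  have hq := q_pos
  have hr := r_gt
  have hrp := r_pos
  have h := q_sq
  rw [le_div_iff₀ hq, div_le_iff₀ hq]
  constructor
  · nlinarith
  · by_contra! hlt
    nlinarith

/-- The Delannoy numbers, normalized by their expected order of growth. The factor `√(N + 3)`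
anticipates the index shift between these numbers and the numbers of marked trees. -/
noncomputable def scaledDelannoy (m N : ℕ) : ℝ :=
  √Real.pi * (delannoy m N * (1 + √2) ^ m * √((N : ℝ) + 3) / r ^ N)

/-- The product of the three asymptotics: those of `centralRatio`, of the central Delannoy numbers,
and of the Delannoy numbers along a line. -/
theorem abs_scaledDelannoy_sub_le {m N : ℕ} (hN : 0 < N) (h : 9 * m ^ 2 ≤ N) :
    |scaledDelannoy m N - r / q| ≤ (66 + 18 * m ^ 2) / N ∧ |scaledDelannoy m N| ≤ 70 := by
  have hN1 : (1 : ℝ) ≤ N := by exact_mod_cast hN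
  have hN0 : (0 : ℝ) < N := by linarith
  obtain ⟨hx1, hx2⟩ := sqrt_pi_mul_centralRatio_bounds hN
  have hy := abs_delannoy_zero_sub_le hN
  have hz := abs_delannoy_mul_pow_sub_le hN h
  have ha0 := delannoy_pos (Nat.zero_le N)
  have hb := centralRatio_pos N
  have hr := r_pos
  obtain ⟨hq1, hq2⟩ := r_div_q_bounds
  set x := √(Real.pi * (N + 3)) * centralRatio N with hx
  set y := delannoy 0 N / (r ^ N * centralRatio N) with hydef
  set z := delannoy m N * (1 + √2) ^ m / delannoy 0 N with hzdef
  have halpha : scaledDelannoy m N = x * y * z := by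
    rw [scaledDelannoy, hx, hydef, hzdef, Real.sqrt_mul Real.pi_pos.le]
    field_simp
  have hz' : |z - 1| ≤ 9 * m ^ 2 / N := by
    rw [hzdef, div_sub_one ha0.ne', abs_div, abs_of_pos ha0, div_le_iff₀ ha0]
    exact hz
  have hm1 : 9 * (m : ℝ) ^ 2 / N ≤ 1 := by
    rw [div_le_one hN0]
    exact_mod_cast h
  have hz2 : |z| ≤ 2 := by
    have := abs_sub_abs_le_abs_sub z 1
    rw [abs_one] at this
    linarith
  have h3N : 3 / (N : ℝ) ≤ 3 := div_le_self (by norm_num) hN1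
  have h6N : 6 / (N : ℝ) ≤ 6 := div_le_self (by norm_num) hN1
  have hy2 : |y| ≤ 5 := by
    have := abs_sub_abs_le_abs_sub y (r / q)
    rw [abs_of_pos (show 0 < r / q by linarith)] at this
    linarith
  have hx3 : |x - 1| ≤ 6 / N := by rw [abs_of_nonneg (by linarith)]; linarith
  have hx4 : |x| ≤ 7 := by rw [abs_of_nonneg (by linarith)]; linarith
  rw [halpha]
  constructor
  · have e : x * y * z - r / q = (x - 1) * (y * z) + (y - r / q) * z + r / q * (z - 1) := by ring
    rw [e]
    calc |(x - 1) * (y * z) + (y - r / q) * z + r / q * (z - 1)|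
        ≤ |x - 1| * (|y| * |z|) + |y - r / q| * |z| + |r / q| * |z - 1| := by
          rw [← abs_mul, ← abs_mul, ← abs_mul, ← abs_mul]
          exact abs_add_three _ _ _
      _ ≤ 6 / N * (5 * 2) + 3 / N * 2 + 2 * (9 * m ^ 2 / N) := by
          rw [abs_of_pos (show 0 < r / q by linarith)]
          gcongr
          linarith
      _ = _ := by ring
  · rw [abs_mul, abs_mul]
    calc |x| * |y| * |z| ≤ 7 * 5 * 2 := by gcongr
      _ = 70 := by norm_num

theorem delannoy_eq (m N : ℕ) :
    delannoy m N = scaledDelannoy m N / √Real.pi * (r ^ N / ((1 + √2) ^ m * √((N : ℝ) + 3))) := by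
  have hr := r_pos
  have hπ := Real.pi_pos
  have : 0 < 1 + √2 := by positivity
  rw [scaledDelannoy]
  field_simp

theorem delannoy_succ_le {m N : ℕ} (h : m < N) : delannoy (m + 1) N ≤ delannoy m N := by
  have h1 := (two_le_ratio h).1
  have h2 := delannoy_pos (show m + 1 ≤ N from h)
  rw [le_div_iff₀ h2] at h1
  linarith

/-- The coefficients of `uSeries ^ m` are smaller than the Delannoy numbers by the factor
`m / N`. -/
theorem abs_coeff_uSeries_pow_le {m N : ℕ} (hN : 0 < N) (h : 9 * m ^ 2 ≤ N) :
    |coeff N (uSeries ^ m)| ≤ m / N * (70 * (r ^ N / ((1 + √2) ^ m * √((N : ℝ) + 3)))) := by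
  have hN0 : (0 : ℝ) < N := by exact_mod_cast hN
  have hr := r_pos
  have hmN : m < N ∨ m = 0 := by
    rcases Nat.eq_zero_or_pos m with h0 | h0
    · exact Or.inr h0
    · left; nlinarith
  have hπ : 1 ≤ √Real.pi := Real.one_le_sqrt.2 (by linarith [Real.pi_gt_three])
  have h1 := mul_coeff_uSeries_pow m N
  have h2 : coeff N (uSeries ^ m) = m / N * (delannoy m N - delannoy (m + 1) N) := by
      field_simp; linarith
  have h3 : delannoy (m + 1) N ≤ delannoy m N := by
    rcases hmN with h0 | rfl
    · exact delannoy_succ_le h0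
    · exact delannoy_succ_le hN
  have h4 := delannoy_nonneg (m + 1) N
  have h5 : delannoy m N ≤ 70 * (r ^ N / ((1 + √2) ^ m * √((N : ℝ) + 3))) := by
    rw [delannoy_eq]
    gcongr
    rw [div_le_iff₀ (by linarith)]
    have := (abs_le.1 (abs_scaledDelannoy_sub_le hN h).2).2
    linarith
  rw [h2, abs_mul, abs_of_nonneg (by positivity), abs_of_nonneg (by linarith)]
  gcongr
  linarith

/-- The case `k = l` of `markedCount_eq` in terms of Delannoy numbers. -/
theorem markedCount_diagonal_eq (j N : ℕ) :
    (markedCount (N + 3) (j + 3) (j + 3) : ℝ) =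
      2 * (j + 2) ^ 2 * (delannoy (2 * j + 2) N + delannoy (2 * j + 3) N) +
      (2 * (coeff (N + 1) (uSeries ^ (2 * j + 2)) + coeff (N + 1) (uSeries ^ (2 * j + 3))) +
      (j + 1) ^ 2 * (coeff N (uSeries ^ (2 * j)) + 2 * coeff N (uSeries ^ (2 * j + 1)) +
        coeff N (uSeries ^ (2 * j + 2)))) := by
  rw [markedCount_eq, forestGapSeries_eq_wSeries]
  have e : (((j + 1 : ℕ) : ℝ⟦X⟧) + 1) * X * uSeries ^ (j + 1) *
      (2 * (((j + 1 : ℕ) : ℝ⟦X⟧) + 1) * X ^ 2 *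
      uSeries ^ (j + 1) * ((1 + uSeries) * wSeries)) +
          2 * (X ^ 2 * (1 + uSeries) * uSeries ^ (j + 1 + (j + 1))) +
      ((j + 1 : ℕ) : ℝ⟦X⟧) * ((j + 1 : ℕ) : ℝ⟦X⟧) * X ^ 3 * (1 + uSeries) ^ 2 *
        uSeries ^ (j + 1 + (j + 1) - 2) =
      C (2 * ((j : ℝ) + 2) ^ 2) * (X ^ 3 *
          (uSeries ^ (2 * j + 2) * wSeries + uSeries ^ (2 * j + 3) * wSeries)) +
      C 2 * (X ^ 2 * (uSeries ^ (2 * j + 2) + uSeries ^ (2 * j + 3))) +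
      C (((j : ℝ) + 1) ^ 2) * (X ^ 3 *
          (uSeries ^ (2 * j) + C 2 * uSeries ^ (2 * j + 1) + uSeries ^ (2 * j + 2))) := by
    rw [show j + 1 + (j + 1) - 2 = 2 * j by omega]
    simp only [map_mul, map_pow, map_add, map_natCast, map_ofNat, map_one]
    push_cast
    ring
  rw [e]
  have h3 : ∀ p : ℝ⟦X⟧, coeff (N + 3) (X ^ 3 * p) = coeff N p := fun p => coeff_X_pow_mul p 3 N
  have h2 : ∀ p : ℝ⟦X⟧, coeff (N + 3) (X ^ 2 * p) = coeff (N + 1) p :=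
    fun p => coeff_X_pow_mul p 2 (N + 1)
  simp only [map_add, coeff_C_mul, h3, h2, delannoy]
  ring

/-- The identity between the constants behind the leading coefficient. -/
theorem sqrt_two_div_q : (1 + (√2 - 1)) / q = q * s ^ 2 := by
  have h : √2 * √2 = 2 := Real.mul_self_sqrt (by norm_num)
  have hq := q_pos
  rw [div_eq_iff hq.ne']
  have h2 := q_sq
  have hs' : s ^ 2 = (3 - 2 * √2) / 4 := by
    unfold s
    linear_combination h / 4
  have hr : r = 3 + 2 * √2 := rfl
  calc 1 + (√2 - 1) = √2 := by ring
    _ = (r ^ 2 - 1) * s ^ 2 := by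
      rw [hs', hr]
      linear_combination (3 + 2 * √2) * h
    _ = q * s ^ 2 * q := by rw [← h2]; ring

theorem q_mul_s_sq_le : q * s ^ 2 ≤ 1 / 2 := by
  have h := sqrt_two_div_q
  have hq := q_pos
  rw [← h, div_le_iff₀ hq]
  have h1 := r_gt
  have h2 := q_sq
  have h3 : √2 ≤ 1.5 := Real.sqrt_le_iff.2 (by norm_num)
  have : 4 ≤ q := by
    by_contra! hlt
    nlinarith
  linarith

/-- The asymptotics for `n = N + 3` and `k = l = j + 3`, as soon as `n` is at least
`100 * k ^ 4`. -/
theorem abs_markedCount_diagonal_sub_le {j N : ℕ} (h : 100 * (j + 3) ^ 4 ≤ N + 3) :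
    |(markedCount (N + 3) (j + 3) (j + 3) : ℝ) -
        2 * q * s ^ 2 / √Real.pi * (r ^ N / (r ^ j * √((N : ℝ) + 3))) * ((j : ℝ) + 3) ^ 2| ≤
      100 * (r ^ N / (r ^ j * √((N : ℝ) + 3))) * ((j : ℝ) + 3) := by
  have hr := r_pos
  have hr1 := r_gt
  have hq := q_pos
  have hs1 : 1.4 ≤ √2 := Real.le_sqrt_of_sq_le (by norm_num)
  have hs2 : √2 ≤ 1.5 := Real.sqrt_le_iff.2 (by norm_num)
  have hτ : (1 + √2)⁻¹ = √2 - 1 := by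
    have h : √2 * √2 = 2 := Real.mul_self_sqrt (by norm_num)
    refine inv_eq_of_mul_eq_one_right ?_
    linear_combination h
  have hπ : 1 ≤ √Real.pi := Real.one_le_sqrt.2 (by linarith [Real.pi_gt_three])
  set k : ℝ := (j : ℝ) + 3 with hk
  have hj0 : (0 : ℝ) ≤ j := by positivity
  have hk3 : 3 ≤ k := by linarith
  have hn : 100 * k ^ 4 ≤ (N : ℝ) + 3 := by rw [hk]; exact_mod_cast h
  have hN9 : 9 * (2 * j + 3) ^ 2 ≤ N := by
    have h1 : (j + 3) ^ 2 ≤ (j + 3) ^ 4 := Nat.pow_le_pow_right (by omega) (by norm_num)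
    have h2 : (2 * j + 3) ^ 2 ≤ (2 * (j + 3)) ^ 2 := Nat.pow_le_pow_left (by omega) 2
    have h3 : 1 ≤ (j + 3) ^ 4 := Nat.one_le_pow _ _ (by omega)
    rw [mul_pow] at h2
    omega
  clear h
  have hN0 : 0 < N := lt_of_lt_of_le (by positivity) hN9
  have hNR : (1 : ℝ) ≤ N := by exact_mod_cast hN0
  have hN2 : 50 * k ^ 4 ≤ N := by
    have : 1 ≤ k ^ 4 := one_le_pow₀ (by linarith)
    linarith
  set Y := r ^ N / (r ^ j * √((N : ℝ) + 3)) with hY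
  have hY0 : 0 < Y := by positivity
  -- the coefficients of powers of `uSeries` contribute only to the error
  have hU : ∀ m N' : ℕ, m ≤ 2 * j + 3 → N ≤ N' →
      r ^ N' / (1 + √2) ^ m ≤ r ^ N / r ^ j → |coeff N' (uSeries ^ m)| ≤ 3 / k ^ 3 * Y := by
    intro m N' hm hN' hle
    have hm2 : m ^ 2 ≤ (2 * j + 3) ^ 2 := Nat.pow_le_pow_left hm 2
    refine (abs_coeff_uSeries_pow_le (by omega) (by omega)).trans ?_
    have hNN : (N : ℝ) ≤ N' := by exact_mod_cast hN'
    have hm' : (m : ℝ) ≤ 2 * k := by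
      have : (m : ℝ) ≤ 2 * j + 3 := by exact_mod_cast hm
      linarith
    have h1 : (m : ℝ) / N' ≤ 2 * k / (50 * k ^ 4) := by
      gcongr
      linarith
    have h2 : r ^ N' / ((1 + √2) ^ m * √((N' : ℝ) + 3)) ≤ Y := by
      rw [hY, ← div_div, ← div_div]
      gcongr
    calc (m : ℝ) / N' * (70 * (r ^ N' / ((1 + √2) ^ m * √((N' : ℝ) + 3))))
        ≤ 2 * k / (50 * k ^ 4) * (70 * Y) := by gcongr
      _ = 14 / 5 / k ^ 3 * Y := by field_simp; ring
      _ ≤ 3 / k ^ 3 * Y := by gcongr; norm_num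
  have hpow : (1 + √2) ^ (2 * j) = r ^ j := by rw [pow_mul, one_add_sqrt_two_sq]
  have h1τ : 1 ≤ 1 + √2 := by linarith
  have hrj : 0 < r ^ j := by positivity
  have hU1 := hU (2 * j + 2) (N + 1) (by omega) (by omega) (by
    rw [pow_add (1 + √2), hpow, one_add_sqrt_two_sq, pow_succ, mul_div_mul_right _ _ hr.ne'])
  have hU2 := hU (2 * j + 3) (N + 1) (by omega) (by omega) (by
    rw [pow_succ (1 + √2), pow_add (1 + √2), hpow, one_add_sqrt_two_sq, pow_succ, ← div_div,
      mul_div_mul_right _ _ hr.ne']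
    exact div_le_self (by positivity) h1τ)
  have hU3 := hU (2 * j) N (by omega) le_rfl (by rw [hpow])
  have hU4 := hU (2 * j + 1) N (by omega) le_rfl (by
    rw [pow_succ, hpow, ← div_div]
    exact div_le_self (by positivity) h1τ)
  have hU5 := hU (2 * j + 2) N (by omega) le_rfl (by
    rw [pow_add, hpow, ← div_div]
    exact div_le_self (by positivity) (one_le_pow₀ h1τ))
  -- the two Delannoy numbers give the leading term
  have hα : ∀ m : ℕ, m ≤ 2 * j + 3 → |scaledDelannoy m N - r / q| ≤ 3 / k ^ 2 := by
    intro m hm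
    have hm2 : m ^ 2 ≤ (2 * j + 3) ^ 2 := Nat.pow_le_pow_left hm 2
    refine (abs_scaledDelannoy_sub_le hN0 (by omega)).1.trans ?_
    have hm' : (m : ℝ) ≤ 2 * k := by
      have : (m : ℝ) ≤ 2 * j + 3 := by exact_mod_cast hm
      linarith
    calc (66 + 18 * (m : ℝ) ^ 2) / N ≤ (66 + 18 * (2 * k) ^ 2) / (50 * k ^ 4) := by gcongr
      _ ≤ 150 * k ^ 2 / (50 * k ^ 4) := by gcongr; nlinarith
      _ = 3 / k ^ 2 := by field_simp; norm_num
  have hα1 := hα (2 * j + 2) (by omega)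
  have hα2 := hα (2 * j + 3) (by omega)
  have ha1 : delannoy (2 * j + 2) N = scaledDelannoy (2 * j + 2) N / √Real.pi * (Y / r) := by
    rw [delannoy_eq, hY, pow_add, hpow, one_add_sqrt_two_sq]
    field_simp
  have ha2 : delannoy (2 * j + 3) N =
      scaledDelannoy (2 * j + 3) N / √Real.pi * (Y / r * (√2 - 1)) := by
    rw [delannoy_eq, hY, pow_succ (1 + √2), pow_add, hpow, one_add_sqrt_two_sq, ← hτ]
    field_simp
  have hqs0 : 0 < q * s ^ 2 := by
    rw [← sqrt_two_div_q]
    exact div_pos (by linarith) hq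
  have hqs := q_mul_s_sq_le
  have hroot := sqrt_two_div_q
  rw [markedCount_diagonal_eq, ha1, ha2]
  set e₁ := scaledDelannoy (2 * j + 2) N - r / q with he1
  set e₂ := scaledDelannoy (2 * j + 3) N - r / q with he2
  have hsplit : 2 * ((j : ℝ) + 2) ^ 2 * (scaledDelannoy (2 * j + 2) N / √Real.pi * (Y / r) +
      scaledDelannoy (2 * j + 3) N / √Real.pi * (Y / r * (√2 - 1))) -
      2 * q * s ^ 2 / √Real.pi * Y * k ^ 2 =
      2 * (k - 1) ^ 2 / √Real.pi / r * Y * (e₁ + e₂ * (√2 - 1)) -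
      2 * (q * s ^ 2) / √Real.pi * Y * (2 * k - 1) := by
    rw [show scaledDelannoy (2 * j + 2) N = e₁ + r / q by rw [he1]; ring,
      show scaledDelannoy (2 * j + 3) N = e₂ + r / q by rw [he2]; ring,
      show (j : ℝ) + 2 = k - 1 by rw [hk]; ring, mul_assoc 2 q, ← hroot]
    field_simp
    ring
  have hmain : |2 * (k - 1) ^ 2 / √Real.pi / r * Y * (e₁ + e₂ * (√2 - 1)) -
      2 * (q * s ^ 2) / √Real.pi * Y * (2 * k - 1)| ≤ 12 * Y + 2 * k * Y := by
    refine (abs_sub _ _).trans (add_le_add ?_ ?_)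
    · have h1 : |e₁ + e₂ * (√2 - 1)| ≤ 3 / k ^ 2 + 3 / k ^ 2 * 1 := by
        refine (abs_add_le _ _).trans (add_le_add hα1 ?_)
        rw [abs_mul, abs_of_pos (show 0 < √2 - 1 by linarith)]
        exact mul_le_mul hα2 (by linarith) (by linarith) (by positivity)
      have h2 : 2 * (k - 1) ^ 2 / √Real.pi / r ≤ 2 * k ^ 2 := by
        rw [div_div]
        refine (div_le_self (by positivity) (one_le_mul_of_one_le_of_one_le hπ
          (by linarith))).trans ?_
        gcongr <;> linarith
      rw [abs_mul, abs_of_nonneg (by positivity)]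
      calc 2 * (k - 1) ^ 2 / √Real.pi / r * Y * |e₁ + e₂ * (√2 - 1)|
          ≤ 2 * k ^ 2 * Y * (3 / k ^ 2 + 3 / k ^ 2 * 1) := by gcongr
        _ = 12 * Y := by field_simp; ring
    · rw [abs_of_nonneg (mul_nonneg (by positivity) (by linarith))]
      have h2 : 2 * (q * s ^ 2) / √Real.pi ≤ 1 :=
        (div_le_self (by positivity) hπ).trans (by linarith)
      calc 2 * (q * s ^ 2) / √Real.pi * Y * (2 * k - 1) ≤ 1 * Y * (2 * k) := by
            gcongr
            · linarith
            · linarith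
        _ = 2 * k * Y := by ring
  set U₁ := coeff (N + 1) (uSeries ^ (2 * j + 2))
  set U₂ := coeff (N + 1) (uSeries ^ (2 * j + 3))
  set U₃ := coeff N (uSeries ^ (2 * j))
  set U₄ := coeff N (uSeries ^ (2 * j + 1))
  set U₅ := coeff N (uSeries ^ (2 * j + 2))
  have hrest : |2 * (U₁ + U₂) + ((j : ℝ) + 1) ^ 2 * (U₃ + 2 * U₄ + U₅)| ≤ 24 * Y := by
    have hk1 : 1 / k ^ 3 ≤ 1 := by
      rw [div_le_one (by positivity)]
      exact one_le_pow₀ (by linarith)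
    have hA : |2 * (U₁ + U₂)| ≤ 2 * (3 / k ^ 3 * Y + 3 / k ^ 3 * Y) := by
      rw [abs_mul, abs_two]
      gcongr
      exact (abs_add_le _ _).trans (add_le_add hU1 hU2)
    have hB : |((j : ℝ) + 1) ^ 2 * (U₃ + 2 * U₄ + U₅)| ≤
        k ^ 2 * (3 / k ^ 3 * Y + 2 * (3 / k ^ 3 * Y) + 3 / k ^ 3 * Y) := by
      rw [abs_mul, abs_of_nonneg (by positivity)]
      have : |2 * U₄| = 2 * |U₄| := by rw [abs_mul, abs_two]
      refine mul_le_mul (by gcongr; linarith) ((abs_add_three _ _ _).trans ?_) (abs_nonneg _)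
        (by positivity)
      rw [this]
      gcongr
    refine (abs_add_le _ _).trans ((add_le_add hA hB).trans ?_)
    have e : 2 * (3 / k ^ 3 * Y + 3 / k ^ 3 * Y) +
        k ^ 2 * (3 / k ^ 3 * Y + 2 * (3 / k ^ 3 * Y) + 3 / k ^ 3 * Y) =
        (12 * (1 / k ^ 3) + 12 * (1 / k)) * Y := by
      field_simp
      ring
    have hk2 : 1 / k ≤ 1 := by
      rw [div_le_one (by positivity)]
      linarith
    rw [e]
    gcongr
    linarith
  rw [add_sub_right_comm, hsplit]
  refine (abs_add_le _ _).trans ((add_le_add hmain hrest).trans ?_)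
  have := mul_le_mul_of_nonneg_right hk3 hY0.le
  linarith

/-- If `k` is large and at most `L * log n`, then `n` exceeds a given polynomial in `k`. -/
theorem exists_forall_log_bound {L : ℝ} (hL : 0 < L) :
    ∃ K : ℕ, 3 ≤ K ∧ ∀ n k : ℕ, K ≤ k → (k : ℝ) ≤ L * Real.log n → 100 * k ^ 4 ≤ n := by
  have h1 := isLittleO_pow_exp_pos_mul_atTop (k := 4) (b := L⁻¹) (inv_pos.2 hL)
  have h2 := (h1.def (c := 1 / 100) (by norm_num)).natCast_atTop
  obtain ⟨K, hK⟩ := Filter.eventually_atTop.1 h2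
  refine ⟨max K 3, le_max_right _ _, fun n k hk hkn => ?_⟩
  have hk3 : 3 ≤ k := (le_max_right _ _).trans hk
  have h3 := hK k ((le_max_left _ _).trans hk)
  rw [Real.norm_of_nonneg (by positivity), Real.norm_of_nonneg (Real.exp_pos _).le] at h3
  have hk0 : (0 : ℝ) < k := by
    have : 0 < k := by omega
    exact_mod_cast this
  have hlog : L⁻¹ * k ≤ Real.log n := by
    rw [inv_mul_le_iff₀ hL]
    exact hkn
  have hn : (0 : ℝ) < n := by
    rcases Nat.eq_zero_or_pos n with rfl | hn
    · simp at hkn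
      omega
    · exact_mod_cast hn
  have h4 : Real.exp (L⁻¹ * k) ≤ n := (Real.le_log_iff_exp_le hn).1 hlog
  have h5 : 100 * (k : ℝ) ^ 4 ≤ n := by linarith
  exact_mod_cast h5

theorem markedCount_asymptotics (L : ℝ) (hL : 0 < L) :
    ∃ M : ℝ, 0 < M ∧ ∃ K : ℕ, ∀ n k : ℕ, K ≤ k → (k : ℝ) ≤ L * Real.log n →
      |(markedCount n k k : ℝ) - 2 * q * s ^ 2 / √Real.pi *
            r ^ ((n : ℤ) - (k : ℤ)) * (n : ℝ) ^ (-(1 / 2) : ℝ) * (k : ℝ) ^ 2| ≤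
        M * r ^ ((n : ℤ) - (k : ℤ)) * (n : ℝ) ^ (-(1 / 2) : ℝ) * (k : ℝ) := by
  obtain ⟨K, hK3, hK⟩ := exists_forall_log_bound hL
  -- the constant `100` is the one of `abs_markedCount_diagonal_sub_le`, independent of `L`
  refine ⟨100, by norm_num, K, fun n k hk hkn => ?_⟩
  have h := hK n k hk hkn
  obtain ⟨j, rfl⟩ : ∃ j, k = j + 3 := ⟨k - 3, by omega⟩
  obtain ⟨N, rfl⟩ : ∃ N, n = N + 3 := ⟨n - 3, by
    have : 0 < (j + 3) ^ 4 := by positivity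
    omega⟩
  have hb := abs_markedCount_diagonal_sub_le h
  have hr := r_pos
  have e : r ^ (((N + 3 : ℕ) : ℤ) - ((j + 3 : ℕ) : ℤ)) * ((N + 3 : ℕ) : ℝ) ^ (-(1 / 2) : ℝ) =
      r ^ N / (r ^ j * √((N : ℝ) + 3)) := by
    rw [show ((N + 3 : ℕ) : ℤ) - ((j + 3 : ℕ) : ℤ) = (N : ℤ) - (j : ℤ) by push_cast; ring,
      zpow_sub₀ hr.ne', zpow_natCast, zpow_natCast, Real.rpow_neg (by positivity),
      ← Real.sqrt_eq_rpow]
    push_cast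
    field_simp
  rw [mul_assoc (2 * q * s ^ 2 / √Real.pi), mul_assoc (100 : ℝ), e]
  push_cast
  exact hb

/-! ### The function `uFun` on the `δ`-domain -/

/-- A set containing the `δ`-domain with parameters `1 / 10` and `π / 3`: the part of a disc
outside of an open cone with vertex `1`, the vertex being removed. -/
def coneComplement : Set ℂ := {x | ‖x‖ ≤ 1.1 ∧ x ≠ 1 ∧ 2 * (x - 1).re ≤ ‖x - 1‖}

theorem deltaDomain_subset : deltaDomain (1 / 10) (Real.pi / 3) ⊆ coneComplement := by
  rintro x ⟨h1, h2, h3⟩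
  refine ⟨by norm_num at h1 ⊢; exact h1, h2, ?_⟩
  have h4 : Real.cos |Complex.arg (x - 1)| ≤ Real.cos (Real.pi / 3) :=
    Real.cos_le_cos_of_nonneg_of_le_pi (by positivity) (Complex.abs_arg_le_pi _) h3
  rw [Real.cos_abs, Real.cos_pi_div_three] at h4
  rw [← Complex.norm_mul_cos_arg (x - 1)]
  nlinarith [norm_nonneg (x - 1)]

theorem mem_coneComplement_of_norm_lt_one {x : ℂ} (hx : ‖x‖ < 1) : x ∈ coneComplement := by
  have h := (Complex.re_le_norm x).trans_lt hx
  refine ⟨by linarith, ?_, ?_⟩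
  · rintro rfl
    simp at hx
  · have : (x - 1).re < 0 := by simp; linarith
    linarith [norm_nonneg (x - 1)]

/-- The set `coneComplement` is star-shaped about `0`. -/
theorem smul_mem_coneComplement {x : ℂ} (hx : x ∈ coneComplement) {t : ℝ} (h0 : 0 ≤ t)
    (h1 : t ≤ 1) : (t : ℂ) * x ∈ coneComplement := by
  obtain ⟨hx1, hx2, hx3⟩ := hx
  rcases h0.eq_or_lt with rfl | h0
  · refine mem_coneComplement_of_norm_lt_one ?_
    simp
  rcases h1.eq_or_lt with rfl | h1
  · simpa using ⟨hx1, hx2, hx3⟩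
  have e : (t : ℂ) * (x - 1) = (t * x - 1) + ((1 - t : ℝ) : ℂ) := by push_cast; ring
  have hn : t * ‖x - 1‖ ≤ ‖t * x - 1‖ + (1 - t) := by
    calc t * ‖x - 1‖ = ‖(t : ℂ) * (x - 1)‖ := by
          rw [norm_mul, Complex.norm_real, Real.norm_of_nonneg h0.le]
      _ ≤ ‖t * x - 1‖ + ‖((1 - t : ℝ) : ℂ)‖ := by rw [e]; exact norm_add_le _ _
      _ = _ := by rw [Complex.norm_real, Real.norm_of_nonneg (by linarith)]
  have hre : t * (x - 1).re = (t * x - 1).re + (1 - t) := by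
    have := congrArg Complex.re e
    simpa using this
  have h2 : 2 * ((t : ℂ) * x - 1).re ≤ ‖(t : ℂ) * x - 1‖ := by nlinarith
  refine ⟨?_, ?_, h2⟩
  · rw [norm_mul, Complex.norm_real, Real.norm_of_nonneg h0.le]
    nlinarith [norm_nonneg x]
  · intro h
    rw [h] at hre hn
    simp only [sub_self, norm_zero, Complex.zero_re, zero_add] at hre hn
    nlinarith

theorem one_sub_mem_slitPlane_of_mem {x : ℂ} (hx : x ∈ coneComplement) :
    1 - x ∈ Complex.slitPlane := by
  obtain ⟨-, hx2, hx3⟩ := hx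
  rw [Complex.mem_slitPlane_iff]
  by_contra! h
  obtain ⟨h1, h2⟩ := h
  have hre : (1 - x).re = -(x - 1).re := by simp
  have him : (x - 1).im = 0 := by simpa using h2
  have h3 : x - 1 = (((x - 1).re : ℝ) : ℂ) := Complex.ext (by simp) (by simpa using him)
  have h4 : ‖x - 1‖ = (x - 1).re := by
    rw [h3, Complex.norm_real, Real.norm_of_nonneg (by simp at h1 ⊢; linarith)]
    simp
  have h5 : ‖x - 1‖ = 0 := le_antisymm (by linarith) (norm_nonneg _)
  exact hx2 (sub_eq_zero.1 (norm_eq_zero.1 h5))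

theorem analyticAt_sqrtFun {x : ℂ} (hx : x ∈ coneComplement) : AnalyticAt ℂ sqrtFun x := by
  have h1 := one_sub_mem_slitPlane_of_mem hx
  have h2 := one_sub_div_mem_slitPlane (x := x) (by linarith [hx.1])
  exact ((analyticAt_const.sub analyticAt_id).cpow analyticAt_const h1).mul
    ((analyticAt_const.sub (analyticAt_id.div_const)).cpow analyticAt_const h2)

theorem analyticAt_uFun {x : ℂ} (hx : x ∈ coneComplement) : AnalyticAt ℂ uFun x :=
  ((analyticAt_const.sub (analyticAt_id.div_const)).sub (analyticAt_sqrtFun hx)).div_const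

theorem sqrtFun_ne_zero {x : ℂ} (hx : x ∈ coneComplement) : sqrtFun x ≠ 0 := by
  have h1 := Complex.slitPlane_ne_zero (one_sub_mem_slitPlane_of_mem hx)
  have h2 := Complex.slitPlane_ne_zero (one_sub_div_mem_slitPlane (x := x) (by linarith [hx.1]))
  intro h
  have : sqrtFun x ^ 2 = 0 := by rw [h]; simp
  rw [sqrtFun, mul_pow, half_cpow_sq, half_cpow_sq] at this
  exact mul_ne_zero h1 h2 this

/-- The functional equation for `uSeries`, at `x / r`. -/
theorem uFun_mul_one_sub (x : ℂ) : uFun x * (1 - uFun x) = x / r * (1 + uFun x) := by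
  have h := sqrtFun_sq x
  unfold uFun
  linear_combination -h / 4

theorem one_add_uFun_ne_zero (x : ℂ) : 1 + uFun x ≠ 0 := by
  intro h
  have h1 := uFun_mul_one_sub x
  rw [h, show uFun x = -1 by linear_combination h] at h1
  norm_num at h1

theorem two_s_eq : 2 * s = √2 - 1 := by unfold s; ring

theorem four_s_sq_mul_r : (2 * s) ^ 2 * r = 1 := by
  have h : √2 * √2 = 2 := Real.mul_self_sqrt (by norm_num)
  rw [two_s_eq]
  unfold r
  linear_combination (-1 + 2 * √2) * h

theorem two_s_sq : (2 * s) ^ 2 = 1 - 2 * (2 * s) := by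
  have h : √2 * √2 = 2 := Real.mul_self_sqrt (by norm_num)
  rw [two_s_eq]
  linear_combination h

theorem two_s_bounds : 0.4 < 2 * s ∧ 2 * s < 0.42 := by
  rw [two_s_eq]
  constructor
  · have : 1.4 < √2 := Real.lt_sqrt_of_sq_lt (by norm_num)
    linarith
  · have : √2 < 1.42 := (Real.sqrt_lt' (by norm_num)).2 (by norm_num)
    linarith

theorem norm_two_s : ‖(2 * (s : ℂ))‖ = 2 * s := by
  have hs := two_s_bounds.1
  rw [show (2 * (s : ℂ)) = ((2 * s : ℝ) : ℂ) by push_cast; ring, Complex.norm_real,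
    Real.norm_of_nonneg (by linarith)]

/-- The point `x = 1` corresponds to `uSeries = 2 s`, where the inverse function of `uFun` has a
critical point. -/
theorem one_sub_mul_one_add_uFun (x : ℂ) :
    (1 - x) * (1 + uFun x) = r * (uFun x - 2 * s) ^ 2 := by
  have h1 : (2 * (s : ℂ)) ^ 2 * r = 1 := by exact_mod_cast four_s_sq_mul_r
  have h2 : (2 * (s : ℂ)) ^ 2 = 1 - 2 * (2 * s) := by exact_mod_cast two_s_sq
  have hr := r_complex_ne_zero
  have h3 : (r : ℂ) * (uFun x * (1 - uFun x)) = x * (1 + uFun x) := by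
    rw [uFun_mul_one_sub]; field_simp
  linear_combination (-uFun x - 1) * h1 + h3 + r * uFun x * h2

/-- The curve `‖uSeries‖ = 2 s` is mapped by the inverse function of `uFun` outside of
`coneComplement`. -/
theorem norm_uFun_ne {x : ℂ} (hx : x ∈ coneComplement) : ‖uFun x‖ ≠ 2 * s := by
  intro hu
  obtain ⟨hx1, hx2, hx3⟩ := hx
  obtain ⟨hs1, hs2⟩ := two_s_bounds
  have hr1 := r_gt
  have hrp := r_pos
  have hrA := four_s_sq_mul_r
  have hkey := one_sub_mul_one_add_uFun x
  have heq := uFun_mul_one_sub x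
  set v := uFun x with hv
  set c := 2 * s with hc
  have hcC : (2 * (s : ℂ)) = (c : ℂ) := by rw [hc]; push_cast; ring
  rw [hcC] at hkey
  have hA : v.re ^ 2 + v.im ^ 2 = c ^ 2 := by
    rw [← hu, ← Complex.normSq_eq_norm_sq, Complex.normSq_apply]; ring
  have hn : ‖1 + v‖ ^ 2 = 1 + c ^ 2 + 2 * v.re := by
    rw [← Complex.normSq_eq_norm_sq, Complex.normSq_apply]; simp; linarith
  have hn' : ‖1 - v‖ ^ 2 = 1 + c ^ 2 - 2 * v.re := by
    rw [← Complex.normSq_eq_norm_sq, Complex.normSq_apply]; simp; linarith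
  have hre := Complex.abs_re_le_norm v
  rw [hu, abs_le] at hre
  -- on the curve, `‖x‖ ≤ 1.1` forces `re v ≥ c / 2`
  have hmod : r * (1 + c ^ 2 - 2 * v.re) = ‖x‖ ^ 2 * (1 + c ^ 2 + 2 * v.re) := by
    have h1 : r * (‖v‖ * ‖1 - v‖) = ‖x‖ * ‖1 + v‖ := by
      have := congrArg norm heq
      rw [norm_mul, norm_mul, norm_div, Complex.norm_real, Real.norm_of_nonneg hrp.le] at this
      rw [this]
      field_simp
    rw [← hn, ← hn', ← mul_pow, ← h1, hu]
    linear_combination (-r * ‖1 - v‖ ^ 2) * hrA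
  have hα : c / 2 ≤ v.re := by
    by_contra! hlt
    have h1 : ‖x‖ ^ 2 ≤ 1.21 := by nlinarith [norm_nonneg x]
    have h2 : ‖x‖ ^ 2 * (1 + c ^ 2 + 2 * v.re) ≤ 1.21 * (1 + c ^ 2 + 2 * v.re) := by
      apply mul_le_mul_of_nonneg_right h1
      rw [← hn]; positivity
    have h3 : 5.8 * (1 + c ^ 2 - 2 * v.re) ≤ r * (1 + c ^ 2 - 2 * v.re) := by
      apply mul_le_mul_of_nonneg_right hr1.le
      rw [← hn']; positivity
    nlinarith
  -- on the curve, `x - 1` is a positive multiple of `v / (1 + v)`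
  have hconj : v * (starRingEnd ℂ) v = ((c ^ 2 : ℝ) : ℂ) := by
    rw [Complex.mul_conj, Complex.normSq_eq_norm_sq, hu]
  have hsum : v + (starRingEnd ℂ) v = ((2 * v.re : ℝ) : ℂ) := Complex.add_conj v
  have hx' : (x - 1) * (1 + v) = ((2 * r * (c - v.re) : ℝ) : ℂ) * v := by
    push_cast at hconj hsum ⊢
    linear_combination -hkey - r * v * hsum + r * hconj
  have hm : 0 ≤ 2 * r * (c - v.re) := mul_nonneg (by linarith) (by linarith)
  set m := 2 * r * (c - v.re) with hmdef
  have hnorm : ‖x - 1‖ * ‖1 + v‖ = m * c := by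
    have := congrArg norm hx'
    rwa [norm_mul, norm_mul, Complex.norm_real, Real.norm_of_nonneg hm, hu] at this
  have hre' : (x - 1).re * ‖1 + v‖ ^ 2 = m * (v.re + c ^ 2) := by
    have h1 : (x - 1) * ((1 + v) * (starRingEnd ℂ) (1 + v)) =
        ((m : ℝ) : ℂ) * (v + v * (starRingEnd ℂ) v) := by
      rw [← mul_assoc, hx', map_add, map_one]; ring
    rw [Complex.mul_conj, Complex.normSq_eq_norm_sq, hconj] at h1
    have := congrArg Complex.re h1
    simpa only [Complex.re_mul_ofReal, Complex.re_ofReal_mul, Complex.add_re,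
      Complex.ofReal_re] using this
  have h1v : 0 < ‖1 + v‖ := norm_pos_iff.2 (one_add_uFun_ne_zero x)
  have hm0 : m ≠ 0 := by
    intro h0
    rw [h0, zero_mul] at hnorm
    rcases mul_eq_zero.1 hnorm with h | h
    · exact hx2 (sub_eq_zero.1 (norm_eq_zero.1 h))
    · exact h1v.ne' h
  have hmpos : 0 < m := lt_of_le_of_ne hm (Ne.symm hm0)
  have hle : ‖1 + v‖ ≤ 1 + c := by
    calc ‖1 + v‖ ≤ ‖(1 : ℂ)‖ + ‖v‖ := norm_add_le _ _
      _ = 1 + c := by rw [norm_one, hu]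
  have h2 : 2 * (m * (v.re + c ^ 2)) ≤ m * c * ‖1 + v‖ := by
    rw [← hre', ← hnorm]
    nlinarith
  have h3 : 2 * (v.re + c ^ 2) ≤ c * ‖1 + v‖ := by
    refine le_of_mul_le_mul_left ?_ hmpos
    linarith
  -- with `re v ≥ c / 2` and `‖1 + v‖ ≤ 1 + c`, this reads `c + 2 * c ^ 2 ≤ c + c ^ 2`
  nlinarith

/-- The segment from `0`, where `uFun` vanishes, to `x` lies in `coneComplement`, so that the norm
of `uFun` cannot reach `2 * s` on it. -/
theorem norm_uFun_lt {x : ℂ} (hx : x ∈ coneComplement) : ‖uFun x‖ < 2 * s := by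
  by_contra! h
  have hs := two_s_bounds.1
  have hcont : ContinuousOn (fun t : ℝ => ‖uFun ((t : ℂ) * x)‖) (Set.Icc 0 1) := by
    intro t ht
    have h1 := (analyticAt_uFun (smul_mem_coneComplement hx ht.1 ht.2)).continuousAt
    have h2 : ContinuousAt (fun t : ℝ => (t : ℂ) * x) t := by fun_prop
    exact (ContinuousAt.comp (f := fun t : ℝ => (t : ℂ) * x) h1 h2).norm.continuousWithinAt
  have h0 : uFun 0 = 0 := by simp [uFun, sqrtFun]
  obtain ⟨t, ht, h1⟩ := intermediate_value_Icc (zero_le_one' ℝ) hcont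
    (show 2 * s ∈ Set.Icc _ _ by
      constructor
      · simp [h0]; linarith
      · simpa using h)
  exact norm_uFun_ne (smul_mem_coneComplement hx ht.1 ht.2) h1

/-- The value of `uFun` approaches `2 * s` like `(1 - x) ^ (1 / 2)`, with a constant below `1`. -/
theorem norm_uFun_sub_sq_le {x : ℂ} (hx : x ∈ coneComplement) :
    ‖uFun x - 2 * s‖ ^ 2 ≤ ‖1 - x‖ := by
  have h := congrArg norm (one_sub_mul_one_add_uFun x)
  have hr := r_gt
  have hs := two_s_bounds.2
  rw [norm_mul, norm_mul, norm_pow, Complex.norm_real, Real.norm_of_nonneg r_pos.le] at h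
  have h1 : ‖1 + uFun x‖ ≤ 2 := by
    calc ‖1 + uFun x‖ ≤ ‖(1 : ℂ)‖ + ‖uFun x‖ := norm_add_le _ _
      _ ≤ 2 := by rw [norm_one]; linarith [norm_uFun_lt hx]
  nlinarith [norm_nonneg (1 - x), sq_nonneg ‖uFun x - 2 * s‖]

/-! ### The generating function of the marked trees -/

/-- For fixed `k` and `l`, the generating function of the numbers `T_{n, k + 2, l + 2}`, at
`x / r`. -/
noncomputable def sliceFun (k l : ℕ) (x : ℂ) : ℂ :=
  2 * (k + 1) * (l + 1) * (x / r) ^ 3 * uFun x ^ (k + l) * (1 + uFun x) * (sqrtFun x)⁻¹ +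
    2 * (x / r) ^ 2 * (1 + uFun x) * uFun x ^ (k + l) +
    k * l * (x / r) ^ 3 * (1 + uFun x) ^ 2 * uFun x ^ (k + l - 2)

theorem hasSum_sliceFun (k l : ℕ) {x : ℂ} (hx : ‖x‖ < 1) :
    HasSum (fun n => (markedCount n (k + 2) (l + 2) : ℂ) * (x / r) ^ n) (sliceFun k l x) := by
  have hrp := r_pos
  have hxr : ‖x / (r : ℂ)‖ < r⁻¹ := by
    rw [norm_div, Complex.norm_real, Real.norm_of_nonneg hrp.le, div_eq_mul_inv]
    exact mul_lt_of_lt_one_left (inv_pos.2 hrp) hx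
  have U := represents_uSeries
  have W := represents_wSeries
  have X1 : Represents (X : ℝ⟦X⟧) (fun x => x) r⁻¹ := .identity
  have c : ∀ c : ℝ, Represents (C c) (fun _ => (c : ℂ)) r⁻¹ := fun c => .const c
  have e : ((k : ℝ⟦X⟧) + 1) * X * uSeries ^ k * forestGapSeries (l + 2) +
      2 * (X ^ 2 * (1 + uSeries) * uSeries ^ (k + l)) +
      (k : ℝ⟦X⟧) * (l : ℝ⟦X⟧) * X ^ 3 * (1 + uSeries) ^ 2 * uSeries ^ (k + l - 2) =
      C (2 * ((k : ℝ) + 1) * (l + 1)) *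
          (X ^ 3 * (uSeries ^ (k + l) * ((C 1 + uSeries) * wSeries))) +
      C 2 * (X ^ 2 * ((C 1 + uSeries) * uSeries ^ (k + l))) +
      C ((k : ℝ) * l) * (X ^ 3 * ((C 1 + uSeries) ^ 2 * uSeries ^ (k + l - 2))) := by
    rw [forestGapSeries_eq_wSeries]
    simp only [map_mul, map_add, map_natCast, map_ofNat, map_one]
    ring
  have h := (((c (2 * ((k : ℝ) + 1) * (l + 1))).mul ((X1.pow 3).mul ((U.pow (k + l)).mul
    (((c 1).add U).mul W)))).add ((c 2).mul ((X1.pow 2).mul (((c 1).add U).mul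
    (U.pow (k + l)))))).add ((c ((k : ℝ) * l)).mul ((X1.pow 3).mul ((((c 1).add U).pow 2).mul
    (U.pow (k + l - 2)))))
  rw [← e] at h
  have h2 := (h _ hxr).2
  simp_rw [← markedCount_eq, Complex.ofReal_natCast] at h2
  convert h2 using 1
  rw [mul_div_cancel₀ x r_complex_ne_zero, sliceFun]
  push_cast
  ring

/-- The generating function of the numbers `T_{n, k, l}`, at `(x / r, y / 2 s, z / 2 s)`. -/
noncomputable def markedFun (p : ℂ × (Fin 2 → ℂ)) : ℂ :=
  let U := uFun p.1
  let X := p.1 / r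
  let Y := p.2 0 / (2 * s)
  let Z := p.2 1 / (2 * s)
  2 * X ^ 3 * (1 + U) * (sqrtFun p.1)⁻¹ * (Y ^ 2 * ((1 - Y * U) ^ 2)⁻¹) *
      (Z ^ 2 * ((1 - Z * U) ^ 2)⁻¹)
    + 2 * X ^ 2 * (1 + U) * (Y ^ 2 * (1 - Y * U)⁻¹) * (Z ^ 2 * (1 - Z * U)⁻¹)
    + X ^ 3 * (1 + U) ^ 2 * (Y ^ 3 * ((1 - Y * U) ^ 2)⁻¹) * (Z ^ 3 * ((1 - Z * U) ^ 2)⁻¹)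

theorem norm_scaled_mul_lt_one {x y : ℂ} (hx : x ∈ coneComplement) (hy : ‖y‖ < 1) :
    ‖y / (2 * s) * uFun x‖ < 1 := by
  have hs := two_s_bounds.1
  have h := norm_uFun_lt hx
  rw [norm_mul, norm_div, norm_two_s, div_mul_eq_mul_div, div_lt_one (by linarith)]
  nlinarith [norm_nonneg y, norm_nonneg (uFun x)]

theorem hasSum_of_eq {ι : Type*} {f g : ι → ℂ} {a b : ℂ} (hf : HasSum f a)
    (h : ∀ i, g i = f i) (h' : b = a) : HasSum g b := by
  rw [h', funext h]
  exact hf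

/-- The series over one of the exponents `k` and `l` of the terms that occur in `sliceFun`. In the
third one, the truncated exponent `k - 1` at `k = 0` is multiplied by zero. -/
theorem hasSum_geometric_family (U Y : ℂ) (h : ‖Y * U‖ < 1) :
    HasSum (fun k : ℕ => U ^ k * Y ^ (k + 2)) (Y ^ 2 * (1 - Y * U)⁻¹) ∧
    HasSum (fun k : ℕ => ((k : ℂ) + 1) * U ^ k * Y ^ (k + 2)) (Y ^ 2 * ((1 - Y * U) ^ 2)⁻¹) ∧
    HasSum (fun k : ℕ => (k : ℂ) * U ^ (k - 1) * Y ^ (k + 2)) (Y ^ 3 * ((1 - Y * U) ^ 2)⁻¹) := by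
  have h1 := (hasSum_geometric_of_norm_lt_one h).mul_left (Y ^ 2)
  have h2 := (hasSum_choose_mul_geometric_of_norm_lt_one 1 h).mul_left (Y ^ 2)
  have h3 := (hasSum_choose_mul_geometric_of_norm_lt_one 1 h).mul_left (Y ^ 3)
  refine ⟨hasSum_of_eq h1 (fun k => ?_) rfl, hasSum_of_eq h2 (fun k => ?_) ?_, ?_⟩
  · rw [mul_pow]; ring
  · rw [mul_pow, Nat.choose_one_right]; push_cast; ring
  · norm_num
  · rw [← hasSum_nat_add_iff' 1]
    refine hasSum_of_eq h3 (fun k => ?_) ?_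
    · rw [mul_pow, Nat.choose_one_right]; push_cast; ring
    · simp

theorem hasSum_mul_prod {f g : ℕ → ℂ} {a b : ℂ} (hf : HasSum f a) (hg : HasSum g b) :
    HasSum (fun p : ℕ × ℕ => f p.1 * g p.2) (a * b) :=
  hf.mul hg (summable_mul_of_summable_norm hf.summable.norm hg.summable.norm)

theorem hasSum_markedFun_slices {x y z : ℂ} (hx : ‖x‖ < 1) (hy : ‖y‖ < 1) (hz : ‖z‖ < 1) :
    HasSum (fun p : ℕ × ℕ => sliceFun p.1 p.2 x * (y / (2 * s)) ^ (p.1 + 2) *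
      (z / (2 * s)) ^ (p.2 + 2)) (markedFun (x, ![y, z])) := by
  have hx' := mem_coneComplement_of_norm_lt_one hx
  obtain ⟨hy1, hy2, hy3⟩ := hasSum_geometric_family _ _ (norm_scaled_mul_lt_one hx' hy)
  obtain ⟨hz1, hz2, hz3⟩ := hasSum_geometric_family _ _ (norm_scaled_mul_lt_one hx' hz)
  have h := (((hasSum_mul_prod hy2 hz2).mul_left (2 * (x / r) ^ 3 * (1 + uFun x) *
      (sqrtFun x)⁻¹)).add
    ((hasSum_mul_prod hy1 hz1).mul_left (2 * (x / r) ^ 2 * (1 + uFun x)))).add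
    ((hasSum_mul_prod hy3 hz3).mul_left ((x / r) ^ 3 * (1 + uFun x) ^ 2))
  refine hasSum_of_eq h ?_ ?_
  · rintro ⟨k, l⟩
    have e : (k : ℂ) * l * uFun x ^ (k + l - 2) =
        (k : ℂ) * l * (uFun x ^ (k - 1) * uFun x ^ (l - 1)) := by
      rcases Nat.eq_zero_or_pos k with rfl | hk
      · simp
      rcases Nat.eq_zero_or_pos l with rfl | hl
      · simp
      rw [← pow_add]
      congr 2
      omega
    have e' : (k : ℂ) * l * (x / r) ^ 3 * (1 + uFun x) ^ 2 * uFun x ^ (k + l - 2) =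
        (x / r) ^ 3 * (1 + uFun x) ^ 2 * ((k : ℂ) * l * (uFun x ^ (k - 1) * uFun x ^ (l - 1))) := by
      rw [← e]; ring
    simp only [sliceFun, e']
    ring
  · simp only [markedFun, Matrix.cons_val_zero, Matrix.cons_val_one]
    ring

/-- The triple series is summed over `n` first, and then over `k` and `l`. -/
theorem hasSum_markedFun {x y z : ℂ} (hx : ‖x‖ < 1) (hy : ‖y‖ < 1) (hz : ‖z‖ < 1) :
    HasSum (fun p : ℕ × ℕ × ℕ => (markedCount p.1 p.2.1 p.2.2 : ℂ) * (x / r) ^ p.1 *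
      (y / (2 * s)) ^ p.2.1 * (z / (2 * s)) ^ p.2.2) (markedFun (x, ![y, z])) := by
  -- only the exponents `k, l ≥ 2` contribute
  let e : (ℕ × ℕ) × ℕ → ℕ × ℕ × ℕ := fun p => (p.2, p.1.1 + 2, p.1.2 + 2)
  have he : Function.Injective e := by
    rintro ⟨⟨k, l⟩, n⟩ ⟨⟨k', l'⟩, n'⟩ h
    simp only [e, Prod.mk.injEq, Nat.add_right_cancel_iff] at h
    obtain ⟨rfl, rfl, rfl⟩ := h
    rfl
  rw [← he.hasSum_iff]
  swap
  · rintro ⟨n, k, l⟩ hp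
    have : ¬ (2 ≤ k ∧ 2 ≤ l) := by
      rintro ⟨hk, hl⟩
      exact hp ⟨((k - 2, l - 2), n), by simp [e]; omega⟩
    simp [markedCount_eq_zero this]
  have hfib : ∀ {x y z : ℂ}, ‖x‖ < 1 → ∀ p : ℕ × ℕ,
      HasSum (fun n => (markedCount n (p.1 + 2) (p.2 + 2) : ℂ) * (x / r) ^ n *
        (y / (2 * s)) ^ (p.1 + 2) * (z / (2 * s)) ^ (p.2 + 2))
        (sliceFun p.1 p.2 x * (y / (2 * s)) ^ (p.1 + 2) * (z / (2 * s)) ^ (p.2 + 2)) :=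
    fun hx p => ((hasSum_sliceFun p.1 p.2 hx).mul_right _).mul_right _
  set F : (ℕ × ℕ) × ℕ → ℂ := fun p => (markedCount p.2 (p.1.1 + 2) (p.1.2 + 2) : ℂ) *
    (x / r) ^ p.2 * (y / (2 * s)) ^ (p.1.1 + 2) * (z / (2 * s)) ^ (p.1.2 + 2) with hF
  change HasSum F _
  -- for nonnegative real arguments all terms are nonnegative, so that the iterated sums yield
  -- summability; the norms of the terms are of this kind
  have hsummable : Summable F := by
    have hn : ∀ v : ℂ, ‖v‖ < 1 → ‖((‖v‖ : ℝ) : ℂ)‖ < 1 := fun v hv => by simpa using hv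
    have hs := two_s_bounds.1
    have hsC : (2 * (s : ℂ)) = ((2 * s : ℝ) : ℂ) := by push_cast; ring
    have hnorm : ∀ p, ((‖F p‖ : ℝ) : ℂ) = (markedCount p.2 (p.1.1 + 2) (p.1.2 + 2) : ℂ) *
        (((‖x‖ : ℝ) : ℂ) / r) ^ p.2 * (((‖y‖ : ℝ) : ℂ) / (2 * s)) ^ (p.1.1 + 2) *
          (((‖z‖ : ℝ) : ℂ) / (2 * s)) ^ (p.1.2 + 2) := by
      intro p
      simp only [hF, hsC, norm_mul, norm_pow, norm_div, Complex.norm_natCast, Complex.norm_real,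
        Real.norm_of_nonneg r_pos.le, Real.norm_of_nonneg (show 0 ≤ 2 * s by linarith)]
      push_cast
      ring
    refine Summable.of_norm ((summable_prod_of_nonneg fun p => norm_nonneg _).2 ⟨fun p => ?_, ?_⟩)
    · exact ((hfib hx p).summable).norm
    · have h1 := (hasSum_markedFun_slices (hn x hx) (hn y hy) (hn z hz)).summable.norm
      refine h1.congr fun p => ?_
      have h2 := hfib (y := ((‖y‖ : ℝ) : ℂ)) (z := ((‖z‖ : ℝ) : ℂ)) (hn x hx) p
      have h3 : HasSum (fun n => ((‖F (p, n)‖ : ℝ) : ℂ)) (sliceFun p.1 p.2 ((‖x‖ : ℝ) : ℂ) *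
          (((‖y‖ : ℝ) : ℂ) / (2 * s)) ^ (p.1 + 2) * (((‖z‖ : ℝ) : ℂ) / (2 * s)) ^ (p.2 + 2)) := by
        simp_rw [hnorm]
        exact h2
      have h4 := h3.tsum_eq
      rw [← Complex.ofReal_tsum] at h4
      rw [← h4, Complex.norm_real, Real.norm_of_nonneg (tsum_nonneg fun n => norm_nonneg _)]
  have h1 := hsummable.hasSum.prod_fiberwise fun p => hfib hx p
  rw [(hasSum_markedFun_slices hx hy hz).unique h1]
  exact hsummable.hasSum

/-! ### The singular expansion -/

theorem norm_half_cpow_sq (z : ℂ) : ‖z ^ (1 / 2 : ℂ)‖ ^ 2 = ‖z‖ := by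
  rw [← norm_pow, half_cpow_sq]

theorem re_half_cpow_nonneg (z : ℂ) : 0 ≤ (z ^ (1 / 2 : ℂ)).re := by
  by_cases hz : z = 0
  · simp [hz]
  rw [Complex.cpow_def_of_ne_zero hz, Complex.exp_re]
  have h : (Complex.log z * (1 / 2)).im = Complex.arg z / 2 := by
    rw [show (1 / 2 : ℂ) = ((1 / 2 : ℝ) : ℂ) by push_cast; ring, Complex.im_mul_ofReal,
      Complex.log_im]
    ring
  rw [h]
  have h1 := Complex.neg_pi_lt_arg z
  have h2 := Complex.arg_le_pi z
  exact mul_nonneg (Real.exp_pos _).le (Real.cos_nonneg_of_mem_Icc ⟨by linarith, by linarith⟩)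

/-- The factors of `markedFun` that depend on `y`, and how far the first of them is from its
value at `x = 1`. -/
theorem factor_bounds {x y : ℂ} (hx : x ∈ coneComplement) (hy : ‖y‖ < 1) :
    ‖(y / (2 * s)) ^ 2 * ((1 - y / (2 * s) * uFun x) ^ 2)⁻¹‖ ≤ 7 * ((1 - ‖y‖)⁻¹) ^ 4 ∧
    ‖(y / (2 * s)) ^ 2 * ((1 - y) ^ 2)⁻¹‖ ≤ 7 * ((1 - ‖y‖)⁻¹) ^ 4 ∧
    ‖(y / (2 * s)) ^ 2 * (1 - y / (2 * s) * uFun x)⁻¹‖ ≤ 7 * ((1 - ‖y‖)⁻¹) ^ 4 ∧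
    ‖(y / (2 * s)) ^ 3 * ((1 - y / (2 * s) * uFun x) ^ 2)⁻¹‖ ≤ 16 * ((1 - ‖y‖)⁻¹) ^ 4 ∧
    ‖(y / (2 * s)) ^ 2 * ((1 - y / (2 * s) * uFun x) ^ 2)⁻¹ -
      (y / (2 * s)) ^ 2 * ((1 - y) ^ 2)⁻¹‖ ≤
        32 * ‖(1 - x) ^ (1 / 2 : ℂ)‖ * ((1 - ‖y‖)⁻¹) ^ 4 := by
  obtain ⟨hs1, hs2⟩ := two_s_bounds
  have hsC : (2 * (s : ℂ)) ≠ 0 := norm_ne_zero_iff.1 (by rw [norm_two_s]; linarith)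
  set σ := ‖(1 - x) ^ (1 / 2 : ℂ)‖ with hσ
  have hσ0 : 0 ≤ σ := norm_nonneg _
  set κ := (1 - ‖y‖)⁻¹ with hκ
  have hη : 0 < 1 - ‖y‖ := by linarith
  have hκ1 : 1 ≤ κ := (one_le_inv₀ hη).2 (by linarith [norm_nonneg y])
  have hY : ‖y / (2 * s)‖ ≤ 2.5 := by
    rw [norm_div, norm_two_s, div_le_iff₀ (by linarith)]
    linarith
  have hu := norm_uFun_lt hx
  have hyU : ‖y / (2 * s) * uFun x‖ ≤ ‖y‖ := by
    rw [norm_mul, norm_div, norm_two_s, div_mul_eq_mul_div, div_le_iff₀ (by linarith)]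
    exact mul_le_mul_of_nonneg_left hu.le (norm_nonneg _)
  have hinv : ∀ v : ℂ, ‖v‖ ≤ ‖y‖ → 1 - v ≠ 0 ∧ ‖(1 - v)⁻¹‖ ≤ κ := by
    intro v hv
    have h1 : 1 - ‖y‖ ≤ ‖1 - v‖ := by
      have := norm_sub_norm_le (1 : ℂ) v
      rw [norm_one] at this
      linarith
    refine ⟨norm_ne_zero_iff.1 (by linarith), ?_⟩
    rw [norm_inv]
    exact inv_anti₀ hη h1
  obtain ⟨hD, hD'⟩ := hinv _ hyU
  obtain ⟨hD₀, hD₀'⟩ := hinv y le_rfl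
  have hdiff : ‖(1 - y) - (1 - y / (2 * s) * uFun x)‖ ≤ 2.5 * σ := by
    have h1 : ‖uFun x - 2 * s‖ ≤ σ := by
      have h := norm_uFun_sub_sq_le hx
      rw [← norm_half_cpow_sq (1 - x)] at h
      exact le_of_sq_le_sq h hσ0
    have e : (1 - y) - (1 - y / (2 * s) * uFun x) = y / (2 * s) * (uFun x - 2 * s) := by
      rw [mul_sub, div_mul_cancel₀ y hsC]
      ring
    rw [e, norm_mul]
    gcongr
  set Y := y / (2 * (s : ℂ))
  set D := 1 - Y * uFun x
  set D₀ := 1 - y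
  have hY2 : ‖Y ^ 2‖ ≤ 6.25 := by
    rw [norm_pow]
    calc ‖Y‖ ^ 2 ≤ 2.5 ^ 2 := by gcongr
      _ = 6.25 := by norm_num
  have hY3 : ‖Y ^ 3‖ ≤ 16 := by
    rw [norm_pow]
    calc ‖Y‖ ^ 3 ≤ 2.5 ^ 3 := by gcongr
      _ ≤ 16 := by norm_num
  have hk : ∀ i ≤ 4, κ ^ i ≤ κ ^ 4 := fun i hi => pow_le_pow_right₀ hκ1 hi
  have hsq : ∀ v : ℂ, ‖v⁻¹‖ ≤ κ → ‖(v ^ 2)⁻¹‖ ≤ κ ^ 4 := by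
    intro v hv
    rw [← inv_pow, norm_pow]
    exact (pow_le_pow_left₀ (norm_nonneg _) hv 2).trans (hk 2 (by norm_num))
  refine ⟨?_, ?_, ?_, ?_, ?_⟩
  · rw [norm_mul]
    exact mul_le_mul (hY2.trans (by norm_num)) (hsq _ hD') (norm_nonneg _) (by norm_num)
  · rw [norm_mul]
    exact mul_le_mul (hY2.trans (by norm_num)) (hsq _ hD₀') (norm_nonneg _) (by norm_num)
  · rw [norm_mul]
    refine mul_le_mul (hY2.trans (by norm_num)) (hD'.trans ?_) (norm_nonneg _) (by norm_num)
    simpa using hk 1 (by norm_num)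
  · rw [norm_mul]
    exact mul_le_mul hY3 (hsq _ hD') (norm_nonneg _) (by norm_num)
  · have e : Y ^ 2 * (D ^ 2)⁻¹ - Y ^ 2 * (D₀ ^ 2)⁻¹ =
        Y ^ 2 * ((D₀ - D) * (D⁻¹ * D₀⁻¹) * (D⁻¹ + D₀⁻¹)) := by
      field_simp
      ring
    rw [e, norm_mul, norm_mul, norm_mul, norm_mul]
    calc ‖Y ^ 2‖ * (‖D₀ - D‖ * (‖D⁻¹‖ * ‖D₀⁻¹‖) * ‖D⁻¹ + D₀⁻¹‖)
        ≤ 6.25 * (2.5 * σ * (κ * κ) * (κ + κ)) := by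
          gcongr
          exact (norm_add_le _ _).trans (add_le_add hD' hD₀')
      _ = 31.25 * σ * κ ^ 3 := by ring
      _ ≤ 32 * σ * κ ^ 4 := by
          have := hk 3 (by norm_num)
          gcongr
          norm_num

theorem norm_leading_constant_le : ‖2 * (q : ℂ) * s ^ 2 / r ^ 2‖ ≤ 1 := by
  have hq := q_pos
  have hr := r_gt
  have hrp := r_pos
  have e : 2 * (q : ℂ) * s ^ 2 / r ^ 2 = ((2 * (q * s ^ 2) / r ^ 2 : ℝ) : ℂ) := by
    push_cast; ring
  rw [e, Complex.norm_real, Real.norm_of_nonneg (by positivity), div_le_one (by positivity)]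
  nlinarith [q_mul_s_sq_le]

/-- The factor of `markedFun` that depends on `x` only, without `(1 - x) ^ (-1 / 2)`, differs from
its value at `x = 1` by `O(|1 - x| ^ (1 / 2))`. -/
theorem norm_sub_constant_le {x : ℂ} (hx : x ∈ coneComplement) :
    ‖2 * (x / r) ^ 3 * (1 + uFun x) * ((1 - x / (r : ℂ) ^ 2) ^ (1 / 2 : ℂ))⁻¹ -
      2 * q * s ^ 2 / r ^ 2‖ ≤ 4 * ‖(1 - x) ^ (1 / 2 : ℂ)‖ := by
  have hr1 := r_gt
  have hrp := r_pos
  have hrC := r_complex_ne_zero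
  have hq := q_pos
  obtain ⟨hs1, hs2⟩ := two_s_bounds
  have hsq := half_cpow_sq (1 - x / (r : ℂ) ^ 2)
  have hre := re_half_cpow_nonneg (1 - x / (r : ℂ) ^ 2)
  have hnorm := norm_half_cpow_sq (1 - x / (r : ℂ) ^ 2)
  have hσsq := norm_half_cpow_sq (1 - x)
  set H := (1 - x / (r : ℂ) ^ 2) ^ (1 / 2 : ℂ)
  set σ := ‖(1 - x) ^ (1 / 2 : ℂ)‖
  have hσ0 : 0 ≤ σ := norm_nonneg _
  have hx1 := hx.1
  have hσ1 : σ ≤ 1.5 := by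
    have : ‖1 - x‖ ≤ 2.1 := by
      calc ‖1 - x‖ ≤ ‖(1 : ℂ)‖ + ‖x‖ := norm_sub_le _ _
        _ ≤ 2.1 := by rw [norm_one]; linarith
    nlinarith
  have hσ2 : ‖x - 1‖ ≤ 1.5 * σ := by
    rw [norm_sub_rev, ← hσsq]
    nlinarith
  have hnr : ‖(r : ℂ)‖ = r := by rw [Complex.norm_real, Real.norm_of_nonneg hrp.le]
  have hHn : 1 / 2 ≤ ‖H‖ := by
    have h1 : ‖x / (r : ℂ) ^ 2‖ ≤ 1 / 2 := by
      rw [norm_div, norm_pow, hnr, div_le_iff₀ (by positivity)]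
      nlinarith
    have h2 := norm_sub_norm_le (1 : ℂ) (x / (r : ℂ) ^ 2)
    rw [norm_one] at h2
    by_contra! hlt
    nlinarith [norm_nonneg H]
  have hH0 : H ≠ 0 := norm_ne_zero_iff.1 (by linarith)
  have hHinv : ‖H⁻¹‖ ≤ 2 := by
    rw [norm_inv]
    calc ‖H‖⁻¹ ≤ (1 / 2)⁻¹ := inv_anti₀ (by norm_num) hHn
      _ = 2 := by norm_num
  -- the square root close to its value `q / r` at `x = 1`
  have hh0 : 1 / 2 ≤ q / r := by
    have := r_div_q_bounds.2
    rw [div_le_iff₀ hq] at this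
    rw [le_div_iff₀ hrp]
    linarith
  have hdiff : ‖(q / r : ℝ) - H‖ ≤ σ := by
    have h1 : ((q / r : ℝ) - H) * ((q / r : ℝ) + H) = (x - 1) / (r : ℂ) ^ 2 := by
      have h2 : ((q / r : ℝ) : ℂ) ^ 2 = 1 - 1 / (r : ℂ) ^ 2 := by
        have : (q / r) ^ 2 = 1 - 1 / r ^ 2 := by
          rw [div_pow, q_sq]
          field_simp
        exact_mod_cast this
      linear_combination h2 - hsq
    have h2 := congrArg norm h1
    rw [norm_mul, norm_div, norm_pow, hnr] at h2
    have h3 : 1 / 2 ≤ ‖((q / r : ℝ) : ℂ) + H‖ := by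
      refine le_trans ?_ (Complex.re_le_norm _)
      rw [Complex.add_re, Complex.ofReal_re]
      linarith
    have h4 : ‖x - 1‖ / r ^ 2 ≤ 1 / 2 * σ := by
      have h6 : (5.8 : ℝ) ^ 2 ≤ r ^ 2 := by gcongr
      rw [div_le_iff₀ (by positivity)]
      nlinarith [mul_le_mul_of_nonneg_left h6 hσ0]
    have h5 : ‖((q / r : ℝ) : ℂ) - H‖ * (1 / 2) ≤
        ‖((q / r : ℝ) : ℂ) - H‖ * ‖((q / r : ℝ) : ℂ) + H‖ := by
      gcongr
    linarith
  have hG0 : 2 * (q : ℂ) * s ^ 2 / r ^ 2 * (q / r : ℝ) = 2 / r ^ 3 * (1 + 2 * s) := by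
    have h1 : (1 + 2 * s) = q * s ^ 2 * q := by
      rw [two_s_eq, ← sqrt_two_div_q]
      field_simp
    have h2 : (1 + 2 * (s : ℂ)) = q * s ^ 2 * q := by exact_mod_cast h1
    rw [h2]
    push_cast
    field_simp
  have hG0n := norm_leading_constant_le
  have hu : ‖uFun x - 2 * s‖ ≤ σ := by
    have h := norm_uFun_sub_sq_le hx
    rw [← hσsq] at h
    exact le_of_sq_le_sq h hσ0
  have hU : ‖1 + uFun x‖ ≤ 1.5 := by
    calc ‖1 + uFun x‖ ≤ ‖(1 : ℂ)‖ + ‖uFun x‖ := norm_add_le _ _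
      _ ≤ 1.5 := by rw [norm_one]; linarith [norm_uFun_lt hx]
  have hcube : ‖x ^ 3 - 1‖ ≤ 6 * σ := by
    have e : x ^ 3 - 1 = (x - 1) * (x ^ 2 + x + 1) := by ring
    rw [e, norm_mul]
    have h1 : ‖x ^ 2 + x + 1‖ ≤ 4 := by
      calc ‖x ^ 2 + x + 1‖ ≤ ‖x ^ 2‖ + ‖x‖ + ‖(1 : ℂ)‖ := norm_add₃_le
        _ ≤ 4 := by rw [norm_pow, norm_one]; nlinarith [norm_nonneg x]
    calc ‖x - 1‖ * ‖x ^ 2 + x + 1‖ ≤ 1.5 * σ * 4 := by gcongr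
      _ = 6 * σ := by ring
  have e : 2 * (x / r) ^ 3 * (1 + uFun x) * H⁻¹ - 2 * q * s ^ 2 / r ^ 2 =
      H⁻¹ * (2 / (r : ℂ) ^ 3 * ((x ^ 3 - 1) * (1 + uFun x) + (uFun x - 2 * s)) +
        2 * q * s ^ 2 / r ^ 2 * ((q / r : ℝ) - H)) := by
    rw [mul_sub, hG0]
    field_simp
    ring
  have h2r : ‖2 / (r : ℂ) ^ 3‖ ≤ 1 / 10 := by
    rw [norm_div, norm_pow, hnr, Complex.norm_ofNat, div_le_iff₀ (by positivity)]
    nlinarith [pow_pos hrp 2, pow_pos hrp 3]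
  rw [e, norm_mul]
  calc ‖H⁻¹‖ * ‖2 / (r : ℂ) ^ 3 * ((x ^ 3 - 1) * (1 + uFun x) + (uFun x - 2 * s)) +
        2 * q * s ^ 2 / r ^ 2 * ((q / r : ℝ) - H)‖
      ≤ 2 * (1 / 10 * (6 * σ * 1.5 + σ) + 1 * σ) := by
        refine mul_le_mul hHinv ((norm_add_le _ _).trans (add_le_add ?_ ?_)) (norm_nonneg _)
          (by norm_num)
        · rw [norm_mul]
          refine mul_le_mul h2r ((norm_add_le _ _).trans (add_le_add ?_ hu)) (norm_nonneg _)
            (by norm_num)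
          rw [norm_mul]
          gcongr
        · rw [norm_mul]
          gcongr
    _ = 4 * σ := by ring

/-- The leading term of the singular expansion of `markedFun`. -/
noncomputable def mainTerm (p : ℂ × (Fin 2 → ℂ)) : ℂ :=
  2 * q * s ^ 2 * (p.2 0 ^ 2 * p.2 1 ^ 2) * ((1 - p.1) ^ (1 / 2 : ℂ))⁻¹ *
    (((1 - p.2 0) ^ 2)⁻¹ * ((1 - p.2 1) ^ 2)⁻¹)

/-- The error term is bounded in `x`: the powers of `(1 - x) ^ (1 / 2)` gained by the factors
cancel the singularity. The constant is not optimized. -/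
theorem norm_markedFun_sub_mainTerm_le {p : ℂ × (Fin 2 → ℂ)} (hx : p.1 ∈ coneComplement)
    (hy : ‖p.2 0‖ < 1) (hz : ‖p.2 1‖ < 1) :
    ‖markedFun p - mainTerm p‖ ≤
      2000 * (((1 - ‖p.2 0‖)⁻¹) ^ 4 * ((1 - ‖p.2 1‖)⁻¹) ^ 4) := by
  obtain ⟨x, v⟩ := p
  simp only [markedFun, mainTerm]
  simp only at hx hy hz
  obtain ⟨hy1, hy2, hy3, hy4, hy5⟩ := factor_bounds hx hy
  obtain ⟨hz1, hz2, hz3, hz4, hz5⟩ := factor_bounds hx hz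
  have hG := norm_sub_constant_le hx
  have hrp := r_pos
  have hr1 := r_gt
  have hrC := r_complex_ne_zero
  obtain ⟨hs1, hs2⟩ := two_s_bounds
  have hsC : (2 * (s : ℂ)) ≠ 0 := norm_ne_zero_iff.1 (by rw [norm_two_s]; linarith)
  have hw0 : (1 - x) ^ (1 / 2 : ℂ) ≠ 0 := by
    intro h
    have := sqrtFun_ne_zero hx
    rw [sqrtFun, h, zero_mul] at this
    exact this rfl
  have hy0 : v 0 = 2 * s * (v 0 / (2 * s)) := (mul_div_cancel₀ _ hsC).symm
  have hz0 : v 1 = 2 * s * (v 1 / (2 * s)) := (mul_div_cancel₀ _ hsC).symm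
  have hκ0 : 0 ≤ ((1 - ‖v 0‖)⁻¹) ^ 4 := by
    have : 0 < 1 - ‖v 0‖ := by linarith
    positivity
  have hμ0 : 0 ≤ ((1 - ‖v 1‖)⁻¹) ^ 4 := by
    have : 0 < 1 - ‖v 1‖ := by linarith
    positivity
  set Y := v 0 / (2 * (s : ℂ))
  set Z := v 1 / (2 * (s : ℂ))
  set κ := ((1 - ‖v 0‖)⁻¹) ^ 4
  set μ := ((1 - ‖v 1‖)⁻¹) ^ 4
  set W := (1 - x) ^ (1 / 2 : ℂ)
  set V := Y ^ 2 * ((1 - Y * uFun x) ^ 2)⁻¹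
  set V₀ := Y ^ 2 * ((1 - v 0) ^ 2)⁻¹ with hV0
  set V' := Z ^ 2 * ((1 - Z * uFun x) ^ 2)⁻¹
  set V₀' := Z ^ 2 * ((1 - v 1) ^ 2)⁻¹ with hV0'
  set A := Y ^ 2 * (1 - Y * uFun x)⁻¹
  set A' := Z ^ 2 * (1 - Z * uFun x)⁻¹
  set B := Y ^ 3 * ((1 - Y * uFun x) ^ 2)⁻¹
  set B' := Z ^ 3 * ((1 - Z * uFun x) ^ 2)⁻¹
  have hmain : 2 * q * s ^ 2 * (v 0 ^ 2 * v 1 ^ 2) * W⁻¹ *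
      (((1 - v 0) ^ 2)⁻¹ * ((1 - v 1) ^ 2)⁻¹) = W⁻¹ * (2 * q * s ^ 2 / r ^ 2 * V₀ * V₀') := by
    have h1 : (2 * (s : ℂ)) ^ 2 * r = 1 := by exact_mod_cast four_s_sq_mul_r
    have h2 : ((2 * (s : ℂ)) ^ 2) ^ 2 = 1 / r ^ 2 := by
      field_simp
      linear_combination ((2 * (s : ℂ)) ^ 2 * r + 1) * h1
    have h3 : v 0 ^ 2 * v 1 ^ 2 = ((2 * (s : ℂ)) ^ 2) ^ 2 * (Y ^ 2 * Z ^ 2) := by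
      conv_lhs => rw [hy0, hz0]
      ring
    rw [h3, h2, hV0, hV0']
    ring
  have hroot : (sqrtFun x)⁻¹ = W⁻¹ * ((1 - x / (r : ℂ) ^ 2) ^ (1 / 2 : ℂ))⁻¹ := by
    rw [sqrtFun, mul_inv]
  set G := 2 * (x / r) ^ 3 * (1 + uFun x) * ((1 - x / (r : ℂ) ^ 2) ^ (1 / 2 : ℂ))⁻¹ with hGdef
  set G₀ : ℂ := 2 * q * s ^ 2 / r ^ 2
  have hG0n : ‖G₀‖ ≤ 1 := norm_leading_constant_le
  have hU : ‖1 + uFun x‖ ≤ 1.5 := by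
    calc ‖1 + uFun x‖ ≤ ‖(1 : ℂ)‖ + ‖uFun x‖ := norm_add_le _ _
      _ ≤ 1.5 := by rw [norm_one]; linarith [norm_uFun_lt hx]
  have hX : ‖x / (r : ℂ)‖ ≤ 1 / 2 := by
    rw [norm_div, Complex.norm_real, Real.norm_of_nonneg hrp.le, div_le_iff₀ hrp]
    linarith [hx.1]
  have e : 2 * (x / r) ^ 3 * (1 + uFun x) * (sqrtFun x)⁻¹ * V * V' +
      2 * (x / r) ^ 2 * (1 + uFun x) * A * A' + (x / r) ^ 3 * (1 + uFun x) ^ 2 * B * B' -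
      2 * q * s ^ 2 * (v 0 ^ 2 * v 1 ^ 2) * W⁻¹ * (((1 - v 0) ^ 2)⁻¹ * ((1 - v 1) ^ 2)⁻¹) =
      W⁻¹ * ((G - G₀) * (V * V') + G₀ * ((V - V₀) * V') + G₀ * (V₀ * (V' - V₀'))) +
      (2 * (x / r) ^ 2 * (1 + uFun x)) * (A * A') +
      ((x / r) ^ 3 * (1 + uFun x) ^ 2) * (B * B') := by
    rw [hmain, hroot, hGdef]
    ring
  rw [e]
  have hW : 0 < ‖W‖ := norm_pos_iff.2 hw0
  have hT1 : ‖W⁻¹ * ((G - G₀) * (V * V') + G₀ * ((V - V₀) * V') + G₀ * (V₀ * (V' - V₀')))‖ ≤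
      644 * (κ * μ) := by
    rw [norm_mul, norm_inv, inv_mul_le_iff₀ hW]
    refine norm_add₃_le.trans ?_
    rw [norm_mul (G - G₀), norm_mul V V', norm_mul G₀, norm_mul (V - V₀), norm_mul G₀, norm_mul V₀]
    calc ‖G - G₀‖ * (‖V‖ * ‖V'‖) + ‖G₀‖ * (‖V - V₀‖ * ‖V'‖) + ‖G₀‖ * (‖V₀‖ * ‖V' - V₀'‖)
        ≤ 4 * ‖W‖ * ((7 * κ) * (7 * μ)) + 1 * ((32 * ‖W‖ * κ) * (7 * μ)) +
          1 * ((7 * κ) * (32 * ‖W‖ * μ)) := by gcongr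
      _ = ‖W‖ * (644 * (κ * μ)) := by ring
  have hT2 : ‖(2 * (x / r) ^ 2 * (1 + uFun x)) * (A * A')‖ ≤ 1 * ((7 * κ) * (7 * μ)) := by
    rw [norm_mul, norm_mul A, norm_mul, norm_mul, norm_pow, Complex.norm_ofNat]
    gcongr
    calc 2 * ‖x / (r : ℂ)‖ ^ 2 * ‖1 + uFun x‖ ≤ 2 * (1 / 2) ^ 2 * 1.5 := by gcongr
      _ ≤ 1 := by norm_num
  have hT3 : ‖((x / r) ^ 3 * (1 + uFun x) ^ 2) * (B * B')‖ ≤ 1 * ((16 * κ) * (16 * μ)) := by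
    rw [norm_mul, norm_mul B, norm_mul, norm_pow, norm_pow]
    gcongr
    calc ‖x / (r : ℂ)‖ ^ 3 * ‖1 + uFun x‖ ^ 2 ≤ (1 / 2) ^ 3 * 1.5 ^ 2 := by gcongr
      _ ≤ 1 := by norm_num
  refine norm_add₃_le.trans ((add_le_add (add_le_add hT1 hT2) hT3).trans ?_)
  have : 0 ≤ κ * μ := mul_nonneg hκ0 hμ0
  linarith

theorem one_sub_ne_zero_of_norm_lt_one {y : ℂ} (hy : ‖y‖ < 1) : 1 - y ≠ 0 := by
  intro h
  rw [← sub_eq_zero.1 h, norm_one] at hy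
  exact lt_irrefl _ hy

theorem analyticAt_snd_apply (j : Fin 2) (p : ℂ × (Fin 2 → ℂ)) :
    AnalyticAt ℂ (fun p : ℂ × (Fin 2 → ℂ) => p.2 j) p :=
  ((ContinuousLinearMap.proj (R := ℂ) (φ := fun _ : Fin 2 => ℂ) j).comp
    (ContinuousLinearMap.snd ℂ ℂ (Fin 2 → ℂ))).analyticAt p

theorem analyticAt_markedFun {p : ℂ × (Fin 2 → ℂ)} (hx : p.1 ∈ coneComplement)
    (hy : ‖p.2 0‖ < 1) (hz : ‖p.2 1‖ < 1) : AnalyticAt ℂ markedFun p := by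
  have hU : AnalyticAt ℂ (fun p : ℂ × (Fin 2 → ℂ) => uFun p.1) p :=
    (analyticAt_uFun hx).fun_comp analyticAt_fst
  have hR : AnalyticAt ℂ (fun p : ℂ × (Fin 2 → ℂ) => (sqrtFun p.1)⁻¹) p :=
    ((analyticAt_sqrtFun hx).fun_comp analyticAt_fst).inv (sqrtFun_ne_zero hx)
  have hX : AnalyticAt ℂ (fun p : ℂ × (Fin 2 → ℂ) => p.1 / (r : ℂ)) p :=
    analyticAt_fst.div analyticAt_const r_complex_ne_zero
  have hs := two_s_bounds.1
  have hsC : (2 * (s : ℂ)) ≠ 0 := norm_ne_zero_iff.1 (by rw [norm_two_s]; linarith)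
  have hY : ∀ j, AnalyticAt ℂ (fun p : ℂ × (Fin 2 → ℂ) => p.2 j / (2 * (s : ℂ))) p := fun j =>
    (analyticAt_snd_apply j p).div analyticAt_const hsC
  have hD : ∀ j, ‖p.2 j‖ < 1 → AnalyticAt ℂ
      (fun p : ℂ × (Fin 2 → ℂ) => (1 - p.2 j / (2 * (s : ℂ)) * uFun p.1)⁻¹) p := fun j hj =>
    (analyticAt_const.sub ((hY j).mul hU)).inv
      (one_sub_ne_zero_of_norm_lt_one (norm_scaled_mul_lt_one hx hj))
  have h1 := hD 0 hy
  have h2 := hD 1 hz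
  have hY0 := hY 0
  have hY1 := hY 1
  unfold markedFun
  simp only [← inv_pow]
  fun_prop

theorem analyticAt_mainTerm {p : ℂ × (Fin 2 → ℂ)} (hx : p.1 ∈ coneComplement)
    (hy : ‖p.2 0‖ < 1) (hz : ‖p.2 1‖ < 1) : AnalyticAt ℂ mainTerm p := by
  have hsl := one_sub_mem_slitPlane_of_mem hx
  have hW : AnalyticAt ℂ (fun p : ℂ × (Fin 2 → ℂ) => ((1 - p.1) ^ (1 / 2 : ℂ))⁻¹) p := by
    refine ((analyticAt_const.sub analyticAt_fst).cpow analyticAt_const hsl).inv ?_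
    intro h
    change (1 - p.1) ^ (1 / 2 : ℂ) = 0 at h
    have h' := half_cpow_sq (1 - p.1)
    rw [h, zero_pow two_ne_zero] at h'
    exact Complex.slitPlane_ne_zero hsl h'.symm
  have hY0 := analyticAt_snd_apply 0 p
  have hY1 := analyticAt_snd_apply 1 p
  have hD0 : AnalyticAt ℂ (fun p : ℂ × (Fin 2 → ℂ) => (1 - p.2 0)⁻¹) p :=
    (analyticAt_const.sub hY0).inv (one_sub_ne_zero_of_norm_lt_one hy)
  have hD1 : AnalyticAt ℂ (fun p : ℂ × (Fin 2 → ℂ) => (1 - p.2 1)⁻¹) p :=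
    (analyticAt_const.sub hY1).inv (one_sub_ne_zero_of_norm_lt_one hz)
  unfold mainTerm
  simp only [← inv_pow]
  fun_prop

/-- The main term as a product of principal values of powers. -/
theorem mainTerm_eq (p : ℂ × (Fin 2 → ℂ)) :
    mainTerm p = 2 * q * s ^ 2 * (p.2 0 ^ 2 * p.2 1 ^ 2) * (1 - p.1) ^ (-((1 / 2 : ℝ) : ℂ)) *
      ∏ j, (1 - p.2 j) ^ (-((![2, 2] j : ℝ) : ℂ)) := by
  have h : ∀ z : ℂ, z ^ (-((2 : ℝ) : ℂ)) = (z ^ 2)⁻¹ := fun z => by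
    rw [Complex.cpow_neg, show ((2 : ℝ) : ℂ) = ((2 : ℕ) : ℂ) by norm_num, Complex.cpow_natCast]
  rw [Fin.prod_univ_two, Matrix.cons_val_zero, Matrix.cons_val_one, Matrix.cons_val_fin_one, h, h,
    Complex.cpow_neg, show ((1 / 2 : ℝ) : ℂ) = 1 / 2 by norm_num, mainTerm]

/-- The coefficient function is a constant multiple of `y ^ 2 * z ^ 2`, the polynomial terms vanish,
and the error term is the difference between `markedFun` and its main term. -/
theorem approx_markedFun :
    Approx markedFun (2 * (q : ℂ) * (s : ℂ) ^ 2) (1 / 2) ![2, 2] := by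
  have hq := q_pos
  have hs := two_s_bounds.1
  have hsp : 0 < s := by linarith
  have hsub := deltaDomain_subset
  have hadm : Admissible (1 / 10) (Real.pi / 3) :=
    ⟨by norm_num, by positivity, by linarith [Real.pi_pos]⟩
  have hc : 2 * (q : ℂ) * (s : ℂ) ^ 2 ≠ 0 := by
    have : 2 * q * s ^ 2 ≠ 0 := by positivity
    exact_mod_cast this
  have hbound : ∀ p ∈ rDomain 2 (1 / 10) (Real.pi / 3),
      ‖markedFun p - mainTerm p‖ ≤
        2000 * (‖1 - p.1‖ ^ (-0 : ℝ) * ∏ j, (1 - ‖p.2 j‖) ^ (-4 : ℝ)) := by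
    intro p hp
    have h : ∀ j, (1 - ‖p.2 j‖) ^ (-4 : ℝ) = ((1 - ‖p.2 j‖)⁻¹) ^ 4 := fun j => by
      have : 0 ≤ 1 - ‖p.2 j‖ := by linarith [hp.2 j]
      rw [Real.rpow_neg this, show (4 : ℝ) = ((4 : ℕ) : ℝ) by norm_num, Real.rpow_natCast, inv_pow]
    rw [neg_zero, Real.rpow_zero, one_mul, Fin.prod_univ_two, h, h]
    exact norm_markedFun_sub_mainTerm_le (hsub hp.1) (hp.2 0) (hp.2 1)
  refine ⟨hc, 1 / 10, Real.pi / 3, 0, fun _ => 4, fun y => 2 * q * s ^ 2 * (y 0 ^ 2 * y 1 ^ 2),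
    fun _ => 0, fun _ _ => 0, fun p => markedFun p - mainTerm p, hadm, by norm_num,
    fun _ => by norm_num, ?_, ?_, ?_, ?_, ?_, ?_⟩
  · intro p _
    rw [← mainTerm_eq p]
    simp
  · intro y _
    have h : ∀ j, AnalyticAt ℂ (fun y : Fin 2 → ℂ => y j) y := fun j =>
      (ContinuousLinearMap.proj (R := ℂ) (φ := fun _ : Fin 2 => ℂ) j).analyticAt y
    exact analyticAt_const.mul (((h 0).pow 2).mul ((h 1).pow 2))
  · refine ⟨‖2 * (q : ℂ) * (s : ℂ) ^ 2‖ * 3, fun y hy => ?_⟩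
    have h0 : ‖y 0‖ ≤ 1.1 := (hsub (hy 0 trivial)).1
    have h1 : ‖y 1‖ ≤ 1.1 := (hsub (hy 1 trivial)).1
    have e : 2 * (q : ℂ) * s ^ 2 * (y 0 ^ 2 * y 1 ^ 2) - 2 * q * s ^ 2 =
        2 * q * s ^ 2 * (-((1 - y 0) * (1 + y 0) * y 1 ^ 2) - (1 - y 1) * (1 + y 1)) := by ring
    rw [e, norm_mul, mul_assoc _ (3 : ℝ), Fin.sum_univ_two]
    refine mul_le_mul_of_nonneg_left ?_ (norm_nonneg _)
    have h2 : ∀ v : ℂ, ‖v‖ ≤ 1.1 → ‖1 + v‖ ≤ 2.1 := fun v hv => by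
      calc ‖1 + v‖ ≤ ‖(1 : ℂ)‖ + ‖v‖ := norm_add_le _ _
        _ ≤ 2.1 := by rw [norm_one]; linarith
    have h3 := h2 _ h0
    have h4 := h2 _ h1
    calc ‖-((1 - y 0) * (1 + y 0) * y 1 ^ 2) - (1 - y 1) * (1 + y 1)‖
        ≤ ‖1 - y 0‖ * ‖1 + y 0‖ * ‖y 1‖ ^ 2 + ‖1 - y 1‖ * ‖1 + y 1‖ := by
          refine (norm_sub_le _ _).trans_eq ?_
          rw [norm_neg, norm_mul, norm_mul, norm_mul, norm_pow]
      _ ≤ ‖1 - y 0‖ * 2.1 * 1.1 ^ 2 + ‖1 - y 1‖ * 2.1 := by gcongr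
      _ ≤ 3 * (‖1 - y 0‖ + ‖1 - y 1‖) := by
          linarith [norm_nonneg (1 - y 0), norm_nonneg (1 - y 1)]
  · exact ⟨0, fun _ _ => 0, fun _ _ _ => analyticAt_const, fun _ _ => by simp⟩
  · exact fun _ => ⟨0, fun _ _ => 0, fun _ _ _ => analyticAt_const, fun _ _ _ _ => rfl,
      fun _ _ => by simp⟩
  · exact ⟨1 / 10, Real.pi / 3, 0, 4, 0, hadm, by norm_num, le_rfl,
      fun p hp => (analyticAt_markedFun (hsub hp.1) (hp.2 0) (hp.2 1)).sub
        (analyticAt_mainTerm (hsub hp.1) (hp.2 0) (hp.2 1)),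
      ⟨2000, hbound⟩, ⟨2000, 1, one_pos, fun p hp _ => hbound p hp⟩⟩

end PlaneTree

theorem mainTheorem3 :
    (∃ f : ℂ × (Fin 2 → ℂ) → ℂ,
      (∀ x y z : ℂ, ‖x‖ < 1 → ‖y‖ < 1 → ‖z‖ < 1 →
        HasSum
          (fun p : ℕ × ℕ × ℕ => (PlaneTree.markedCount p.1 p.2.1 p.2.2 : ℂ) *
            (x / (SingularExpansion.r : ℂ)) ^ p.1 *
            (y / (2 * (SingularExpansion.s : ℂ))) ^ p.2.1 *
            (z / (2 * (SingularExpansion.s : ℂ))) ^ p.2.2)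
          (f (x, ![y, z]))) ∧
      SingularExpansion.Approx f
        (2 * (SingularExpansion.q : ℂ) * (SingularExpansion.s : ℂ) ^ 2) (1 / 2) ![2, 2]) ∧
    (∀ L : ℝ, 0 < L → ∃ M : ℝ, 0 < M ∧ ∃ K : ℕ, ∀ n k : ℕ, K ≤ k → (k : ℝ) ≤ L * Real.log n →
      |(PlaneTree.markedCount n k k : ℝ) -
          2 * SingularExpansion.q * SingularExpansion.s ^ 2 / √Real.pi *
            SingularExpansion.r ^ ((n : ℤ) - (k : ℤ)) * (n : ℝ) ^ (-(1 / 2) : ℝ) * (k : ℝ) ^ 2| ≤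
        M * SingularExpansion.r ^ ((n : ℤ) - (k : ℤ)) * (n : ℝ) ^ (-(1 / 2) : ℝ) * (k : ℝ)) :=
  ⟨⟨PlaneTree.markedFun, fun _ _ _ hx hy hz => PlaneTree.hasSum_markedFun hx hy hz,
    PlaneTree.approx_markedFun⟩, PlaneTree.markedCount_asymptotics⟩
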